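/- **Setting.** Let $K\ge 1$. For each round $k=1,\dots,K$ there are a feature vector $\theta_k\in\mathbb R^d$ (fixed in advance) and a (possibly random) arm set $\mathcal D_k\subseteq\mathbb R^d$. The learner selects $a_k\in\mathcal D_k$ and observes $r_k=\langle\theta_k,a_k\rangle+\epsilon_k$, where almost surely $|\epsilon_k|\le R$, $\mathbb E[\epsilon_k\mid a_{1:k},\epsilon_{1:k-1}]=0$ and $\mathbb E[\epsilon_k^2\mid a_{1:k},\epsilon_{1:k-1}]=\sigma_k^2$; the $\sigma_k$ are not observed. Assume $\|a\|_2\le A$ and $\langle a,\theta_k\rangle\in[-1,1]$ for all $a\in\mathcal D_k$, $\|\theta_k\|_2\le B$, $\sum_{k=1}^{K-1}\|\theta_{k+1}-\theta_k\|_2\le B_K$, $\sum_{k=1}^K\sigma_k^2\le V_K$ (almost surely), and that $\langle\cdot,\theta_k\rangle$ attains its maximum over $\mathcal D_k$ at some $a_k^*\in\mathcal D_k$. The dynamic regret is $\mathrm{Regret}(K)=\sum_{k=1}^K(\langle a_k^*,\theta_k\rangle-\langle a_k,\theta_k\rangle)$. **Algorithm (Restarted SAVE$^+$).** Inputs: $\alpha>0$,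 $B$, $R$, $0<\delta<1$, an integer window $1\le w\le K$. Put $L=\max\{0,\lceil\log_2(1/\alpha)\rceil\}$, $[L]=\{1,\dots,L\}$, $\bar B=\max\{B,2\}$, $\|x\|_{S^{-1}}=\sqrt{x^\top S^{-1}x}$. Initially, and again at the beginning of each round $k$ divisible by $w$, set for all $\ell\in[L]$: $\hat\Sigma_\ell=2^{-2\ell}I$, $\hat b_\ell=0$, $\hat\theta_\ell=0$, $\hat\beta_\ell=2^{-\ell}\bar B$, $\hat\Psi_\ell=\emptyset$. In round $k$ choose $$a_k\in\arg\max_{a\in\mathcal D_k}\ \min_{\ell\in[L]}\big(\langle a,\hat\theta_\ell\rangle+\hat\beta_\ell\|a\|_{\hat\Sigma_\ell^{-1}}\big)$$ (any arm if $L=0$), ties broken arbitrarily, and observe $r_k$. If there is an $\ell\in[L]$ with $\|a_k\|_{\hat\Sigma_\ell^{-1}}\ge2^{-\ell}$, let $\ell$ be the smallest one, put $w_k=2^{-\ell}/\|a_k\|_{\hat\Sigma_\ell^{-1}}$, add $k$ to $\hat\Psi_\ell$, and update $\hat\Sigma_\ell\leftarrow\hat\Sigma_\ell+w_k^2a_ka_k^\top$,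 $\hat b_\ell\leftarrow\hat b_\ell+w_k^2r_ka_k$, $\hat\theta_\ell\leftarrow\hat\Sigma_\ell^{-1}\hat b_\ell$, and then $$\hat\beta_\ell\leftarrow16\cdot2^{-\ell}\sqrt{8\widehat{\mathrm{Var}}_\ell+6R^2\log\tfrac{4(w+1)^2L}{\delta}+2^{-2\ell+2}\bar B^2}\,\sqrt{\log\tfrac{4w^2L}{\delta}}+6\cdot2^{-\ell}R\log\tfrac{4w^2L}{\delta}+2^{-\ell}B,$$ where $\widehat{\mathrm{Var}}_\ell=\sum_{i\in\hat\Psi_\ell}w_i^2(r_i-\langle\hat\theta_\ell,a_i\rangle)^2$ if $2^\ell\ge64\sqrt{\log(4(w+1)^2L/\delta)}$, and $\widehat{\mathrm{Var}}_\ell=R^2|\hat\Psi_\ell|$ otherwise. All other layers stay unchanged. **Theorem.** There is an absolute integer $p\ge0$ such that the following holds. (i) For every $B$ there is a constant $C$, depending only on $B$, such that for all $d,K,\alpha,\delta,w,A,R,B_K,V_K$ and all instances as above, with probability at least $1-3\delta$ the regret of Restarted SAVE$^+$ satisfies $$\mathrm{Regret}(K)\le C\,\Lambda^p\Big(\frac{A^2\sqrt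 d\,w^{3/2}B_K}{\alpha}+(w\alpha^2+d)\sqrt{\frac KwV_K}+(1+R)\Big(K\alpha^2+\frac{Kd}{w}\Big)\Big),$$ where $\Lambda=1+\log K+\log(1+A)+\log(1+1/\alpha)+\log(1/\delta)$. (ii) For all $A,B,R$ there is a constant $C$, depending only on $A,B,R$, such that under the same conditions, with probability at least $1-3\delta$, $$\mathrm{Regret}(K)\le C\,\Lambda_0^p\Big(\frac{\sqrt d\,w^{3/2}B_K}{\alpha}+\alpha^2\big(K+\sqrt{wKV_K}\big)+d\sqrt{\frac{KV_K}{w}}+\frac{dK}{w}\Big),$$ where $\Lambda_0=1+\log K+\log(1+1/\alpha)+\log(1/\delta)$. -/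

import Mathlib

open MeasureTheory

noncomputable section

namespace RestartedSAVE

/-- The feature space `ℝ^d` with the Euclidean norm. -/
abbrev Vec (d : ℕ) : Type := EuclideanSpace ℝ (Fin d)

/-- The inputs of the algorithm: restart window size `w`, layer parameter `α`, the upper bound `B`
on the norms of the feature vectors, the noise bound `R` and the confidence level `δ`. -/
structure Params where
  w : ℕ
  α : ℝ
  B : ℝ
  R : ℝ
  δ : ℝ

/-- The number of layers `L = ⌈log₂ (1 / α)⌉` (there are no layers if `1 ≤ α`). -/
def Params.L (P : Params) : ℕ := ⌈Real.logb 2 (1 / P.α)⌉₊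

/-- `2^{-ℓ}`. -/
def lev (ℓ : ℕ) : ℝ := (2 : ℝ) ^ (-(ℓ : ℤ))

/-- `‖x‖_{S⁻¹} = √(xᵀ S⁻¹ x)`. -/
def invNorm {d : ℕ} (S : Matrix (Fin d) (Fin d) ℝ) (x : Vec d) : ℝ :=
  Real.sqrt (x.ofLp ⬝ᵥ (S⁻¹).mulVec x.ofLp)

/-- The data kept for one layer: the matrix `Σ̂`, the vector `b̂`, the estimate `θ̂`, the confidence
radius `β̂`, the set `Ψ̂` of the rounds (since the last restart) assigned to the layer, and the
weights `w_i` of these rounds. -/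
structure Layer (d : ℕ) where
  Sig : Matrix (Fin d) (Fin d) ℝ
  b : Vec d
  est : Vec d
  radius : ℝ
  rounds : Finset ℕ
  weight : ℕ → ℝ

/-- The state of the algorithm: the data of all layers, indexed by `ℓ = 1, …, L`
(the entry `L + 1` is used only to record the rounds that fall in no layer). -/
abbrev State (d : ℕ) : Type := ℕ → Layer d

/-- `max {B, 2}`; equal to `2` in the normalised case `B ≤ 2`. -/
def Params.Bmax (P : Params) : ℝ := max P.B 2

/-- The state at the beginning and after a restart. The initial radius is `2^{-ℓ} max {B, 2}`,
which is `2^{-ℓ+1}` for `B ≤ 2`. -/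
def initState (d : ℕ) (P : Params) : State d := fun ℓ =>
  { Sig := (lev ℓ ^ 2) • (1 : Matrix (Fin d) (Fin d) ℝ)
    b := 0
    est := 0
    radius := lev ℓ * P.Bmax
    rounds := ∅
    weight := fun _ => 0 }

/-- The variance estimate of layer `ℓ`. Here `a i` and `r i` are the arm and the reward of
round `i`. -/
def varEst {d : ℕ} (P : Params) (a : ℕ → Vec d) (r : ℕ → ℝ) (ℓ : ℕ)
    (est : Vec d) (rounds : Finset ℕ) (weight : ℕ → ℝ) : ℝ :=
  open Classical in
  if 64 * Real.sqrt (Real.log (4 * ((P.w : ℝ) + 1) ^ 2 * P.L / P.δ)) ≤ (2 : ℝ) ^ ℓ then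
    ∑ i ∈ rounds, weight i ^ 2 * (r i - inner ℝ est (a i)) ^ 2
  else P.R ^ 2 * (rounds.card : ℝ)

/-- The adaptive confidence radius of layer `ℓ`. The summand `2^{-2ℓ+2} max {B, 2}²` under the
square root is `2^{-2ℓ+4}` for `B ≤ 2`. -/
def confRadius {d : ℕ} (P : Params) (a : ℕ → Vec d) (r : ℕ → ℝ) (ℓ : ℕ)
    (est : Vec d) (rounds : Finset ℕ) (weight : ℕ → ℝ) : ℝ :=
  16 * lev ℓ *
      Real.sqrt (8 * varEst P a r ℓ est rounds weight
        + 6 * P.R ^ 2 * Real.log (4 * ((P.w : ℝ) + 1) ^ 2 * P.L / P.δ)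
        + 4 * lev ℓ ^ 2 * P.Bmax ^ 2) *
      Real.sqrt (Real.log (4 * (P.w : ℝ) ^ 2 * P.L / P.δ))
    + 6 * lev ℓ * P.R * Real.log (4 * (P.w : ℝ) ^ 2 * P.L / P.δ)
    + lev ℓ * P.B

/-- The optimistic index of an arm `x`,
`min_{ℓ ∈ [L]} (⟨x, θ̂_ℓ⟩ + β̂_ℓ ‖x‖_{Σ̂_ℓ⁻¹})`
(a minimum over a finite set; if there is no layer, all arms have the same index). -/
def index {d : ℕ} (P : Params) (s : State d) (x : Vec d) : ℝ :=
  ⨅ ℓ : {ℓ : ℕ // ℓ ∈ Finset.Icc 1 P.L},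
    (inner ℝ x (s ℓ).est + (s ℓ).radius * invNorm (s ℓ).Sig x)

/-- The layers `ℓ ∈ [L]` in which the arm `x` is uncertain: `‖x‖_{Σ̂_ℓ⁻¹} ≥ 2^{-ℓ}`. -/
def uncertain {d : ℕ} (P : Params) (s : State d) (x : Vec d) : Finset ℕ :=
  open Classical in
  (Finset.Icc 1 P.L).filter (fun ℓ => lev ℓ ≤ invNorm (s ℓ).Sig x)

/-- The update at the end of round `k`, in which the arms and rewards are `a k` and `r k`. -/
def update {d : ℕ} (P : Params) (a : ℕ → Vec d) (r : ℕ → ℝ) (k : ℕ) (s : State d) : State d :=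
  open Classical in
  if h : (uncertain P s (a k)).Nonempty then
    let ℓ := (uncertain P s (a k)).min' h
    let c : ℝ := lev ℓ / invNorm (s ℓ).Sig (a k)
    let Sig' := (s ℓ).Sig + c ^ 2 • Matrix.vecMulVec (a k).ofLp (a k).ofLp
    let b' : Vec d := (s ℓ).b + (c ^ 2 * r k) • a k
    let est' : Vec d := WithLp.toLp 2 ((Sig'⁻¹).mulVec b'.ofLp)
    let rounds' := insert k (s ℓ).rounds
    let weight' := Function.update (s ℓ).weight k c
    Function.update s ℓ
      { Sig := Sig'
        b := b'
        est := est'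
        radius := confRadius P a r ℓ est' rounds' weight'
        rounds := rounds'
        weight := weight' }
  else
    Function.update s (P.L + 1)
      { s (P.L + 1) with rounds := insert k (s (P.L + 1)).rounds }

/-- The state with which the arm of round `k` is selected, for `k = 1, 2, …`; the algorithm
restarts at the beginning of every round `k` that is divisible by `w`. -/
def stateAt {d : ℕ} (P : Params) (a : ℕ → Vec d) (r : ℕ → ℝ) : ℕ → State d
  | 0 => initState d P
  | k + 1 =>
    if (k + 1) % P.w = 0 ∨ k = 0 then initState d P
    else update P a r k (stateAt P a r k)

/-- The `σ`-algebra generated by the arms `a_1, …, a_k` and the noises `ε_1, …, ε_{k-1}`. -/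
@[reducible]
def history {Ω : Type*} {d : ℕ} (a : ℕ → Ω → Vec d) (ε : ℕ → Ω → ℝ) (k : ℕ) :
    MeasurableSpace Ω :=
  (⨆ i ∈ Finset.Icc 1 k, MeasurableSpace.comap (a i) inferInstance) ⊔
    (⨆ i ∈ Finset.Ico 1 k, MeasurableSpace.comap (ε i) inferInstance)

/-- The non-stationary heteroscedastic linear contextual bandit over the rounds `1, …, K`, on a
probability space `(Ω, μ)`: feature vectors `θ k` fixed in advance, arm sets `D k`, selected arms
`a k`, optimal arms `aStar k`, noises `ε k` with conditional variances `(σ k)²`,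
norm bounds `A` (arms) and `B` (features), noise bound `R`,
total variation budget `BK` and total variance `VK`. -/
structure IsBandit {Ω : Type*} [MeasurableSpace Ω] (μ : Measure Ω) {d : ℕ} (K : ℕ)
    (A B R BK VK : ℝ) (θ : ℕ → Vec d) (D : ℕ → Ω → Set (Vec d))
    (a aStar : ℕ → Ω → Vec d) (ε σ : ℕ → Ω → ℝ) : Prop where
  measurable_arm : ∀ k ∈ Finset.Icc 1 K, Measurable (a k)
  measurable_noise : ∀ k ∈ Finset.Icc 1 K, Measurable (ε k)
  arm_mem : ∀ k ∈ Finset.Icc 1 K, ∀ ω, a k ω ∈ D k ω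
  star_mem : ∀ k ∈ Finset.Icc 1 K, ∀ ω, aStar k ω ∈ D k ω
  star_max : ∀ k ∈ Finset.Icc 1 K, ∀ ω, IsMaxOn (fun x => inner ℝ x (θ k)) (D k ω) (aStar k ω)
  norm_arm : ∀ k ∈ Finset.Icc 1 K, ∀ ω, ∀ x ∈ D k ω, ‖x‖ ≤ A
  mean_reward : ∀ k ∈ Finset.Icc 1 K, ∀ ω, ∀ x ∈ D k ω, inner ℝ x (θ k) ∈ Set.Icc (-1 : ℝ) 1
  norm_feature : ∀ k ∈ Finset.Icc 1 K, ‖θ k‖ ≤ B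
  noise_bdd : ∀ k ∈ Finset.Icc 1 K, ∀ᵐ ω ∂μ, |ε k ω| ≤ R
  noise_mean : ∀ k ∈ Finset.Icc 1 K, μ[ε k | history a ε k] =ᵐ[μ] fun _ => 0
  noise_var : ∀ k ∈ Finset.Icc 1 K,
    μ[fun ω => ε k ω ^ 2 | history a ε k] =ᵐ[μ] fun ω => σ k ω ^ 2
  variation : ∑ k ∈ Finset.Ico 1 K, ‖θ (k + 1) - θ k‖ ≤ BK
  variance : ∀ᵐ ω ∂μ, ∑ k ∈ Finset.Icc 1 K, σ k ω ^ 2 ≤ VK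

/-- The reward `r_k = ⟨θ_k, a_k⟩ + ε_k`. -/
def reward {Ω : Type*} {d : ℕ} (θ : ℕ → Vec d) (a : ℕ → Ω → Vec d) (ε : ℕ → Ω → ℝ)
    (ω : Ω) (k : ℕ) : ℝ :=
  inner ℝ (θ k) (a k ω) + ε k ω

/-- The arms of the rounds `1, …, K` are selected by the algorithm: in every round the arm
maximises the optimistic index over the arm set (ties are broken arbitrarily). -/
def FollowsAlgorithm {Ω : Type*} {d : ℕ} (P : Params) (K : ℕ) (θ : ℕ → Vec d)
    (D : ℕ → Ω → Set (Vec d)) (a : ℕ → Ω → Vec d) (ε : ℕ → Ω → ℝ) : Prop :=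
  ∀ k ∈ Finset.Icc 1 K, ∀ ω,
    IsMaxOn (index P (stateAt P (fun i => a i ω) (reward θ a ε ω) k)) (D k ω) (a k ω)

/-- The dynamic regret over the rounds `1, …, K`. -/
def regret {Ω : Type*} {d : ℕ} (K : ℕ) (θ : ℕ → Vec d) (a aStar : ℕ → Ω → Vec d) (ω : Ω) : ℝ :=
  ∑ k ∈ Finset.Icc 1 K, (inner ℝ (aStar k ω) (θ k) - inner ℝ (a k ω) (θ k))

/-- `X ≤ c` with probability at least `p`. -/
def HoldsWithProb {Ω : Type*} [MeasurableSpace Ω] (μ : Measure Ω) (p : ℝ) (X : Ω → ℝ) (c : ℝ) :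
    Prop :=
  ∃ G : Set Ω, MeasurableSet G ∧ ENNReal.ofReal p ≤ μ G ∧ ∀ ω ∈ G, X ω ≤ c

end RestartedSAVE

end

/-! Fix an epoch, the stretch between two restarts. Layer ℓ is a weighted ridge regression, and its
weights give every arm it receives norm exactly ρ = 2^{-ℓ} with respect to the current Σ̂_ℓ⁻¹.
Measured against the current feature θ_k, the vector b̂_ℓ − Σ̂_ℓ θ_k splits into weighted noise, a
drift caused by θ_i ≠ θ_k, and the regularisation −ρ²θ_k (`estError_le`). The drift has size at most
√w · A times the variation inside the epoch, and the regularisation at most ρB.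

Noise. The squared self-normalised noise grows by a martingale increment plus ρ² times the weighted
squared noise (`noiseNorm_sq_le`). Since exp(y − y²) ≤ 1 + y for |y| ≤ 1/2, the process exp(∑ (p_i
ε_i − (p_i ε_i)²)) is a supermartingale for predictable, suitably bounded p_i. The martingale is
thus compared with its realised quadratic variation, and the unobserved σ_k do not enter. A
bootstrap (`noiseNorm_le_threshold`) and a grid of values for the noise energy V give `GoodEpoch`:
the noise is O(ρ(√((V + R²) log) + R log)). In layers with 64 ρ √log ≤ 1, V may be replaced by the
observed residuals: the two square roots differ by drift plus estimation error, and the noise part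
of that error is a small fraction of √V up to terms in R. In coarser layers V is bounded by R² times
the number of rounds. Hence the radius covers the estimation error up to drift
(`estError_le_radius`), and in the fine layers it is not too large (`radius_le`).

Regret. If the selected arm goes to layer ℓ + 1, it was certain in layer ℓ. Optimism bounds its
regret by twice radius times norm plus drift, that is by O(4^{-ℓ} log · (√energy + R + B̄)) plus
drift (`IsPath.gap_le_of_good`). In the coarse layers 4^{-ℓ} log is bounded below, so the trivial
bound 2 suffices. Each round multiplies det Σ̂_ℓ by exactly 1 + ρ², so a layer receives O(4^ℓ d log)
rounds per epoch (`IsPath.card_roundSet_mul_le`); summing over layers gives `IsPath.sum_lev_sq_le`.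
Cauchy–Schwarz over the epochs and a second exponential supermartingale, which bounds ∑ ε_k² by 2V_K
+ (1 + R)² log(1/δ), produce the variance term.

Bad epochs. The radius contains no log K, so in general a union bound over all epochs is not
available. Instead each epoch is bad with probability at most δ/w, and by Markov's inequality at
most a fraction 1/w of the epochs is bad, outside an event of probability δ
(`measureReal_card_gt_le`). A bad epoch costs at most 2w, so together they cost at most twice the
number of epochs, which the term Kd/w absorbs. -/

namespace RestartedSAVE

/-! ### Norms weighted by an inverse matrix, design matrices and rank-one updates -/

/-- The linear map `x ↦ M x` on the Euclidean space. -/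
noncomputable def act {d : ℕ} (M : Matrix (Fin d) (Fin d) ℝ) : Vec d →ₗ[ℝ] Vec d where
  toFun x := WithLp.toLp 2 (M.mulVec x.ofLp)
  map_add' x y := by simp [Matrix.mulVec_add]
  map_smul' c x := by simp [Matrix.mulVec_smul]

theorem act_apply {d : ℕ} (M : Matrix (Fin d) (Fin d) ℝ) (x : Vec d) :
    act M x = WithLp.toLp 2 (M.mulVec x.ofLp) := rfl

theorem inner_eq_dotProduct {d : ℕ} (x y : Vec d) : inner ℝ x y = x.ofLp ⬝ᵥ y.ofLp := by
  rw [EuclideanSpace.inner_eq_star_dotProduct, dotProduct_comm]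
  simp

theorem act_mul {d : ℕ} (M N : Matrix (Fin d) (Fin d) ℝ) (x : Vec d) :
    act (M * N) x = act M (act N x) := by
  simp [act_apply, Matrix.mulVec_mulVec]

theorem inner_act_symm {d : ℕ} {M : Matrix (Fin d) (Fin d) ℝ} (hM : M.PosDef) (x y : Vec d) :
    inner ℝ (act M x) y = inner ℝ x (act M y) := by
  have h : M.transpose = M := by
    have := hM.isHermitian
    rwa [Matrix.IsHermitian, Matrix.conjTranspose_eq_transpose_of_trivial] at this
  rw [inner_eq_dotProduct, inner_eq_dotProduct, act_apply, act_apply]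
  simp only
  rw [Matrix.dotProduct_mulVec, ← Matrix.mulVec_transpose, h]

theorem act_act_inv {d : ℕ} {M : Matrix (Fin d) (Fin d) ℝ} (hM : M.PosDef) (x : Vec d) :
    act M (act M⁻¹ x) = x := by
  have h : IsUnit M.det := (Matrix.isUnit_iff_isUnit_det M).1 hM.isUnit
  rw [← act_mul, Matrix.mul_nonsing_inv _ h]
  simp [act_apply]

theorem act_inv_act {d : ℕ} {M : Matrix (Fin d) (Fin d) ℝ} (hM : M.PosDef) (x : Vec d) :
    act M⁻¹ (act M x) = x := by
  have h : IsUnit M.det := (Matrix.isUnit_iff_isUnit_det M).1 hM.isUnit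
  rw [← act_mul, Matrix.nonsing_inv_mul _ h]
  simp [act_apply]

theorem inner_act_self_nonneg {d : ℕ} {M : Matrix (Fin d) (Fin d) ℝ} (hM : M.PosDef) (x : Vec d) :
    0 ≤ inner ℝ x (act M x) := by
  rw [inner_eq_dotProduct]
  have h := hM.posSemidef.dotProduct_mulVec_nonneg x.ofLp
  rw [star_trivial] at h
  exact h

theorem invNorm_eq {d : ℕ} (M : Matrix (Fin d) (Fin d) ℝ) (x : Vec d) :
    invNorm M x = Real.sqrt (inner ℝ x (act M⁻¹ x)) := by
  rw [inner_eq_dotProduct]; rfl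

theorem invNorm_nonneg {d : ℕ} (M : Matrix (Fin d) (Fin d) ℝ) (x : Vec d) : 0 ≤ invNorm M x :=
  Real.sqrt_nonneg _

theorem invNorm_sq {d : ℕ} {M : Matrix (Fin d) (Fin d) ℝ} (hM : M.PosDef) (x : Vec d) :
    invNorm M x ^ 2 = inner ℝ x (act M⁻¹ x) := by
  rw [invNorm_eq, Real.sq_sqrt (inner_act_self_nonneg hM.inv x)]

theorem abs_inner_act_inv_le {d : ℕ} {M : Matrix (Fin d) (Fin d) ℝ} (hM : M.PosDef)
    (x y : Vec d) : |inner ℝ x (act M⁻¹ y)| ≤ invNorm M x * invNorm M y := by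
  refine abs_le_of_sq_le_sq ?_ (mul_nonneg (invNorm_nonneg _ _) (invNorm_nonneg _ _))
  rw [mul_pow, invNorm_sq hM, invNorm_sq hM]
  have key : inner ℝ x (act M⁻¹ y) * inner ℝ y (act M⁻¹ x) ≤
      inner ℝ x (act M⁻¹ x) * inner ℝ y (act M⁻¹ y) := LinearMap.BilinForm.apply_mul_apply_le_of_forall_zero_le
    ((innerₗ (Vec d)).compl₂ (act M⁻¹)) (fun x => inner_act_self_nonneg hM.inv x) x y
  rw [← inner_act_symm hM.inv y x, real_inner_comm] at key
  rwa [sq, real_inner_comm (act M⁻¹ y) x]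

theorem invNorm_smul {d : ℕ} (M : Matrix (Fin d) (Fin d) ℝ) (c : ℝ) (x : Vec d) :
    invNorm M (c • x) = |c| * invNorm M x := by
  rw [invNorm_eq, invNorm_eq, map_smul, inner_smul_left, inner_smul_right, ← mul_assoc,
    conj_trivial, Real.sqrt_mul (mul_self_nonneg c), Real.sqrt_mul_self_eq_abs]

theorem invNorm_add_le {d : ℕ} {M : Matrix (Fin d) (Fin d) ℝ} (hM : M.PosDef) (x y : Vec d) :
    invNorm M (x + y) ≤ invNorm M x + invNorm M y := by
  refine abs_le_of_sq_le_sq' ?_ (add_nonneg (invNorm_nonneg _ _) (invNorm_nonneg _ _)) |>.2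
  rw [invNorm_sq hM, map_add, inner_add_left, inner_add_right, inner_add_right, add_sq,
    invNorm_sq hM, invNorm_sq hM, ← inner_act_symm hM.inv y x, real_inner_comm x (act M⁻¹ y)]
  have := (le_abs_self _).trans (abs_inner_act_inv_le hM x y)
  linarith

/-- The regularised design matrix `λ I + ∑ xᵢ xᵢᵀ`. -/
noncomputable def design {d : ℕ} {ι : Type*} (lam : ℝ) (s : Finset ι) (x : ι → Vec d) :
    Matrix (Fin d) (Fin d) ℝ :=
  lam • (1 : Matrix (Fin d) (Fin d) ℝ) + ∑ i ∈ s, Matrix.vecMulVec (x i).ofLp (x i).ofLp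

theorem act_design {d : ℕ} {ι : Type*} (lam : ℝ) (s : Finset ι) (x : ι → Vec d) (g : Vec d) :
    act (design lam s x) g = lam • g + ∑ i ∈ s, inner ℝ (x i) g • x i := by
  apply WithLp.ofLp_injective
  rw [act_apply, design]
  simp only [Matrix.add_mulVec, Matrix.sum_mulVec, Matrix.smul_mulVec, Matrix.one_mulVec,
    Matrix.vecMulVec_mulVec, WithLp.ofLp_add, WithLp.ofLp_smul, WithLp.ofLp_sum,
    inner_eq_dotProduct, op_smul_eq_smul]

theorem posDef_design {d : ℕ} {ι : Type*} {lam : ℝ} (hl : 0 < lam) (s : Finset ι)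
    (x : ι → Vec d) : (design lam s x).PosDef := by
  refine Matrix.PosDef.add_posSemidef (Matrix.PosDef.smul Matrix.PosDef.one hl)
    (Matrix.posSemidef_sum _ fun i _ => ?_)
  simpa using Matrix.posSemidef_vecMulVec_self_star (x i).ofLp

theorem inner_act_design {d : ℕ} {ι : Type*} (lam : ℝ) (s : Finset ι) (x : ι → Vec d) (g : Vec d) :
    inner ℝ g (act (design lam s x) g) = lam * ‖g‖ ^ 2 + ∑ i ∈ s, inner ℝ (x i) g ^ 2 := by
  rw [act_design, inner_add_right, inner_smul_right, real_inner_self_eq_norm_sq, inner_sum]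
  congr 1
  refine Finset.sum_congr rfl fun i _ => ?_
  rw [inner_smul_right, real_inner_comm, sq]

/-- With q = M⁻¹g and M the design matrix, ⟨q, M q⟩ is the left side plus λ‖q‖², and it equals the
squared norm on the right. -/
theorem sum_inner_sq_le {d : ℕ} {ι : Type*} {lam : ℝ} (hl : 0 < lam) (s : Finset ι)
    (x : ι → Vec d) (g : Vec d) :
    ∑ i ∈ s, inner ℝ (x i) (act (design lam s x)⁻¹ g) ^ 2 ≤ invNorm (design lam s x) g ^ 2 := by
  have hM := posDef_design hl s x
  have h := inner_act_design lam s x (act (design lam s x)⁻¹ g)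
  rw [act_act_inv hM, real_inner_comm, ← invNorm_sq hM] at h
  nlinarith [mul_nonneg hl.le (sq_nonneg ‖act (design lam s x)⁻¹ g‖)]

/-- Dual to `sum_inner_sq_le`: pair the sum with M⁻¹ of itself and apply Cauchy–Schwarz. Used for
the drift, whose cost is therefore free of the dimension. -/
theorem invNorm_sum_smul_le {d : ℕ} {ι : Type*} {lam : ℝ} (hl : 0 < lam) (s : Finset ι)
    (x : ι → Vec d) (v : ι → ℝ) :
    invNorm (design lam s x) (∑ i ∈ s, v i • x i) ≤ Real.sqrt (∑ i ∈ s, v i ^ 2) := by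
  have hM := posDef_design hl s x
  set g := ∑ i ∈ s, v i • x i with hg
  set n := invNorm (design lam s x) g with hn
  have h0 : 0 ≤ n := invNorm_nonneg _ _
  have h1 : n ^ 2 ≤ Real.sqrt (∑ i ∈ s, v i ^ 2) * n := by
    rw [hn, invNorm_sq hM]
    conv_lhs => rw [hg, sum_inner]
    simp only [inner_smul_left, conj_trivial]
    refine (Real.sum_mul_le_sqrt_mul_sqrt s v _).trans ?_
    refine mul_le_mul_of_nonneg_left ?_ (Real.sqrt_nonneg _)
    exact Real.sqrt_le_iff.2 ⟨h0, sum_inner_sq_le hl s x g⟩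
  rcases h0.eq_or_lt with h | h
  · rw [← h]; exact Real.sqrt_nonneg _
  · rw [sq] at h1
    exact le_of_mul_le_mul_right h1 h

theorem sqrt_mul_invNorm_le {d : ℕ} {ι : Type*} {lam : ℝ} (hl : 0 < lam) (s : Finset ι)
    (x : ι → Vec d) (g : Vec d) :
    Real.sqrt lam * invNorm (design lam s x) g ≤ ‖g‖ := by
  have hM := posDef_design hl s x
  set n := invNorm (design lam s x) g with hn
  set q := act (design lam s x)⁻¹ g with hq
  have h0 : 0 ≤ n := invNorm_nonneg _ _
  have h := inner_act_design lam s x q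
  rw [act_act_inv hM, real_inner_comm, ← invNorm_sq hM, ← hn] at h
  have h2 : 0 ≤ ∑ i ∈ s, inner ℝ (x i) q ^ 2 := Finset.sum_nonneg fun i _ => sq_nonneg _
  have h3 : n ^ 2 ≤ ‖g‖ * ‖q‖ := by
    rw [hn, invNorm_sq hM]; exact real_inner_le_norm _ _
  refine abs_le_of_sq_le_sq' ?_ (norm_nonneg _) |>.2
  rw [mul_pow, Real.sq_sqrt hl.le]
  rcases h0.eq_or_lt with h' | h'
  · rw [← h']; simp
  have h4 : n ^ 2 * (lam * n ^ 2) ≤ n ^ 2 * ‖g‖ ^ 2 := by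
    have : (n ^ 2) ^ 2 ≤ (‖g‖ * ‖q‖) ^ 2 := pow_le_pow_left₀ (sq_nonneg _) h3 2
    have h5 : lam * ‖q‖ ^ 2 ≤ n ^ 2 := by linarith
    calc n ^ 2 * (lam * n ^ 2) = lam * (n ^ 2) ^ 2 := by ring
      _ ≤ lam * (‖g‖ * ‖q‖) ^ 2 := mul_le_mul_of_nonneg_left this hl.le
      _ = (lam * ‖q‖ ^ 2) * ‖g‖ ^ 2 := by ring
      _ ≤ n ^ 2 * ‖g‖ ^ 2 := mul_le_mul_of_nonneg_right h5 (sq_nonneg _)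
  exact le_of_mul_le_mul_left h4 (by positivity)

/-- One step of the recursion for the self-normalised noise: the new squared norm of
`N + η x` with respect to `M + x xᵀ`. -/
theorem invNorm_add_rankOne_sq_le {d : ℕ} {M M' : Matrix (Fin d) (Fin d) ℝ} (hM : M.PosDef)
    (hM' : M'.PosDef) {x : Vec d} (h : M' = M + Matrix.vecMulVec x.ofLp x.ofLp)
    (N : Vec d) (η : ℝ) :
    invNorm M' (N + η • x) ^ 2 ≤ invNorm M N ^ 2 +
      (2 * η * inner ℝ x (act M⁻¹ N) + 2 * invNorm M x ^ 2 * η ^ 2) / (1 + invNorm M x ^ 2) := by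
  have hact : ∀ g, act M' g = act M g + inner ℝ x g • x := by
    intro g
    apply WithLp.ofLp_injective
    simp only [h, act_apply, Matrix.add_mulVec, Matrix.vecMulVec_mulVec, WithLp.ofLp_add,
      WithLp.ofLp_smul, inner_eq_dotProduct, op_smul_eq_smul]
  set ρ2 := invNorm M x ^ 2 with hρ
  have hρ0 : 0 ≤ ρ2 := sq_nonneg _
  -- Sherman–Morrison in the only direction needed: M'⁻¹x is a multiple of M⁻¹x.
  have hinvx : (1 + ρ2) • act M'⁻¹ x = act M⁻¹ x := by
    have : act M' (act M⁻¹ x) = (1 + ρ2) • x := by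
      rw [hact, act_act_inv hM, ← invNorm_sq hM, add_smul, one_smul]
    rw [← map_smul, ← this, act_inv_act hM']
  set v := act M'⁻¹ (N + η • x) with hv
  have hxv : (1 + ρ2) * inner ℝ x v = inner ℝ x (act M⁻¹ N) + η * ρ2 := by
    rw [hv, ← inner_act_symm hM'.inv, ← real_inner_smul_left, hinvx, inner_act_symm hM.inv,
      map_add, inner_add_right, map_smul, inner_smul_right, hρ, invNorm_sq hM]
  have hQ' : invNorm M' (N + η • x) ^ 2 = 2 * inner ℝ v (N + η • x) - inner ℝ v (act M' v) := by
    rw [invNorm_sq hM', ← hv, real_inner_comm]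
    have : act M' v = N + η • x := by rw [hv, act_act_inv hM']
    rw [this]; ring
  -- The squared norm of N is the maximum over v of 2⟨v, N⟩ − ⟨v, M v⟩; evaluating it at the
  -- maximiser v for M' leaves only terms in ⟨x, v⟩, and −⟨x, v⟩² is dropped at the end.
  have hQ : 2 * inner ℝ v N - inner ℝ v (act M v) ≤ invNorm M N ^ 2 := by
    have := inner_act_self_nonneg hM (v - act M⁻¹ N)
    rw [map_sub, act_act_inv hM, inner_sub_left, inner_sub_right, inner_sub_right,
      inner_act_symm hM.inv, act_inv_act hM, inner_act_symm hM.inv, ← invNorm_sq hM,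
      real_inner_comm v N] at this
    linarith
  rw [hQ', hact, inner_add_right, inner_add_right, inner_smul_right, inner_smul_right]
  have e : inner ℝ v x = inner ℝ x v := real_inner_comm _ _
  rw [e]
  have hpos : 0 < 1 + ρ2 := by linarith
  have e2 : inner ℝ x v = (inner ℝ x (act M⁻¹ N) + η * ρ2) / (1 + ρ2) := by
    rw [eq_div_iff hpos.ne', mul_comm]; exact hxv
  have e3 : (2 * η * inner ℝ x (act M⁻¹ N) + 2 * ρ2 * η ^ 2) / (1 + ρ2) = 2 * η * inner ℝ x v := by
    rw [e2]; ring
  rw [e3]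
  nlinarith [mul_self_nonneg (inner ℝ x v)]

theorem det_add_rankOne {d : ℕ} {M : Matrix (Fin d) (Fin d) ℝ} (hM : M.PosDef) (x : Vec d) :
    (M + Matrix.vecMulVec x.ofLp x.ofLp).det = M.det * (1 + invNorm M x ^ 2) := by
  have h : IsUnit M.det := (Matrix.isUnit_iff_isUnit_det M).1 hM.isUnit
  rw [Matrix.vecMulVec_eq Unit, Matrix.det_add_replicateCol_mul_replicateRow h, invNorm_sq hM,
    inner_eq_dotProduct, act_apply]
  congr 1
  rw [Matrix.det_unique, Matrix.add_apply, Matrix.one_apply_eq, Matrix.mul_assoc,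
    Matrix.mul_apply_eq_vecMul]
  rfl

/-- Every eigenvalue is the value of the quadratic form at a unit eigenvector, hence at most λ plus
the sum of the ‖xᵢ‖². -/
theorem det_design_le {d : ℕ} {ι : Type*} {lam A : ℝ} (hl : 0 < lam) (s : Finset ι)
    (x : ι → Vec d) (hx : ∀ i ∈ s, ‖x i‖ ≤ A) :
    (design lam s x).det ≤ (lam + s.card * A ^ 2) ^ d := by
  have hM := posDef_design hl s x
  have hH := hM.isHermitian
  have hb : ∀ j, hH.eigenvalues j ≤ lam + s.card * A ^ 2 := by
    intro j
    set g := hH.eigenvectorBasis j with hg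
    have hn : ‖g‖ = 1 := hH.eigenvectorBasis.orthonormal.1 j
    have h1 := inner_act_design lam s x g
    have h2 : act (design lam s x) g = hH.eigenvalues j • g := by
      apply WithLp.ofLp_injective
      exact hH.mulVec_eigenvectorBasis j
    rw [h2, inner_smul_right, real_inner_self_eq_norm_sq, hn, one_pow, mul_one, mul_one] at h1
    rw [h1]
    have h3 : ∑ i ∈ s, inner ℝ (x i) g ^ 2 ≤ ∑ _i ∈ s, A ^ 2 := by
      refine Finset.sum_le_sum fun i hi => ?_
      rw [← sq_abs]
      refine pow_le_pow_left₀ (abs_nonneg _) ?_ 2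
      calc |inner ℝ (x i) g| ≤ ‖x i‖ * ‖g‖ := abs_real_inner_le_norm _ _
        _ ≤ A := by rw [hn, mul_one]; exact hx i hi
    simpa using h3
  rw [hH.det_eq_prod_eigenvalues]
  refine (Finset.prod_le_prod (fun j _ => (hM.posSemidef.eigenvalues_nonneg j))
    (fun j _ => hb j)).trans ?_
  simp

/-! ### Dyadic scales and the layer of an arm -/

theorem lev_pos (ℓ : ℕ) : 0 < lev ℓ := by unfold lev; positivity

theorem lev_eq (ℓ : ℕ) : lev ℓ = ((2 : ℝ) ^ ℓ)⁻¹ := by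
  rw [lev, zpow_neg, zpow_natCast]

theorem lev_le_one (ℓ : ℕ) : lev ℓ ≤ 1 := by
  rw [lev_eq]; exact inv_le_one_of_one_le₀ (one_le_pow₀ (by norm_num))

theorem lev_zero : lev 0 = 1 := by simp [lev]

theorem lev_succ (ℓ : ℕ) : lev (ℓ + 1) = lev ℓ / 2 := by
  rw [lev_eq, lev_eq, pow_succ, mul_inv]; ring

/-- The smallest layer in which the arm `x` is uncertain, and `L + 1` if there is none. -/
noncomputable def level {d : ℕ} (P : Params) (s : State d) (x : Vec d) : ℕ :=
  open Classical in
  if h : (uncertain P s x).Nonempty then (uncertain P s x).min' h else P.L + 1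

theorem mem_uncertain {d : ℕ} {P : Params} {s : State d} {x : Vec d} {ℓ : ℕ} :
    ℓ ∈ uncertain P s x ↔ ℓ ∈ Finset.Icc 1 P.L ∧ lev ℓ ≤ invNorm (s ℓ).Sig x := by
  classical
  rw [uncertain, Finset.mem_filter]

theorem level_mem {d : ℕ} (P : Params) (s : State d) (x : Vec d) :
    level P s x ∈ Finset.Icc 1 (P.L + 1) := by
  unfold level
  split_ifs with h
  · have := (mem_uncertain.1 (Finset.min'_mem _ h)).1
    rw [Finset.mem_Icc] at this ⊢
    omega
  · simp

theorem lev_le_invNorm_of_level {d : ℕ} {P : Params} {s : State d} {x : Vec d} {ℓ : ℕ}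
    (hℓ : ℓ ∈ Finset.Icc 1 P.L) (h : level P s x = ℓ) : lev ℓ ≤ invNorm (s ℓ).Sig x := by
  unfold level at h
  split_ifs at h with h'
  · have := (mem_uncertain.1 (Finset.min'_mem _ h')).2
    rwa [h] at this
  · rw [Finset.mem_Icc] at hℓ; omega

theorem invNorm_lt_of_lt_level {d : ℕ} {P : Params} {s : State d} {x : Vec d} {ℓ : ℕ}
    (hℓ : ℓ ∈ Finset.Icc 1 P.L) (h : ℓ < level P s x) : invNorm (s ℓ).Sig x < lev ℓ := by
  by_contra hc
  have hm : ℓ ∈ uncertain P s x := mem_uncertain.2 ⟨hℓ, not_lt.1 hc⟩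
  have hne : (uncertain P s x).Nonempty := ⟨ℓ, hm⟩
  rw [level, dif_pos hne] at h
  exact absurd (Finset.min'_le _ _ hm) (not_le.2 h)

/-- Expresses the layer through finitely many norm inequalities, which is what makes the layer
assignment measurable. -/
theorem level_eq_iff {d : ℕ} {P : Params} {s : State d} {x : Vec d} {ℓ : ℕ}
    (hℓ : ℓ ∈ Finset.Icc 1 P.L) : level P s x = ℓ ↔
      lev ℓ ≤ invNorm (s ℓ).Sig x ∧ ∀ j ∈ Finset.Ico 1 ℓ, invNorm (s j).Sig x < lev j := by
  rw [Finset.mem_Icc] at hℓ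
  constructor
  · rintro h
    refine ⟨lev_le_invNorm_of_level (Finset.mem_Icc.2 hℓ) h, fun j hj => ?_⟩
    rw [Finset.mem_Ico] at hj
    exact invNorm_lt_of_lt_level (P := P) (Finset.mem_Icc.2 ⟨hj.1, by omega⟩) (by omega)
  · rintro ⟨h1, h2⟩
    rcases lt_trichotomy (level P s x) ℓ with h | h | h
    · have hm := level_mem P s x
      rw [Finset.mem_Icc] at hm
      have h3 := lev_le_invNorm_of_level (P := P) (s := s) (x := x)
        (Finset.mem_Icc.2 ⟨hm.1, by omega⟩) rfl
      exact absurd (h2 _ (Finset.mem_Ico.2 ⟨hm.1, h⟩)) (not_lt.2 h3)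
    · exact h
    · exact absurd (invNorm_lt_of_lt_level (Finset.mem_Icc.2 hℓ) h) (not_lt.2 h1)

/-! ### Closed form of the state of a layer -/

variable {d : ℕ} (P : Params) (a : ℕ → Vec d) (r : ℕ → ℝ)

/-- The layer to which round `k` is assigned (`L + 1` if there is none). -/
noncomputable def roundLevel (k : ℕ) : ℕ := level P (stateAt P a r k) (a k)

/-- The weight of round `k`. -/
noncomputable def roundWeight (k : ℕ) : ℝ :=
  lev (roundLevel P a r k) / invNorm (stateAt P a r k (roundLevel P a r k)).Sig (a k)

/-- The rounds before round `k` in the same epoch that are assigned to layer `ℓ`. -/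
noncomputable def roundSet (k ℓ : ℕ) : Finset ℕ :=
  (Finset.Ico 1 k).filter fun i => i / P.w = k / P.w ∧ roundLevel P a r i = ℓ

theorem mem_roundSet {k ℓ i : ℕ} : i ∈ roundSet P a r k ℓ ↔
    (1 ≤ i ∧ i < k) ∧ i / P.w = k / P.w ∧ roundLevel P a r i = ℓ := by
  rw [roundSet, Finset.mem_filter, Finset.mem_Ico]

theorem roundSet_one (ℓ : ℕ) : roundSet P a r 1 ℓ = ∅ := by simp [roundSet]

theorem roundSet_restart (hw : 1 ≤ P.w) {k : ℕ} (ℓ : ℕ) (h : (k + 1) % P.w = 0) :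
    roundSet P a r (k + 1) ℓ = ∅ := by
  ext i
  simp only [mem_roundSet, Finset.notMem_empty, iff_false]
  rintro ⟨⟨_, h2⟩, h3, _⟩
  have h4 : i / P.w < (k + 1) / P.w := by
    rw [Nat.div_lt_iff_lt_mul hw, Nat.div_mul_cancel (Nat.dvd_of_mod_eq_zero h)]
    exact h2
  omega

theorem div_succ_of_mod_ne {w k : ℕ} (h : (k + 1) % w ≠ 0) : (k + 1) / w = k / w := by
  rw [Nat.succ_div, if_neg (fun hd => h (Nat.mod_eq_zero_of_dvd hd)), add_zero]

theorem roundSet_succ_of_eq {k ℓ : ℕ} (hk : 1 ≤ k) (h : (k + 1) % P.w ≠ 0)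
    (hℓ : roundLevel P a r k = ℓ) :
    roundSet P a r (k + 1) ℓ = insert k (roundSet P a r k ℓ) := by
  ext i
  simp only [mem_roundSet, Finset.mem_insert, div_succ_of_mod_ne h]
  constructor
  · rintro ⟨⟨h1, h2⟩, h3, h4⟩
    rcases Nat.lt_succ_iff_lt_or_eq.1 h2 with h5 | h5
    · exact Or.inr ⟨⟨h1, h5⟩, h3, h4⟩
    · exact Or.inl h5
  · rintro (rfl | ⟨⟨h1, h2⟩, h3, h4⟩)
    · exact ⟨⟨hk, by omega⟩, rfl, hℓ⟩
    · exact ⟨⟨h1, by omega⟩, h3, h4⟩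

theorem roundSet_succ_of_ne {k ℓ : ℕ} (h : (k + 1) % P.w ≠ 0)
    (hℓ : roundLevel P a r k ≠ ℓ) :
    roundSet P a r (k + 1) ℓ = roundSet P a r k ℓ := by
  ext i
  simp only [mem_roundSet, div_succ_of_mod_ne h]
  constructor
  · rintro ⟨⟨h1, h2⟩, h3, h4⟩
    rcases Nat.lt_succ_iff_lt_or_eq.1 h2 with h5 | h5
    · exact ⟨⟨h1, h5⟩, h3, h4⟩
    · rw [h5] at h4; exact absurd h4 hℓ
  · rintro ⟨⟨h1, h2⟩, h3, h4⟩
    exact ⟨⟨h1, by omega⟩, h3, h4⟩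

theorem notMem_roundSet (k ℓ : ℕ) : k ∉ roundSet P a r k ℓ := by simp [mem_roundSet]

theorem stateAt_one : stateAt P a r 1 = initState d P := by simp [stateAt]

theorem stateAt_restart {k : ℕ} (h : (k + 1) % P.w = 0) :
    stateAt P a r (k + 1) = initState d P := by
  rw [stateAt, if_pos (Or.inl h)]

theorem stateAt_succ {k : ℕ} (hk : 1 ≤ k) (h : (k + 1) % P.w ≠ 0) :
    stateAt P a r (k + 1) = update P a r k (stateAt P a r k) := by
  rw [stateAt, if_neg]
  rintro (h' | h')
  · exact h h'
  · omega

theorem update_of_ne {k ℓ : ℕ} {s : State d} (hℓ : ℓ ∈ Finset.Icc 1 P.L)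
    (h : level P s (a k) ≠ ℓ) : update P a r k s ℓ = s ℓ := by
  rw [Finset.mem_Icc] at hℓ
  unfold update
  split_ifs with hu
  · rw [level, dif_pos hu] at h
    exact Function.update_of_ne (fun e => h e.symm) _ _
  · exact Function.update_of_ne (by omega) _ _

theorem update_of_eq {k ℓ : ℕ} {s : State d} (hℓ : ℓ ∈ Finset.Icc 1 P.L)
    (h : level P s (a k) = ℓ) :
    update P a r k s ℓ =
      (let c : ℝ := lev ℓ / invNorm (s ℓ).Sig (a k)
      let Sig' := (s ℓ).Sig + c ^ 2 • Matrix.vecMulVec (a k).ofLp (a k).ofLp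
      let b' : Vec d := (s ℓ).b + (c ^ 2 * r k) • a k
      let est' : Vec d := act Sig'⁻¹ b'
      let rounds' := insert k (s ℓ).rounds
      let weight' := Function.update (s ℓ).weight k c
      { Sig := Sig'
        b := b'
        est := est'
        radius := confRadius P a r ℓ est' rounds' weight'
        rounds := rounds'
        weight := weight' }) := by
  classical
  unfold update
  by_cases hu : (uncertain P s (a k)).Nonempty
  · rw [level, dif_pos hu] at h
    subst h
    rw [dif_pos hu]
    dsimp only
    rw [Function.update_self]
    simp only [act_apply]
  · rw [level, dif_neg hu] at h
    rw [Finset.mem_Icc] at hℓ; omega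

theorem confRadius_congr {ℓ : ℕ} {est : Vec d} {s : Finset ℕ} {u v : ℕ → ℝ}
    (h : ∀ i ∈ s, u i = v i) :
    confRadius P a r ℓ est s u = confRadius P a r ℓ est s v := by
  have : varEst P a r ℓ est s u = varEst P a r ℓ est s v := by
    unfold varEst
    split_ifs
    · exact Finset.sum_congr rfl fun i hi => by rw [h i hi]
    · rfl
  rw [confRadius, confRadius, this]

/-- A closed form of the data of a layer. -/
structure IsLayer (P : Params) (a : ℕ → Vec d) (r : ℕ → ℝ) (k ℓ : ℕ) (S : Layer d) : Prop where
  rounds : S.rounds = roundSet P a r k ℓ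
  weight : ∀ i ∈ roundSet P a r k ℓ, S.weight i = roundWeight P a r i
  Sig : S.Sig = design (lev ℓ ^ 2) (roundSet P a r k ℓ) (fun i => roundWeight P a r i • a i)
  b : S.b = ∑ i ∈ roundSet P a r k ℓ, (roundWeight P a r i ^ 2 * r i) • a i
  est : S.est = act S.Sig⁻¹ S.b
  radius : S.radius = lev ℓ * P.Bmax ∧ roundSet P a r k ℓ = ∅ ∨
    S.radius = confRadius P a r ℓ S.est (roundSet P a r k ℓ) (roundWeight P a r)

theorem isLayer_init {k ℓ : ℕ} (h : roundSet P a r k ℓ = ∅) :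
    IsLayer P a r k ℓ (initState d P ℓ) where
  rounds := h.symm
  weight := by simp [h]
  Sig := by simp [h, design, initState]
  b := by simp [h, initState]
  est := by simp [initState]
  radius := Or.inl ⟨rfl, h⟩

theorem vecMulVec_smul_self (c : ℝ) (x : Vec d) :
    Matrix.vecMulVec (c • x).ofLp (c • x).ofLp = c ^ 2 • Matrix.vecMulVec x.ofLp x.ofLp := by
  rw [WithLp.ofLp_smul, Matrix.smul_vecMulVec, Matrix.vecMulVec_smul', op_smul_eq_smul,
    Matrix.smul_vecMulVec, smul_smul, sq]

/-- Turns the recursive state into sums over the rounds of the current epoch. The initial radius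
occurs only while the layer is empty, the case where there is no noise to cover. -/
theorem isLayer_stateAt (hw : 1 ≤ P.w) {k ℓ : ℕ} (hk : 1 ≤ k) (hℓ : ℓ ∈ Finset.Icc 1 P.L) :
    IsLayer P a r k ℓ (stateAt P a r k ℓ) := by
  induction k, hk using Nat.le_induction with
  | base => rw [stateAt_one]; exact isLayer_init P a r (roundSet_one P a r ℓ)
  | succ k hk ih =>
    by_cases hr : (k + 1) % P.w = 0
    · rw [stateAt_restart P a r hr]
      exact isLayer_init P a r (roundSet_restart P a r hw ℓ hr)
    rw [stateAt_succ P a r hk hr]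
    by_cases hl : roundLevel P a r k = ℓ
    · have hins := roundSet_succ_of_eq P a r hk hr hl
      have hnot := notMem_roundSet P a r k ℓ
      have hc : lev ℓ / invNorm (stateAt P a r k ℓ).Sig (a k) = roundWeight P a r k := by
        rw [roundWeight, hl]
      have hwt : ∀ i ∈ roundSet P a r (k + 1) ℓ,
          Function.update (stateAt P a r k ℓ).weight k (roundWeight P a r k) i
            = roundWeight P a r i := by
        intro i hi
        by_cases hik : i = k
        · subst hik; simp
        · rw [Function.update_of_ne hik]
          rw [hins, Finset.mem_insert] at hi
          exact ih.weight i (hi.resolve_left hik)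
      rw [update_of_eq P a r hℓ hl]
      dsimp only
      rw [hc]
      refine ⟨?_, hwt, ?_, ?_, rfl, Or.inr ?_⟩
      · dsimp only; rw [hins, ih.rounds]
      · dsimp only
        rw [hins, design, Finset.sum_insert hnot, ih.Sig, design, vecMulVec_smul_self]
        abel
      · dsimp only
        rw [hins, Finset.sum_insert hnot, ih.b, add_comm]
      · dsimp only
        rw [ih.rounds, ← hins]
        exact confRadius_congr P a r hwt
    · have hs := roundSet_succ_of_ne P a r hr hl
      rw [update_of_ne P a r hℓ hl]
      constructor
      · rw [hs]; exact ih.rounds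
      · rw [hs]; exact ih.weight
      · rw [hs]; exact ih.Sig
      · rw [hs]; exact ih.b
      · exact ih.est
      · rw [hs]; exact ih.radius

theorem posDef_Sig (hw : 1 ≤ P.w) {k ℓ : ℕ} (hk : 1 ≤ k) (hℓ : ℓ ∈ Finset.Icc 1 P.L) :
    (stateAt P a r k ℓ).Sig.PosDef := by
  rw [(isLayer_stateAt P a r hw hk hℓ).Sig]
  exact posDef_design (pow_pos (lev_pos ℓ) 2) _ _

theorem lev_le_invNorm_round {k ℓ : ℕ} (hℓ : ℓ ∈ Finset.Icc 1 P.L)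
    (h : roundLevel P a r k = ℓ) : lev ℓ ≤ invNorm (stateAt P a r k ℓ).Sig (a k) :=
  lev_le_invNorm_of_level hℓ h

theorem roundWeight_nonneg (k : ℕ) : 0 ≤ roundWeight P a r k :=
  div_nonneg (lev_pos _).le (invNorm_nonneg _ _)

theorem roundWeight_le_one {k ℓ : ℕ} (hℓ : ℓ ∈ Finset.Icc 1 P.L)
    (h : roundLevel P a r k = ℓ) : roundWeight P a r k ≤ 1 := by
  have h1 := lev_le_invNorm_round P a r hℓ h
  rw [roundWeight, h]
  exact div_le_one_of_le₀ h1 (invNorm_nonneg _ _)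

/-- The point of the weights. All increments of a layer having the same norm, the factor 1 + ρ² is
constant in the noise recursion and in the determinant. -/
theorem invNorm_weighted_arm {k ℓ : ℕ} (hℓ : ℓ ∈ Finset.Icc 1 P.L)
    (h : roundLevel P a r k = ℓ) :
    invNorm (stateAt P a r k ℓ).Sig (roundWeight P a r k • a k) = lev ℓ := by
  have h1 := lev_le_invNorm_round P a r hℓ h
  rw [invNorm_smul, abs_of_nonneg (roundWeight_nonneg P a r k), roundWeight, h]
  exact div_mul_cancel₀ _ ((lev_pos ℓ).trans_le h1).ne'

/-! ### Self-normalised noise and the bootstrap for its bound -/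

variable {d : ℕ} (P : Params) (a : ℕ → Vec d) (r ε : ℕ → ℝ)

/-- The weighted noise of layer `ℓ` before round `k`. -/
noncomputable def noiseSum (k ℓ : ℕ) : Vec d :=
  ∑ i ∈ roundSet P a r k ℓ, (roundWeight P a r i ^ 2 * ε i) • a i

/-- The self-normalised noise of layer `ℓ` before round `k`. -/
noncomputable def noiseNorm (k ℓ : ℕ) : ℝ :=
  invNorm (stateAt P a r k ℓ).Sig (noiseSum P a r ε k ℓ)

/-- The weighted sum of squares of the noise of layer `ℓ` before round `k`. -/
noncomputable def noiseEnergy (k ℓ : ℕ) : ℝ :=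
  ∑ i ∈ roundSet P a r k ℓ, (roundWeight P a r i * ε i) ^ 2

/-- The coefficient of the noise of round `k` in the recursion for `noiseNorm`. -/
noncomputable def noiseCoef (k ℓ : ℕ) : ℝ :=
  roundWeight P a r k ^ 2 *
    inner ℝ (a k) (act (stateAt P a r k ℓ).Sig⁻¹ (noiseSum P a r ε k ℓ))

theorem noiseNorm_nonneg (k ℓ : ℕ) : 0 ≤ noiseNorm P a r ε k ℓ := invNorm_nonneg _ _

theorem noiseEnergy_nonneg (k ℓ : ℕ) : 0 ≤ noiseEnergy P a r ε k ℓ :=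
  Finset.sum_nonneg fun _ _ => sq_nonneg _

theorem Sig_succ_of_eq (hw : 1 ≤ P.w) {k ℓ : ℕ} (hk : 1 ≤ k) (hℓ : ℓ ∈ Finset.Icc 1 P.L)
    (hr : (k + 1) % P.w ≠ 0) (hl : roundLevel P a r k = ℓ) :
    (stateAt P a r (k + 1) ℓ).Sig = (stateAt P a r k ℓ).Sig +
      Matrix.vecMulVec (roundWeight P a r k • a k).ofLp (roundWeight P a r k • a k).ofLp := by
  rw [(isLayer_stateAt P a r hw (by omega) hℓ).Sig, (isLayer_stateAt P a r hw hk hℓ).Sig,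
    roundSet_succ_of_eq P a r hk hr hl, design, Finset.sum_insert (notMem_roundSet P a r k ℓ),
    design]
  abel

/-- Sum the one-step bound `invNorm_add_rankOne_sq_le` with x the weighted arm. Its denominator 1 +
ρ² is the same in every round of the layer, so it can be multiplied out before summing. -/
theorem noiseNorm_sq_le (hw : 1 ≤ P.w) {k ℓ : ℕ} (hk : 1 ≤ k) (hℓ : ℓ ∈ Finset.Icc 1 P.L) :
    (1 + lev ℓ ^ 2) * noiseNorm P a r ε k ℓ ^ 2 ≤
      2 * ∑ i ∈ roundSet P a r k ℓ, noiseCoef P a r ε i ℓ * ε i +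
        2 * lev ℓ ^ 2 * noiseEnergy P a r ε k ℓ := by
  have h0 : ∀ k, roundSet P a r k ℓ = ∅ → (1 + lev ℓ ^ 2) * noiseNorm P a r ε k ℓ ^ 2 ≤
      2 * ∑ i ∈ roundSet P a r k ℓ, noiseCoef P a r ε i ℓ * ε i +
        2 * lev ℓ ^ 2 * noiseEnergy P a r ε k ℓ := by
    intro k h
    simp [noiseNorm, noiseSum, noiseEnergy, h, invNorm_eq]
  induction k, hk using Nat.le_induction with
  | base => exact h0 1 (roundSet_one P a r ℓ)
  | succ k hk ih =>
    by_cases hr : (k + 1) % P.w = 0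
    · exact h0 _ (roundSet_restart P a r hw ℓ hr)
    by_cases hl : roundLevel P a r k = ℓ
    · have hins := roundSet_succ_of_eq P a r hk hr hl
      have hnot := notMem_roundSet P a r k ℓ
      have hN : noiseSum P a r ε (k + 1) ℓ = noiseSum P a r ε k ℓ +
          (roundWeight P a r k * ε k) • (roundWeight P a r k • a k) := by
        rw [noiseSum, hins, Finset.sum_insert hnot, noiseSum, add_comm, smul_smul]
        congr 2; ring
      have hstep := invNorm_add_rankOne_sq_le (posDef_Sig P a r hw hk hℓ)
        (posDef_Sig P a r hw (by omega) hℓ) (Sig_succ_of_eq P a r hw hk hℓ hr hl)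
        (noiseSum P a r ε k ℓ) (roundWeight P a r k * ε k)
      rw [← hN, invNorm_weighted_arm P a r hℓ hl, real_inner_smul_left] at hstep
      change noiseNorm P a r ε (k + 1) ℓ ^ 2 ≤ noiseNorm P a r ε k ℓ ^ 2 + _ at hstep
      rw [noiseEnergy, hins, Finset.sum_insert hnot, Finset.sum_insert hnot]
      rw [noiseEnergy] at ih
      have hpos : 0 < 1 + lev ℓ ^ 2 := by positivity
      have := mul_le_mul_of_nonneg_left hstep hpos.le
      rw [mul_add, mul_div_cancel₀ _ hpos.ne'] at this
      rw [noiseCoef]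
      nlinarith [this, ih]
    · have hs := roundSet_succ_of_ne P a r hr hl
      have hS : stateAt P a r (k + 1) ℓ = stateAt P a r k ℓ := by
        rw [stateAt_succ P a r hk hr, update_of_ne P a r hℓ hl]
      rw [noiseNorm, noiseSum, noiseEnergy, hs, hS]
      exact ih

theorem abs_noiseCoef_le (hw : 1 ≤ P.w) {k ℓ : ℕ} (hk : 1 ≤ k) (hℓ : ℓ ∈ Finset.Icc 1 P.L)
    (hl : roundLevel P a r k = ℓ) :
    |noiseCoef P a r ε k ℓ| ≤ roundWeight P a r k * (lev ℓ * noiseNorm P a r ε k ℓ) := by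
  have h := abs_inner_act_inv_le (posDef_Sig P a r hw hk hℓ) (roundWeight P a r k • a k)
    (noiseSum P a r ε k ℓ)
  rw [invNorm_weighted_arm P a r hℓ hl, real_inner_smul_left] at h
  rw [noiseCoef, sq, mul_assoc, abs_mul, abs_of_nonneg (roundWeight_nonneg P a r k)]
  exact mul_le_mul_of_nonneg_left h (roundWeight_nonneg P a r k)

/-- The bound on `noiseNorm` when `noiseEnergy` is at most `v`, at confidence `exp (-Γ)`. -/
noncomputable def noiseThreshold (ℓ : ℕ) (v Γ : ℝ) : ℝ :=
  lev ℓ * (4 * √(v * Γ) + 4 * P.R * Γ + 2 * √v)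

/-- The scale of the exponential martingale. -/
noncomputable def noiseScale (ℓ : ℕ) (v Γ : ℝ) : ℝ :=
  (lev ℓ * noiseThreshold P ℓ v Γ * (2 * P.R + √(v / Γ)))⁻¹

/-- The predictable coefficients of the exponential martingale of layer `ℓ` and epoch `m`. -/
noncomputable def predictable (m ℓ : ℕ) (v Γ : ℝ) (i : ℕ) : ℝ :=
  open Classical in
  if i / P.w = m ∧ roundLevel P a r i = ℓ ∧ noiseNorm P a r ε i ℓ ≤ noiseThreshold P ℓ v Γ then
    noiseScale P ℓ v Γ * noiseCoef P a r ε i ℓ else 0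

theorem noiseThreshold_pos {ℓ : ℕ} {v Γ : ℝ} (hR : 0 < P.R) (hΓ : 0 < Γ) :
    0 < noiseThreshold P ℓ v Γ := by
  have := lev_pos ℓ
  unfold noiseThreshold; positivity

theorem noiseScale_pos {ℓ : ℕ} {v Γ : ℝ} (hR : 0 < P.R) (hΓ : 0 < Γ) :
    0 < noiseScale P ℓ v Γ := by
  have := lev_pos ℓ
  have := noiseThreshold_pos P (ℓ := ℓ) (v := v) hR hΓ
  unfold noiseScale; positivity

theorem abs_predictable_le (hw : 1 ≤ P.w) {m ℓ i : ℕ} {v Γ : ℝ} (hR : 0 < P.R) (hΓ : 0 < Γ)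
    (hi : 1 ≤ i) (hℓ : ℓ ∈ Finset.Icc 1 P.L) :
    |predictable P a r ε m ℓ v Γ i| ≤ (2 * P.R)⁻¹ := by
  unfold predictable
  split_ifs with h
  · obtain ⟨_, hl, hn⟩ := h
    have hl0 := lev_pos ℓ
    have ht := noiseThreshold_pos P (ℓ := ℓ) (v := v) hR hΓ
    have hc : |noiseCoef P a r ε i ℓ| ≤ lev ℓ * noiseThreshold P ℓ v Γ := by
      refine (abs_noiseCoef_le P a r ε hw hi hℓ hl).trans ?_
      calc _ ≤ 1 * (lev ℓ * noiseNorm P a r ε i ℓ) :=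
            mul_le_mul_of_nonneg_right (roundWeight_le_one P a r hℓ hl)
              (mul_nonneg hl0.le (noiseNorm_nonneg _ _ _ _ _ _))
        _ ≤ _ := by rw [one_mul]; exact mul_le_mul_of_nonneg_left hn hl0.le
    rw [abs_mul, abs_of_pos (noiseScale_pos P hR hΓ)]
    refine (mul_le_mul_of_nonneg_left hc (noiseScale_pos P hR hΓ).le).trans ?_
    rw [noiseScale, mul_inv, mul_comm, ← mul_assoc, mul_inv_cancel₀ (by positivity), one_mul]
    exact inv_anti₀ (by positivity) (by linarith [Real.sqrt_nonneg (v / Γ)])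
  · simp; exact hR.le

/-- Strong induction on the round: as long as the earlier norms are below the threshold t, the
truncation in `predictable` is inactive and the hypothesis bounds the true martingale. With T the
martingale sum and s the scale, T ≤ Γ/s + sρ²t²v. The threshold is chosen so that n² ≤ 2T + 2ρ²v
then gives n² ≤ t². -/
theorem noiseNorm_le_threshold (hw : 1 ≤ P.w) {m ℓ K : ℕ} {v Γ : ℝ} (hR : 0 < P.R) (hΓ : 0 < Γ)
    (hv : 0 ≤ v) (hℓ : ℓ ∈ Finset.Icc 1 P.L)
    (hev : ∀ k ∈ Finset.Icc 1 K, k / P.w = m →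
      ∑ i ∈ Finset.Ico 1 k, (predictable P a r ε m ℓ v Γ i * ε i
        - (predictable P a r ε m ℓ v Γ i * ε i) ^ 2) ≤ Γ)
    {k : ℕ} (hk : k ∈ Finset.Icc 1 K) (hm : k / P.w = m) (hV : noiseEnergy P a r ε k ℓ ≤ v) :
    noiseNorm P a r ε k ℓ ≤ noiseThreshold P ℓ v Γ := by
  induction k using Nat.strong_induction_on with
  | _ k ih =>
  have hk' := Finset.mem_Icc.1 hk
  -- Within an epoch the noise energy is nondecreasing, so its bound by v passes to earlier rounds
  -- and the induction hypothesis applies to them.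
  have hprev : ∀ i ∈ roundSet P a r k ℓ,
      predictable P a r ε m ℓ v Γ i = noiseScale P ℓ v Γ * noiseCoef P a r ε i ℓ := by
    intro i hi
    have hi' := (mem_roundSet P a r).1 hi
    rw [predictable, if_pos]
    refine ⟨by omega, hi'.2.2, ih i hi'.1.2 (Finset.mem_Icc.2 ⟨by omega, by omega⟩) (by omega) ?_⟩
    refine le_trans (Finset.sum_le_sum_of_subset_of_nonneg ?_ fun _ _ _ => sq_nonneg _) hV
    intro j hj
    have hj' := (mem_roundSet P a r).1 hj
    exact (mem_roundSet P a r).2 ⟨by omega, by omega, hj'.2.2⟩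
  set s := noiseScale P ℓ v Γ with hs
  set t := noiseThreshold P ℓ v Γ with ht
  have hs0 : 0 < s := noiseScale_pos P hR hΓ
  have ht0 : 0 < t := noiseThreshold_pos P hR hΓ
  have hl0 := lev_pos ℓ
  have h1 := hev k hk hm
  have h2 : ∑ i ∈ Finset.Ico 1 k, (predictable P a r ε m ℓ v Γ i * ε i
        - (predictable P a r ε m ℓ v Γ i * ε i) ^ 2) =
      ∑ i ∈ roundSet P a r k ℓ, (s * noiseCoef P a r ε i ℓ * ε i
        - (s * noiseCoef P a r ε i ℓ * ε i) ^ 2) := by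
    rw [← Finset.sum_congr rfl fun i hi =>
      congrArg (fun c => c * ε i - (c * ε i) ^ 2) (hprev i hi)]
    symm
    refine Finset.sum_subset (Finset.filter_subset _ _) fun i hi hi' => ?_
    have : predictable P a r ε m ℓ v Γ i = 0 := by
      rw [predictable, if_neg]
      rintro ⟨h3, h4, _⟩
      exact hi' (Finset.mem_filter.2 ⟨hi, by omega, h4⟩)
    rw [this]; ring
  rw [h2, Finset.sum_sub_distrib] at h1
  have h3 : ∑ i ∈ roundSet P a r k ℓ, (s * noiseCoef P a r ε i ℓ * ε i) ^ 2 ≤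
      s ^ 2 * lev ℓ ^ 2 * t ^ 2 * v := by
    refine le_trans (Finset.sum_le_sum fun i hi => ?_) (b := ∑ i ∈ roundSet P a r k ℓ,
      s ^ 2 * lev ℓ ^ 2 * t ^ 2 * (roundWeight P a r i * ε i) ^ 2) ?_
    · have hi' := (mem_roundSet P a r).1 hi
      have hn : noiseNorm P a r ε i ℓ ≤ t := by
        refine ih i hi'.1.2 (Finset.mem_Icc.2 ⟨by omega, by omega⟩) (by omega) ?_
        refine le_trans (Finset.sum_le_sum_of_subset_of_nonneg ?_ fun _ _ _ => sq_nonneg _) hV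
        intro j hj
        have hj' := (mem_roundSet P a r).1 hj
        exact (mem_roundSet P a r).2 ⟨by omega, by omega, hj'.2.2⟩
      have hc := (abs_noiseCoef_le P a r ε hw hi'.1.1 hℓ hi'.2.2).trans
        (mul_le_mul_of_nonneg_left (mul_le_mul_of_nonneg_left hn hl0.le)
          (roundWeight_nonneg P a r i))
      have hc2 := pow_le_pow_left₀ (abs_nonneg _) hc 2
      rw [sq_abs] at hc2
      calc (s * noiseCoef P a r ε i ℓ * ε i) ^ 2
          = (s ^ 2 * ε i ^ 2) * noiseCoef P a r ε i ℓ ^ 2 := by ring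
        _ ≤ (s ^ 2 * ε i ^ 2) * (roundWeight P a r i * (lev ℓ * t)) ^ 2 :=
            mul_le_mul_of_nonneg_left hc2 (by positivity)
        _ = _ := by ring
    · rw [← Finset.mul_sum]
      exact mul_le_mul_of_nonneg_left hV (by positivity)
  have h4 := noiseNorm_sq_le P a r ε hw hk'.1 hℓ
  have h5 : s * ∑ i ∈ roundSet P a r k ℓ, noiseCoef P a r ε i ℓ * ε i =
      ∑ i ∈ roundSet P a r k ℓ, s * noiseCoef P a r ε i ℓ * ε i := by
    rw [Finset.mul_sum]; exact Finset.sum_congr rfl fun i _ => by ring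
  rw [← h5] at h1
  set T := ∑ i ∈ roundSet P a r k ℓ, noiseCoef P a r ε i ℓ * ε i with hT
  set n := noiseNorm P a r ε k ℓ with hn
  have h6 : n ^ 2 ≤ 2 * T + 2 * lev ℓ ^ 2 * v := by
    have := mul_le_mul_of_nonneg_left hV (show 0 ≤ 2 * lev ℓ ^ 2 by positivity)
    nlinarith [mul_nonneg (sq_nonneg (lev ℓ)) (sq_nonneg n)]
  have h7 : T ≤ Γ * s⁻¹ + s * lev ℓ ^ 2 * t ^ 2 * v := by
    have : s * T ≤ s * (Γ * s⁻¹ + s * lev ℓ ^ 2 * t ^ 2 * v) := by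
      have : s * (Γ * s⁻¹ + s * lev ℓ ^ 2 * t ^ 2 * v) = Γ + s ^ 2 * lev ℓ ^ 2 * t ^ 2 * v := by
        field_simp
      rw [this]; linarith
    exact le_of_mul_le_mul_left this hs0
  have hsinv : s⁻¹ = lev ℓ * t * (2 * P.R + √(v / Γ)) := by rw [hs, noiseScale, inv_inv]
  have hq1 : Γ * √(v / Γ) = √(v * Γ) := by
    rw [Real.sqrt_div hv, Real.sqrt_mul hv]
    field_simp
    rw [Real.sq_sqrt hΓ.le, mul_comm]
  -- The summand √(v/Γ) in the scale balances the two terms: each contributes ρt√(vΓ), while the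
  -- summand 2R costs 2RΓ·ρt.
  have h8 : s * lev ℓ ^ 2 * t ^ 2 * v ≤ lev ℓ * t * √(v * Γ) := by
    rcases hv.eq_or_lt with h | h
    · rw [← h]; simp
    have hsq : 0 < √(v / Γ) := Real.sqrt_pos.2 (by positivity)
    have h9 : s ≤ (lev ℓ * t * √(v / Γ))⁻¹ := by
      rw [hs, noiseScale]
      exact inv_anti₀ (by positivity)
        (mul_le_mul_of_nonneg_left (by linarith) (by positivity))
    have h10 : v = √(v / Γ) * √(v * Γ) := by
      rw [← Real.sqrt_mul (by positivity)]
      rw [show v / Γ * (v * Γ) = v ^ 2 by field_simp, Real.sqrt_sq hv]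
    calc s * lev ℓ ^ 2 * t ^ 2 * v ≤ (lev ℓ * t * √(v / Γ))⁻¹ * lev ℓ ^ 2 * t ^ 2 * v := by
          gcongr
      _ = (lev ℓ * t * √(v / Γ))⁻¹ * lev ℓ ^ 2 * t ^ 2 * (√(v / Γ) * √(v * Γ)) := by rw [← h10]
      _ = _ := by field_simp
  have h11 : lev ℓ ^ 2 * v * 4 ≤ t * (lev ℓ * (2 * √v)) := by
    have h12 : lev ℓ * (2 * √v) ≤ t := by
      rw [ht, noiseThreshold]
      refine mul_le_mul_of_nonneg_left ?_ hl0.le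
      have := Real.sqrt_nonneg (v * Γ)
      have : 0 ≤ P.R * Γ := by positivity
      linarith
    have := mul_le_mul_of_nonneg_right h12 (show 0 ≤ lev ℓ * (2 * √v) by positivity)
    have h13 := Real.sq_sqrt hv
    calc lev ℓ ^ 2 * v * 4 = lev ℓ * (2 * √v) * (lev ℓ * (2 * √v)) := by
          nth_rewrite 1 [← h13]; ring
      _ ≤ _ := this
  refine abs_le_of_sq_le_sq' ?_ ht0.le |>.2
  have h14 : Γ * s⁻¹ = lev ℓ * t * (2 * P.R * Γ) + lev ℓ * t * √(v * Γ) := by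
    rw [hsinv, ← hq1]; ring
  have h15 : t ^ 2 = t * (lev ℓ * (4 * √(v * Γ) + 4 * P.R * Γ + 2 * √v)) := by
    rw [sq]; nth_rewrite 2 [ht]; rw [noiseThreshold]
  have h16 : 0 ≤ lev ℓ ^ 2 * v := by positivity
  rw [h15]
  nlinarith

/-! ### Exponential supermartingales for bounded noise -/

/-- Equivalently 1 ≤ (1 + y) exp(y² − y). For y ≥ 0 the first-order bound on exp gives 1 + y³; for y
≤ 0 the second-order one is needed, as then y³ ≤ 0. -/
theorem exp_sub_sq_le {y : ℝ} (hy : |y| ≤ 1 / 2) : Real.exp (y - y ^ 2) ≤ 1 + y := by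
  obtain ⟨h1, h2⟩ := abs_le.1 hy
  have hpos : 0 < 1 + y := by linarith
  have key : 1 ≤ (1 + y) * Real.exp (y ^ 2 - y) := by
    rcases le_total 0 y with h | h
    · have h3 := Real.add_one_le_exp (y ^ 2 - y)
      have h4 := mul_le_mul_of_nonneg_left h3 hpos.le
      nlinarith [pow_nonneg h 3]
    · have h3 := Real.quadratic_le_exp_of_nonneg (show 0 ≤ y ^ 2 - y by nlinarith)
      have h4 := mul_le_mul_of_nonneg_left h3 hpos.le
      have h5 : (1 + y) * (1 + (y ^ 2 - y) + (y ^ 2 - y) ^ 2 / 2) =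
          1 + y ^ 2 * (y + (1 - y ^ 2) * (1 - y) / 2) := by ring
      have h6 : 0 ≤ y + (1 - y ^ 2) * (1 - y) / 2 := by nlinarith
      nlinarith [mul_nonneg (sq_nonneg y) h6]
  rw [show y - y ^ 2 = -(y ^ 2 - y) by ring, Real.exp_neg]
  rw [inv_le_iff_one_le_mul₀ (Real.exp_pos _)]
  exact key

theorem exp_le_one_add_two_mul {x : ℝ} (h0 : 0 ≤ x) (h1 : x ≤ 1) : Real.exp x ≤ 1 + 2 * x := by
  have := Real.abs_exp_sub_one_le (x := x) (by rwa [abs_of_nonneg h0])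
  rw [abs_of_nonneg h0] at this
  linarith [le_abs_self (Real.exp x - 1)]

theorem measureReal_le_of_integral_exp_le_one {Ω : Type*} {m0 : MeasurableSpace Ω} {μ : Measure Ω}
    {f : Ω → ℝ} {Γ : ℝ}
    (h1 : Integrable (fun ω => Real.exp (f ω)) μ) (h2 : ∫ ω, Real.exp (f ω) ∂μ ≤ 1) :
    μ.real {ω | Γ ≤ f ω} ≤ Real.exp (-Γ) := by
  have h := mul_meas_ge_le_integral_of_nonneg
    (Filter.Eventually.of_forall fun ω => (Real.exp_pos (f ω)).le) h1 (Real.exp Γ)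
  simp only [Real.exp_le_exp] at h
  have h3 := h.trans h2
  rw [Real.exp_neg, ← one_div, le_div_iff₀ (Real.exp_pos _), mul_comm]
  exact h3

section
variable {Ω : Type*} {m0 : MeasurableSpace Ω} {μ : Measure Ω} [IsProbabilityMeasure μ]
  {F : ℕ → MeasurableSpace Ω} {K : ℕ} {ε : ℕ → Ω → ℝ} {R : ℝ}

theorem integral_mul_condExp {m : MeasurableSpace Ω} (hm : m ≤ m0) {U f : Ω → ℝ} {c : ℝ}
    (hU : StronglyMeasurable[m] U) (hUb : ∀ᵐ ω ∂μ, ‖U ω‖ ≤ c) (hf : Integrable f μ) :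
    ∫ ω, U ω * f ω ∂μ = ∫ ω, U ω * (μ[f | m]) ω ∂μ := by
  have hint : Integrable (fun ω => U ω * f ω) μ :=
    hf.bdd_mul (hU.mono hm).aestronglyMeasurable hUb
  rw [← integral_condExp hm (f := fun ω => U ω * f ω)]
  exact integral_congr_ae (condExp_mul_of_stronglyMeasurable_left hU hint hf)

theorem integrable_of_ae_bdd {f : Ω → ℝ} (hf : Measurable f) {c : ℝ} (h : ∀ᵐ ω ∂μ, |f ω| ≤ c) :
    Integrable f μ :=
  Integrable.of_bound hf.aestronglyMeasurable c h

/-- The exponential supermartingale normalised by the realised quadratic variation. -/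
theorem integral_exp_sum_sub_sq_le (hF : ∀ i ∈ Finset.Icc 1 K, F i ≤ m0)
    (hmono : ∀ i j, i ≤ j → F i ≤ F j)
    (hεm : ∀ i j, 1 ≤ i → i < j → Measurable[F j] (ε i))
    (hε0 : ∀ i ∈ Finset.Icc 1 K, Measurable (ε i))
    (hεb : ∀ i ∈ Finset.Icc 1 K, ∀ᵐ ω ∂μ, |ε i ω| ≤ R)
    (hmean : ∀ i ∈ Finset.Icc 1 K, μ[ε i | F i] =ᵐ[μ] fun _ => 0)
    {p : ℕ → Ω → ℝ} {b : ℝ} (hpm : ∀ i ∈ Finset.Icc 1 K, Measurable[F i] (p i))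
    (hpb : ∀ i ∈ Finset.Icc 1 K, ∀ ω, |p i ω| ≤ b) (hb : b * R ≤ 1 / 2)
    {n : ℕ} (hn1 : 1 ≤ n) (hn : n ≤ K + 1) :
    Integrable (fun ω => Real.exp (∑ i ∈ Finset.Ico 1 n,
        (p i ω * ε i ω - (p i ω * ε i ω) ^ 2))) μ ∧
      ∫ ω, Real.exp (∑ i ∈ Finset.Ico 1 n, (p i ω * ε i ω - (p i ω * ε i ω) ^ 2)) ∂μ ≤ 1 := by
  -- y − y² ≤ 1/4 for every real y, so the process is bounded at every sample point, with no appeal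
  -- to the noise bound.
  have hbound : ∀ n ω, Real.exp (∑ i ∈ Finset.Ico 1 n,
      (p i ω * ε i ω - (p i ω * ε i ω) ^ 2)) ≤ Real.exp (n : ℝ) := by
    intro n ω
    refine Real.exp_le_exp.2 ((Finset.sum_le_card_nsmul _ _ 1 fun i _ => ?_).trans ?_)
    · nlinarith [sq_nonneg (p i ω * ε i ω - 1 / 2)]
    · simp
  induction n, hn1 using Nat.le_induction with
  | base => simp
  | succ n hn1 ih =>
    obtain ⟨ih1, ih2⟩ := ih (by omega)
    have hnK : n ∈ Finset.Icc 1 K := Finset.mem_Icc.2 ⟨hn1, by omega⟩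
    set W : Ω → ℝ := fun ω => Real.exp (∑ i ∈ Finset.Ico 1 n,
      (p i ω * ε i ω - (p i ω * ε i ω) ^ 2)) with hW
    have hWm : Measurable[F n] W := by
      refine Real.measurable_exp.comp (Finset.measurable_fun_sum _ fun i hi => ?_)
      rw [Finset.mem_Ico] at hi
      have h1 : Measurable[F n] (p i) :=
        (hpm i (Finset.mem_Icc.2 ⟨hi.1, by omega⟩)).mono (hmono i n hi.2.le) le_rfl
      have h2 := hεm i n hi.1 hi.2
      exact (h1.mul h2).sub ((h1.mul h2).pow_const 2)
    have hWp : ∀ ω, 0 < W ω := fun ω => Real.exp_pos _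
    have hsucc : ∀ ω, Real.exp (∑ i ∈ Finset.Ico 1 (n + 1),
        (p i ω * ε i ω - (p i ω * ε i ω) ^ 2)) =
        W ω * Real.exp (p n ω * ε n ω - (p n ω * ε n ω) ^ 2) := by
      intro ω
      rw [Finset.sum_Ico_succ_top hn1, Real.exp_add]
    have hpm' : Measurable (p n) := (hpm n hnK).mono (hF n hnK) le_rfl
    have hWm' : Measurable W := hWm.mono (hF n hnK) le_rfl
    have hint : Integrable (fun ω => W ω * Real.exp (p n ω * ε n ω - (p n ω * ε n ω) ^ 2)) μ := by
      refine integrable_of_ae_bdd (c := Real.exp ((n + 1 : ℕ) : ℝ)) ?_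
        (Filter.Eventually.of_forall fun ω => ?_)
      · have := hε0 n hnK
        fun_prop
      · rw [← hsucc, abs_of_pos (Real.exp_pos _)]
        exact hbound _ _
    have hεint : Integrable (ε n) μ := integrable_of_ae_bdd (hε0 n hnK) (hεb n hnK)
    have hb0 : ∀ ω, ‖W ω * p n ω‖ ≤ Real.exp (n : ℝ) * b := by
      intro ω
      rw [norm_mul, Real.norm_eq_abs, Real.norm_eq_abs, abs_of_pos (hWp ω)]
      exact mul_le_mul (hbound n ω) (hpb n hnK ω) (abs_nonneg _) (Real.exp_pos _).le
    have hint2 : Integrable (fun ω => W ω * p n ω * ε n ω) μ :=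
      hεint.bdd_mul (hWm'.mul hpm').aestronglyMeasurable (Filter.Eventually.of_forall hb0)
    have hzero : ∫ ω, W ω * p n ω * ε n ω ∂μ = 0 := by
      rw [integral_mul_condExp (hF n hnK) (U := fun ω => W ω * p n ω)
        (hWm.mul (hpm n hnK)).stronglyMeasurable (Filter.Eventually.of_forall hb0) hεint]
      rw [integral_congr_ae (g := fun _ => (0 : ℝ))]
      · simp
      · filter_upwards [hmean n hnK] with ω hω
        simp [hω]
    simp only [hsucc]
    refine ⟨hint, ?_⟩
    calc ∫ ω, W ω * Real.exp (p n ω * ε n ω - (p n ω * ε n ω) ^ 2) ∂μ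
        ≤ ∫ ω, (W ω + W ω * p n ω * ε n ω) ∂μ := by
          refine integral_mono_ae hint (ih1.add hint2) ?_
          filter_upwards [hεb n hnK] with ω hω
          have : |p n ω * ε n ω| ≤ 1 / 2 := by
            rw [abs_mul]
            refine le_trans (mul_le_mul (hpb n hnK ω) hω (abs_nonneg _) ?_) hb
            exact (abs_nonneg _).trans (hpb n hnK ω)
          have := mul_le_mul_of_nonneg_left (exp_sub_sq_le this) (hWp ω).le
          calc _ ≤ _ := this
            _ = _ := by ring
      _ = ∫ ω, W ω ∂μ := by rw [integral_add ih1 hint2, hzero, add_zero]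
      _ ≤ 1 := ih2

/-- The exponential supermartingale for the sum of the squares of the noise. -/
theorem integral_exp_sum_sq_sub_le (hF : ∀ i ∈ Finset.Icc 1 K, F i ≤ m0)
    (hmono : ∀ i j, i ≤ j → F i ≤ F j)
    (hεm : ∀ i j, 1 ≤ i → i < j → Measurable[F j] (ε i))
    (hε0 : ∀ i ∈ Finset.Icc 1 K, Measurable (ε i))
    (hεb : ∀ i ∈ Finset.Icc 1 K, ∀ᵐ ω ∂μ, |ε i ω| ≤ R) {s : ℝ} (hs : 0 ≤ s) (hsR : s * R ^ 2 ≤ 1)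
    {n : ℕ} (hn1 : 1 ≤ n) (hn : n ≤ K + 1) :
    Integrable (fun ω => Real.exp (∑ i ∈ Finset.Ico 1 n,
        (s * ε i ω ^ 2 - 2 * s * (μ[fun ω => ε i ω ^ 2 | F i]) ω))) μ ∧
      ∫ ω, Real.exp (∑ i ∈ Finset.Ico 1 n,
        (s * ε i ω ^ 2 - 2 * s * (μ[fun ω => ε i ω ^ 2 | F i]) ω)) ∂μ ≤ 1 := by
  set g : ℕ → Ω → ℝ := fun i => μ[fun ω => ε i ω ^ 2 | F i] with hg
  have hg0 : ∀ i, ∀ᵐ ω ∂μ, 0 ≤ g i ω := fun i =>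
    condExp_nonneg (Filter.Eventually.of_forall fun ω => sq_nonneg (ε i ω))
  have hgm : ∀ i, StronglyMeasurable[F i] (g i) := fun i => stronglyMeasurable_condExp
  have hx : ∀ i ∈ Finset.Icc 1 K, ∀ᵐ ω ∂μ, s * ε i ω ^ 2 ≤ 1 := by
    intro i hi
    filter_upwards [hεb i hi] with ω hω
    refine le_trans (mul_le_mul_of_nonneg_left ?_ hs) hsR
    rw [← sq_abs]
    exact pow_le_pow_left₀ (abs_nonneg _) hω 2
  have hbound : ∀ n ≤ K + 1, ∀ᵐ ω ∂μ, Real.exp (∑ i ∈ Finset.Ico 1 n,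
      (s * ε i ω ^ 2 - 2 * s * g i ω)) ≤ Real.exp (n : ℝ) := by
    intro n hn
    have h1 : ∀ᵐ ω ∂μ, ∀ i ∈ Finset.Icc 1 K, s * ε i ω ^ 2 ≤ 1 ∧ 0 ≤ g i ω :=
      (Finset.eventually_all _).2 fun i hi => (hx i hi).and (hg0 i)
    filter_upwards [h1] with ω hω
    refine Real.exp_le_exp.2 ((Finset.sum_le_card_nsmul _ _ 1 fun i hi => ?_).trans ?_)
    · rw [Finset.mem_Ico] at hi
      have := hω i (Finset.mem_Icc.2 ⟨hi.1, by omega⟩)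
      nlinarith [mul_nonneg hs this.2]
    · simp
  change Integrable (fun ω => Real.exp (∑ i ∈ Finset.Ico 1 n,
        (s * ε i ω ^ 2 - 2 * s * g i ω))) μ ∧
      ∫ ω, Real.exp (∑ i ∈ Finset.Ico 1 n, (s * ε i ω ^ 2 - 2 * s * g i ω)) ∂μ ≤ 1
  induction n, hn1 using Nat.le_induction with
  | base => simp
  | succ n hn1 ih =>
    obtain ⟨ih1, ih2⟩ := ih (by omega)
    have hnK : n ∈ Finset.Icc 1 K := Finset.mem_Icc.2 ⟨hn1, by omega⟩
    set W : Ω → ℝ := fun ω => Real.exp (∑ i ∈ Finset.Ico 1 n,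
      (s * ε i ω ^ 2 - 2 * s * g i ω)) with hW
    have hWm : Measurable[F n] W := by
      refine Real.measurable_exp.comp (Finset.measurable_fun_sum _ fun i hi => ?_)
      rw [Finset.mem_Ico] at hi
      have h1 : Measurable[F n] (g i) := (hgm i).measurable.mono (hmono i n hi.2.le) le_rfl
      have h2 := hεm i n hi.1 hi.2
      exact ((h2.pow_const 2).const_mul s).sub (h1.const_mul (2 * s))
    have hWp : ∀ ω, 0 < W ω := fun ω => Real.exp_pos _
    have hsucc : ∀ ω, Real.exp (∑ i ∈ Finset.Ico 1 (n + 1),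
        (s * ε i ω ^ 2 - 2 * s * g i ω)) =
        W ω * Real.exp (s * ε n ω ^ 2 - 2 * s * g n ω) := by
      intro ω
      rw [Finset.sum_Ico_succ_top hn1, Real.exp_add]
    have hgn : Measurable[F n] (g n) := (hgm n).measurable
    have hgn' : Measurable (g n) := hgn.mono (hF n hnK) le_rfl
    have hWm' : Measurable W := hWm.mono (hF n hnK) le_rfl
    have hε := hε0 n hnK
    have hint : Integrable (fun ω => W ω * Real.exp (s * ε n ω ^ 2 - 2 * s * g n ω)) μ := by
      refine integrable_of_ae_bdd (c := Real.exp ((n + 1 : ℕ) : ℝ)) (by fun_prop) ?_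
      filter_upwards [hbound (n + 1) hn] with ω hω
      rw [← hsucc, abs_of_pos (Real.exp_pos _)]
      exact hω
    have hεint : Integrable (fun ω => ε n ω ^ 2) μ := by
      refine integrable_of_ae_bdd (c := R ^ 2) (by fun_prop) ?_
      filter_upwards [hεb n hnK] with ω hω
      rw [abs_of_nonneg (sq_nonneg _), ← sq_abs]
      exact pow_le_pow_left₀ (abs_nonneg _) hω 2
    -- The compensator factor is known before the noise of round n, so it joins the past weight.
    -- Then e^x ≤ 1 + 2x on [0, 1], conditioning, and 1 + 2sg ≤ exp(2sg) close the step.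
    set U : Ω → ℝ := fun ω => W ω * Real.exp (-(2 * s * g n ω)) with hU
    have hUm : Measurable[F n] U :=
      hWm.mul (Real.measurable_exp.comp (hgn.const_mul (2 * s)).neg)
    have hUm' : Measurable U := hUm.mono (hF n hnK) le_rfl
    have hUp : ∀ ω, 0 < U ω := fun ω => mul_pos (hWp ω) (Real.exp_pos _)
    have hUb : ∀ᵐ ω ∂μ, ‖U ω‖ ≤ Real.exp (n : ℝ) := by
      filter_upwards [hbound n (by omega), hg0 n] with ω h1 h2
      rw [Real.norm_eq_abs, abs_of_pos (hUp ω)]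
      calc U ω ≤ W ω * 1 := mul_le_mul_of_nonneg_left
            (Real.exp_le_one_iff.2 (by have := mul_nonneg hs h2; linarith)) (hWp ω).le
        _ ≤ _ := by rw [mul_one]; exact h1
    have hUint : Integrable U μ := integrable_of_ae_bdd hUm' hUb
    have hUe : Integrable (fun ω => U ω * ε n ω ^ 2) μ :=
      hεint.bdd_mul hUm'.aestronglyMeasurable hUb
    have hUg : Integrable (fun ω => U ω * g n ω) μ :=
      integrable_condExp.bdd_mul hUm'.aestronglyMeasurable hUb
    simp only [hsucc]
    refine ⟨hint, ?_⟩
    calc ∫ ω, W ω * Real.exp (s * ε n ω ^ 2 - 2 * s * g n ω) ∂μ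
        ≤ ∫ ω, (U ω + 2 * s * (U ω * ε n ω ^ 2)) ∂μ := by
          refine integral_mono_ae hint (hUint.add (hUe.const_mul (2 * s))) ?_
          filter_upwards [hx n hnK] with ω hω
          have h1 := exp_le_one_add_two_mul (mul_nonneg hs (sq_nonneg (ε n ω))) hω
          have h2 := mul_le_mul_of_nonneg_left h1 (hUp ω).le
          calc _ = U ω * Real.exp (s * ε n ω ^ 2) := by
                rw [hU, sub_eq_add_neg, Real.exp_add]; ring
            _ ≤ _ := h2
            _ = _ := by ring
      _ = ∫ ω, (U ω + 2 * s * (U ω * g n ω)) ∂μ := by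
          rw [integral_add hUint (hUe.const_mul (2 * s)),
            integral_add hUint (hUg.const_mul (2 * s)), integral_const_mul, integral_const_mul,
            integral_mul_condExp (hF n hnK) hUm.stronglyMeasurable hUb hεint]
      _ ≤ ∫ ω, W ω ∂μ := by
          refine integral_mono_ae (hUint.add (hUg.const_mul (2 * s))) ih1
            (Filter.Eventually.of_forall fun ω => ?_)
          have h1 := Real.add_one_le_exp (2 * s * g n ω)
          have h2 := mul_le_mul_of_nonneg_left h1 (hUp ω).le
          calc _ = U ω * (2 * s * g n ω + 1) := by ring
            _ ≤ _ := h2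
            _ = W ω := by rw [hU, mul_assoc, ← Real.exp_add]; simp
      _ ≤ 1 := ih2

end

/-! ### Predictability of the coefficients with respect to the history -/

section
variable {Ω : Type*} {d : ℕ} {a : ℕ → Ω → Vec d} {ε : ℕ → Ω → ℝ}

theorem history_mono (i j : ℕ) (h : i ≤ j) : history a ε i ≤ history a ε j := by
  refine sup_le_sup ?_ ?_
  · exact biSup_mono fun k hk => Finset.Icc_subset_Icc_right h hk
  · exact biSup_mono fun k hk => Finset.Ico_subset_Ico_right h hk

theorem measurable_arm_history {i k : ℕ} (h1 : 1 ≤ i) (h2 : i ≤ k) :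
    Measurable[history a ε k] (a i) := by
  refine Measurable.of_comap_le (le_sup_of_le_left ?_)
  exact le_biSup (fun i => MeasurableSpace.comap (a i) inferInstance)
    (Finset.mem_Icc.2 ⟨h1, h2⟩)

theorem measurable_noise_history (i k : ℕ) (h1 : 1 ≤ i) (h2 : i < k) :
    Measurable[history a ε k] (ε i) := by
  refine Measurable.of_comap_le (le_sup_of_le_right ?_)
  exact le_biSup (fun i => MeasurableSpace.comap (ε i) inferInstance)
    (Finset.mem_Ico.2 ⟨h1, h2⟩)

theorem history_le {m0 : MeasurableSpace Ω} {K : ℕ} (ha : ∀ k ∈ Finset.Icc 1 K, Measurable (a k))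
    (hε : ∀ k ∈ Finset.Icc 1 K, Measurable (ε k)) (k : ℕ) (hk : k ∈ Finset.Icc 1 K) :
    history a ε k ≤ m0 := by
  rw [Finset.mem_Icc] at hk
  refine sup_le (iSup₂_le fun i hi => ?_) (iSup₂_le fun i hi => ?_)
  · rw [Finset.mem_Icc] at hi
    exact (ha i (Finset.mem_Icc.2 ⟨hi.1, by omega⟩)).comap_le
  · rw [Finset.mem_Ico] at hi
    exact (hε i (Finset.mem_Icc.2 ⟨hi.1, by omega⟩)).comap_le

theorem measurable_det {m : MeasurableSpace Ω} {M : Ω → Matrix (Fin d) (Fin d) ℝ}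
    (hM : ∀ i j, Measurable fun ω => M ω i j) : Measurable fun ω => (M ω).det := by
  simp only [Matrix.det_apply]
  exact Finset.measurable_fun_sum _ fun σ _ =>
    (Finset.measurable_fun_prod _ fun i _ => hM _ _).const_smul _

/-- Determinant and adjugate are polynomial in the entries, and inversion of the determinant is
measurable also where it vanishes, so no invertibility is required. -/
theorem measurable_inv_entry {m : MeasurableSpace Ω} {M : Ω → Matrix (Fin d) (Fin d) ℝ}
    (hM : ∀ i j, Measurable fun ω => M ω i j) (i j : Fin d) :
    Measurable fun ω => (M ω)⁻¹ i j := by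
  simp only [Matrix.inv_def, Matrix.smul_apply, smul_eq_mul, Ring.inverse_eq_inv',
    Matrix.adjugate_apply]
  refine (measurable_det hM).inv.mul (measurable_det fun i' j' => ?_)
  simp only [Matrix.updateRow_apply]
  split_ifs
  · exact measurable_const
  · exact hM _ _

theorem measurable_coord {m : MeasurableSpace Ω} {x : Ω → Vec d} (hx : Measurable x) (i : Fin d) :
    Measurable fun ω => (x ω).ofLp i :=
  (EuclideanSpace.proj (𝕜 := ℝ) i).continuous.measurable.comp hx

theorem measurable_inner_act_inv {m : MeasurableSpace Ω} {M : Ω → Matrix (Fin d) (Fin d) ℝ}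
    (hM : ∀ i j, Measurable fun ω => M ω i j) {x y : Ω → Vec d} (hx : Measurable x)
    (hy : Measurable y) : Measurable fun ω => inner ℝ (x ω) (act (M ω)⁻¹ (y ω)) := by
  simp only [inner_eq_dotProduct, act_apply, dotProduct, Matrix.mulVec]
  exact Finset.measurable_fun_sum _ fun i _ => (measurable_coord hx i).mul
    (Finset.measurable_fun_sum _ fun j _ =>
      (measurable_inv_entry hM i j).mul (measurable_coord hy j))

theorem measurable_invNorm {m : MeasurableSpace Ω} {M : Ω → Matrix (Fin d) (Fin d) ℝ}
    (hM : ∀ i j, Measurable fun ω => M ω i j) {x : Ω → Vec d} (hx : Measurable x) :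
    Measurable fun ω => invNorm (M ω) (x ω) := by
  simp only [invNorm_eq]
  exact (measurable_inner_act_inv hM hx hx).sqrt

open Classical in
theorem Sig_succ_apply (P : Params) (a : ℕ → Vec d) (r : ℕ → ℝ) (hw : 1 ≤ P.w) {k ℓ : ℕ}
    (hk : 1 ≤ k) (hℓ : ℓ ∈ Finset.Icc 1 P.L) (hr : (k + 1) % P.w ≠ 0) (i j : Fin d) :
    (stateAt P a r (k + 1) ℓ).Sig i j = if roundLevel P a r k = ℓ then
      (stateAt P a r k ℓ).Sig i j + (lev ℓ / invNorm (stateAt P a r k ℓ).Sig (a k)) ^ 2 *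
        ((a k).ofLp i * (a k).ofLp j) else (stateAt P a r k ℓ).Sig i j := by
  split_ifs with hl
  · rw [Sig_succ_of_eq P a r hw hk hℓ hr hl, vecMulVec_smul_self, roundWeight, hl,
      Matrix.add_apply, Matrix.smul_apply, Matrix.vecMulVec_apply, smul_eq_mul]
  · rw [stateAt_succ P a r hk hr, update_of_ne P a r hℓ hl]

open Classical in
theorem noiseSum_succ (P : Params) (a : ℕ → Vec d) (r ε : ℕ → ℝ) {k ℓ : ℕ} (hk : 1 ≤ k)
    (hr : (k + 1) % P.w ≠ 0) :
    noiseSum P a r ε (k + 1) ℓ = if roundLevel P a r k = ℓ then noiseSum P a r ε k ℓ +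
      ((lev ℓ / invNorm (stateAt P a r k ℓ).Sig (a k)) ^ 2 * ε k) • a k
      else noiseSum P a r ε k ℓ := by
  split_ifs with hl
  · rw [noiseSum, roundSet_succ_of_eq P a r hk hr hl,
      Finset.sum_insert (notMem_roundSet P a r k ℓ), noiseSum, add_comm, roundWeight, hl]
  · rw [noiseSum, roundSet_succ_of_ne P a r hr hl, noiseSum]

variable (P : Params) (θ : ℕ → Vec d)

theorem measurableSet_roundLevel_eq {m : MeasurableSpace Ω} {k ℓ : ℕ}
    (hℓ : ℓ ∈ Finset.Icc 1 P.L) (ha : Measurable (a k))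
    (hS : ∀ ℓ ∈ Finset.Icc 1 P.L, ∀ i j, Measurable fun ω =>
      (stateAt P (fun i => a i ω) (reward θ a ε ω) k ℓ).Sig i j) :
    MeasurableSet {ω | roundLevel P (fun i => a i ω) (reward θ a ε ω) k = ℓ} := by
  have hℓ' := Finset.mem_Icc.1 hℓ
  have h : {ω | roundLevel P (fun i => a i ω) (reward θ a ε ω) k = ℓ} =
      {ω | lev ℓ ≤ invNorm (stateAt P (fun i => a i ω) (reward θ a ε ω) k ℓ).Sig (a k ω)} ∩
      ⋂ j ∈ Finset.Ico 1 ℓ,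
        {ω | invNorm (stateAt P (fun i => a i ω) (reward θ a ε ω) k j).Sig (a k ω) < lev j} := by
    ext ω
    simp only [roundLevel, Set.mem_ofPred_eq, level_eq_iff hℓ, Set.mem_inter_iff, Set.mem_iInter]
  rw [h]
  refine (measurableSet_le measurable_const (measurable_invNorm (hS ℓ hℓ) ha)).inter
    (Finset.measurableSet_biInter _ fun j hj => ?_)
  rw [Finset.mem_Ico] at hj
  exact measurableSet_lt (measurable_invNorm (hS j (Finset.mem_Icc.2 ⟨hj.1, by omega⟩)) ha)
    measurable_const

/-- Matrices, layers and weights depend only on past arms and `noiseSum` also on past noise. The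
estimates and radii, which use the rewards, are not involved, so neither is the arm selection rule.
-/
theorem measurable_Sig_noiseSum (hw : 1 ≤ P.w) {k : ℕ} (hk : 1 ≤ k) :
    ∀ ℓ ∈ Finset.Icc 1 P.L,
      (∀ i j, Measurable[history a ε k] fun ω =>
        (stateAt P (fun i => a i ω) (reward θ a ε ω) k ℓ).Sig i j) ∧
      Measurable[history a ε k] fun ω =>
        noiseSum P (fun i => a i ω) (reward θ a ε ω) (fun i => ε i ω) k ℓ := by
  have hinit : ∀ k ℓ, (∀ ω, roundSet P (fun i => a i ω) (reward θ a ε ω) k ℓ = ∅) →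
      (∀ ω, stateAt P (fun i => a i ω) (reward θ a ε ω) k = initState d P) →
      (∀ i j, Measurable[history a ε k] fun ω =>
        (stateAt P (fun i => a i ω) (reward θ a ε ω) k ℓ).Sig i j) ∧
      Measurable[history a ε k] fun ω =>
        noiseSum P (fun i => a i ω) (reward θ a ε ω) (fun i => ε i ω) k ℓ := by
    intro k ℓ h1 h2
    simp only [h2, noiseSum, h1, Finset.sum_empty]
    exact ⟨fun i j => measurable_const, measurable_const⟩
  induction k, hk using Nat.le_induction with
  | base =>
    exact fun ℓ _ => hinit 1 ℓ (fun ω => roundSet_one P _ _ ℓ) fun ω => stateAt_one P _ _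
  | succ k hk ih =>
    intro ℓ hℓ
    by_cases hr : (k + 1) % P.w = 0
    · exact hinit _ ℓ (fun ω => roundSet_restart P _ _ hw ℓ hr) fun ω => stateAt_restart P _ _ hr
    have hmono : history a ε k ≤ history a ε (k + 1) := history_mono k (k + 1) (by omega)
    have hS : ∀ ℓ ∈ Finset.Icc 1 P.L, ∀ i j, Measurable[history a ε (k + 1)] fun ω =>
        (stateAt P (fun i => a i ω) (reward θ a ε ω) k ℓ).Sig i j :=
      fun ℓ hℓ i j => ((ih ℓ hℓ).1 i j).mono hmono le_rfl
    have hN : Measurable[history a ε (k + 1)] fun ω =>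
        noiseSum P (fun i => a i ω) (reward θ a ε ω) (fun i => ε i ω) k ℓ :=
      (ih ℓ hℓ).2.mono hmono le_rfl
    have ha : Measurable[history a ε (k + 1)] (a k) := measurable_arm_history hk (by omega)
    have hε : Measurable[history a ε (k + 1)] (ε k) := measurable_noise_history k _ hk (by omega)
    have hset := measurableSet_roundLevel_eq P θ (ε := ε) hℓ ha hS
    have hc : Measurable[history a ε (k + 1)] fun ω =>
        lev ℓ / invNorm (stateAt P (fun i => a i ω) (reward θ a ε ω) k ℓ).Sig (a k ω) :=
      (measurable_invNorm (hS ℓ hℓ) ha).const_div (lev ℓ)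
    constructor
    · intro i j
      simp only [fun ω => Sig_succ_apply P (fun i => a i ω) (reward θ a ε ω) hw hk hℓ hr i j]
      exact Measurable.ite hset ((hS ℓ hℓ i j).add ((hc.pow_const 2).mul
        ((measurable_coord ha i).mul (measurable_coord ha j)))) (hS ℓ hℓ i j)
    · simp only [fun ω => noiseSum_succ P (fun i => a i ω) (reward θ a ε ω) (fun i => ε i ω)
        (ℓ := ℓ) hk hr]
      exact Measurable.ite hset (hN.add (((hc.pow_const 2).mul hε).smul ha)) hN

theorem measurable_predictable (hw : 1 ≤ P.w) {k ℓ : ℕ} (hk : 1 ≤ k) (hℓ : ℓ ∈ Finset.Icc 1 P.L)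
    (m : ℕ) (v Γ : ℝ) :
    Measurable[history a ε k] fun ω =>
      predictable P (fun i => a i ω) (reward θ a ε ω) (fun i => ε i ω) m ℓ v Γ k := by
  classical
  have hSN := measurable_Sig_noiseSum (a := a) (ε := ε) P θ hw hk
  have ha : Measurable[history a ε k] (a k) := measurable_arm_history hk le_rfl
  have hset := measurableSet_roundLevel_eq P θ (ε := ε) hℓ ha (fun ℓ hℓ => (hSN ℓ hℓ).1)
  have hc : Measurable[history a ε k] fun ω =>
      lev ℓ / invNorm (stateAt P (fun i => a i ω) (reward θ a ε ω) k ℓ).Sig (a k ω) :=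
    (measurable_invNorm (hSN ℓ hℓ).1 ha).const_div (lev ℓ)
  have h : (fun ω => predictable P (fun i => a i ω) (reward θ a ε ω) (fun i => ε i ω) m ℓ v Γ k) =
      fun ω => if k / P.w = m ∧ roundLevel P (fun i => a i ω) (reward θ a ε ω) k = ℓ ∧
          noiseNorm P (fun i => a i ω) (reward θ a ε ω) (fun i => ε i ω) k ℓ ≤
            noiseThreshold P ℓ v Γ then
        noiseScale P ℓ v Γ *
        ((lev ℓ / invNorm (stateAt P (fun i => a i ω) (reward θ a ε ω) k ℓ).Sig (a k ω)) ^ 2 *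
          inner ℝ (a k ω) (act (stateAt P (fun i => a i ω) (reward θ a ε ω) k ℓ).Sig⁻¹
            (noiseSum P (fun i => a i ω) (reward θ a ε ω) (fun i => ε i ω) k ℓ))) else 0 := by
    funext ω
    unfold predictable
    split_ifs with hl
    · rw [noiseCoef, roundWeight, hl.2.1]
    · rfl
  rw [h]
  refine Measurable.ite ?_ (((hc.pow_const 2).mul
    (measurable_inner_act_inv (hSN ℓ hℓ).1 ha (hSN ℓ hℓ).2)).const_mul _) measurable_const
  refine MeasurableSet.inter (MeasurableSet.const _) (hset.inter ?_)
  exact measurableSet_le (measurable_invNorm (hSN ℓ hℓ).1 (hSN ℓ hℓ).2) measurable_const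

end

/-! ### Epochs and the probability that one of them is bad -/

/-- The rounds of epoch `m`. -/
def epoch (w K m : ℕ) : Finset ℕ := (Finset.Icc 1 K).filter fun k => k / w = m

theorem mem_epoch {w K m k : ℕ} : k ∈ epoch w K m ↔ k ∈ Finset.Icc 1 K ∧ k / w = m :=
  Finset.mem_filter

theorem card_epoch_le {w : ℕ} (hw : 1 ≤ w) (K m : ℕ) : (epoch w K m).card ≤ w := by
  have h : epoch w K m ⊆ Finset.Ico (m * w) (m * w + w) := by
    intro k hk
    have hk := (mem_epoch.1 hk).2
    have h1 := Nat.div_mul_le_self k w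
    have h2 := Nat.lt_div_mul_add (a := k) hw
    rw [hk] at h1 h2
    exact Finset.mem_Ico.2 ⟨h1, h2⟩
  simpa using Finset.card_le_card h

/-- The logarithm `log (4 w² L / δ)` in the confidence radius. -/
noncomputable def logConf (P : Params) : ℝ := Real.log (4 * (P.w : ℝ) ^ 2 * P.L / P.δ)

theorem exp_logConf {P : Params} (hw : 1 ≤ P.w) (hL : 1 ≤ P.L) (hδ : 0 < P.δ) :
    Real.exp (logConf P) = 4 * (P.w : ℝ) ^ 2 * P.L / P.δ := by
  have : (0 : ℝ) < P.w := by exact_mod_cast hw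
  have : (0 : ℝ) < P.L := by exact_mod_cast hL
  exact Real.exp_log (by positivity)

theorem one_le_logConf {P : Params} (hw : 1 ≤ P.w) (hL : 1 ≤ P.L) (hδ : 0 < P.δ)
    (hδ1 : P.δ < 1) : 1 ≤ logConf P := by
  rw [← Real.exp_le_exp, exp_logConf hw hL hδ, le_div_iff₀ hδ]
  have h1 : (1 : ℝ) ≤ P.w := by exact_mod_cast hw
  have h2 : (1 : ℝ) ≤ P.L := by exact_mod_cast hL
  have h3 := Real.exp_one_lt_d9
  have h4 : (1 : ℝ) ≤ (P.w : ℝ) ^ 2 := one_le_pow₀ h1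
  have h5 : (1 : ℝ) ≤ (P.w : ℝ) ^ 2 * P.L := one_le_mul_of_one_le_of_one_le h4 h2
  nlinarith [Real.exp_pos 1]

section
variable {d : ℕ} (P : Params) (a : ℕ → Vec d) (r ε : ℕ → ℝ)

theorem card_roundSet_lt (hw : 1 ≤ P.w) (k ℓ : ℕ) : (roundSet P a r k ℓ).card < P.w := by
  have h : roundSet P a r k ℓ ⊆ Finset.Ico (k / P.w * P.w) k := by
    intro i hi
    have hi := (mem_roundSet P a r).1 hi
    have h1 := Nat.div_mul_le_self i P.w
    rw [hi.2.1] at h1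
    exact Finset.mem_Ico.2 ⟨h1, hi.1.2⟩
  have h2 := Finset.card_le_card h
  rw [Nat.card_Ico] at h2
  have h3 := Nat.lt_div_mul_add (a := k) hw
  omega

/-- The self-normalised noise is small in the epoch `m`. -/
def GoodEpoch (K m : ℕ) : Prop :=
  ∀ ℓ ∈ Finset.Icc 1 P.L, ∀ k ∈ epoch P.w K m, noiseNorm P a r ε k ℓ ≤
    lev ℓ * (8 * √(logConf P * (noiseEnergy P a r ε k ℓ + P.R ^ 2)) + 8 * P.R * logConf P)

theorem noiseEnergy_le {K k ℓ : ℕ} (hℓ : ℓ ∈ Finset.Icc 1 P.L)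
    (hk : k ∈ Finset.Icc 1 K) (hε : ∀ i ∈ Finset.Icc 1 K, |ε i| ≤ P.R) :
    noiseEnergy P a r ε k ℓ ≤ (roundSet P a r k ℓ).card * P.R ^ 2 := by
  rw [← nsmul_eq_mul]
  refine Finset.sum_le_card_nsmul _ _ _ fun i hi => ?_
  have hi := (mem_roundSet P a r).1 hi
  have hk := Finset.mem_Icc.1 hk
  have h1 := hε i (Finset.mem_Icc.2 ⟨hi.1.1, by omega⟩)
  rw [mul_pow, ← sq_abs (ε i)]
  calc _ ≤ 1 * P.R ^ 2 := mul_le_mul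
        (pow_le_one₀ (roundWeight_nonneg P a r i) (roundWeight_le_one P a r hℓ hi.2.2))
        (pow_le_pow_left₀ (abs_nonneg _) h1 2) (sq_nonneg _) zero_le_one
    _ = _ := one_mul _

theorem goodEpoch_of_R_eq_zero {K m : ℕ} (hR : P.R = 0)
    (hε : ∀ i ∈ Finset.Icc 1 K, |ε i| ≤ P.R) : GoodEpoch P a r ε K m := by
  intro ℓ hℓ k hk
  have hk := Finset.mem_Icc.1 (mem_epoch.1 hk).1
  have h : noiseSum P a r ε k ℓ = 0 := by
    refine Finset.sum_eq_zero fun i hi => ?_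
    have hi := (mem_roundSet P a r).1 hi
    have h1 := hε i (Finset.mem_Icc.2 ⟨hi.1.1, by omega⟩)
    rw [hR] at h1
    rw [abs_nonpos_iff.1 h1, mul_zero, zero_smul]
  have h0 : noiseNorm P a r ε k ℓ = 0 := by simp [noiseNorm, h, invNorm_eq]
  rw [h0, hR]
  have := lev_pos ℓ
  simp only [mul_zero, zero_mul, add_zero]
  positivity

/-- Peeling: the threshold is available only for deterministic v, so the random energy is rounded up
to a multiple of R². Fewer than w rounds precede in the epoch, so w grid values suffice. Rounding
adds at most R², the extra summand in `GoodEpoch`. -/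
theorem goodEpoch_of_forall (hw : 1 ≤ P.w) (hL : 1 ≤ P.L) (hδ : 0 < P.δ) (hδ1 : P.δ < 1)
    {K m : ℕ} (hR : 0 < P.R) (hε : ∀ i ∈ Finset.Icc 1 K, |ε i| ≤ P.R)
    (hev : ∀ ℓ ∈ Finset.Icc 1 P.L, ∀ k ∈ epoch P.w K m, ∀ j ∈ Finset.range P.w,
      ∑ i ∈ Finset.Ico 1 k,
        (predictable P a r ε m ℓ (P.R ^ 2 * (j + 1)) (2 * logConf P) i * ε i
        - (predictable P a r ε m ℓ (P.R ^ 2 * (j + 1)) (2 * logConf P) i * ε i) ^ 2)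
        ≤ 2 * logConf P) : GoodEpoch P a r ε K m := by
  intro ℓ hℓ k hk
  have hk' := mem_epoch.1 hk
  have hlog := one_le_logConf hw hL hδ hδ1
  set V := noiseEnergy P a r ε k ℓ with hV
  have hV0 : 0 ≤ V := noiseEnergy_nonneg P a r ε k ℓ
  have hR2 : 0 < P.R ^ 2 := by positivity
  have hVc := noiseEnergy_le P a r ε hℓ hk'.1 hε
  have hcard : ((roundSet P a r k ℓ).card : ℝ) < P.w := by
    exact_mod_cast card_roundSet_lt P a r hw k ℓ
  set j := ⌊V / P.R ^ 2⌋₊ with hj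
  have hjw : j ∈ Finset.range P.w := by
    rw [Finset.mem_range, hj, Nat.floor_lt (by positivity), div_lt_iff₀ hR2]
    exact hVc.trans_lt (mul_lt_mul_of_pos_right hcard hR2)
  set v := P.R ^ 2 * ((j : ℝ) + 1) with hv
  have hv1 : V ≤ v := by
    have := (Nat.lt_floor_add_one (V / P.R ^ 2)).le
    rw [div_le_iff₀ hR2] at this
    rw [hv, mul_comm]; exact this
  have hv2 : v ≤ V + P.R ^ 2 := by
    have := Nat.floor_le (show 0 ≤ V / P.R ^ 2 by positivity)
    rw [le_div_iff₀ hR2] at this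
    rw [hv]; linarith
  have hv0 : 0 ≤ v := hV0.trans hv1
  refine (noiseNorm_le_threshold P a r ε hw hR (by linarith) hv0 hℓ
    (fun i hi hm => hev ℓ hℓ i (mem_epoch.2 ⟨hi, hm⟩) j hjw) hk'.1 hk'.2 hv1).trans ?_
  rw [noiseThreshold]
  refine mul_le_mul_of_nonneg_left ?_ (lev_pos ℓ).le
  set g := logConf P with hg
  set y := √(g * (V + P.R ^ 2)) with hy
  have hsq : y ^ 2 = g * (V + P.R ^ 2) := Real.sq_sqrt (by positivity)
  have hy0 : 0 ≤ y := Real.sqrt_nonneg _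
  -- √2 ≤ 3/2, and 4 · 3/2 + 2 = 8 is the constant in `GoodEpoch`.
  have h1 : √(v * (2 * g)) ≤ 3 / 2 * y := by
    refine Real.sqrt_le_iff.2 ⟨by positivity, ?_⟩
    nlinarith [mul_le_mul_of_nonneg_left hv2 (show 0 ≤ g by linarith),
      mul_nonneg (show 0 ≤ g by linarith) hv0]
  have h2 : √v ≤ y := by
    refine Real.sqrt_le_iff.2 ⟨by positivity, ?_⟩
    nlinarith
  linarith

end

/-- A union bound over layers, rounds of the epoch and grid values. At level `logConf` the at most
L·w² events would total δ/4; doubling the exponent makes the total small enough for δ/w, as Markov's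
inequality over the epochs will require. -/
theorem measureReal_badEpoch_le {Ω : Type*} {m0 : MeasurableSpace Ω} {μ : Measure Ω}
    [IsProbabilityMeasure μ] {d K : ℕ} {P : Params} {a : ℕ → Ω → Vec d} {ε : ℕ → Ω → ℝ}
    (θ : ℕ → Vec d) (hw : 1 ≤ P.w) (hL : 1 ≤ P.L) (hδ : 0 < P.δ) (hδ1 : P.δ < 1)
    (ha : ∀ k ∈ Finset.Icc 1 K, Measurable (a k)) (hεm : ∀ k ∈ Finset.Icc 1 K, Measurable (ε k))
    (hεb : ∀ k ∈ Finset.Icc 1 K, ∀ᵐ ω ∂μ, |ε k ω| ≤ P.R)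
    (hmean : ∀ k ∈ Finset.Icc 1 K, μ[ε k | history a ε k] =ᵐ[μ] fun _ => 0)
    (hR : 0 < P.R) (m : ℕ) :
    μ.real {ω | ¬ ∀ ℓ ∈ Finset.Icc 1 P.L, ∀ k ∈ epoch P.w K m, ∀ j ∈ Finset.range P.w,
      ∑ i ∈ Finset.Ico 1 k,
        (predictable P (fun i => a i ω) (reward θ a ε ω) (fun i => ε i ω) m ℓ
            (P.R ^ 2 * (j + 1)) (2 * logConf P) i * ε i ω
        - (predictable P (fun i => a i ω) (reward θ a ε ω) (fun i => ε i ω) m ℓ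
            (P.R ^ 2 * (j + 1)) (2 * logConf P) i * ε i ω) ^ 2) ≤ 2 * logConf P}
      ≤ P.δ / P.w := by
  have hlog := one_le_logConf hw hL hδ hδ1
  set S : ℕ → ℕ → ℕ → Ω → ℝ := fun ℓ k j ω => ∑ i ∈ Finset.Ico 1 k,
        (predictable P (fun i => a i ω) (reward θ a ε ω) (fun i => ε i ω) m ℓ
            (P.R ^ 2 * (j + 1)) (2 * logConf P) i * ε i ω
        - (predictable P (fun i => a i ω) (reward θ a ε ω) (fun i => ε i ω) m ℓ
            (P.R ^ 2 * (j + 1)) (2 * logConf P) i * ε i ω) ^ 2) with hS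
  have hone : ∀ ℓ ∈ Finset.Icc 1 P.L, ∀ k ∈ epoch P.w K m, ∀ j,
      μ.real {ω | 2 * logConf P ≤ S ℓ k j ω} ≤ Real.exp (-(2 * logConf P)) := by
    intro ℓ hℓ k hk j
    have hk' := Finset.mem_Icc.1 (mem_epoch.1 hk).1
    obtain ⟨h1, h2⟩ := integral_exp_sum_sub_sq_le (μ := μ) (F := history a ε) (K := K) (ε := ε)
      (R := P.R) (b := (2 * P.R)⁻¹) (n := k) (history_le ha hεm) history_mono
      measurable_noise_history hεm hεb hmean
      (p := fun i ω => predictable P (fun i => a i ω) (reward θ a ε ω) (fun i => ε i ω) m ℓ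
            (P.R ^ 2 * (j + 1)) (2 * logConf P) i)
      (fun i hi => measurable_predictable P θ hw (Finset.mem_Icc.1 hi).1 hℓ m _ _)
      (fun i hi ω => abs_predictable_le P _ _ _ hw hR (by linarith) (Finset.mem_Icc.1 hi).1 hℓ)
      (by rw [mul_inv, mul_assoc, inv_mul_cancel₀ hR.ne']; norm_num) hk'.1 (by omega)
    exact measureReal_le_of_integral_exp_le_one h1 h2
  have hsub : {ω | ¬ ∀ ℓ ∈ Finset.Icc 1 P.L, ∀ k ∈ epoch P.w K m, ∀ j ∈ Finset.range P.w,
      S ℓ k j ω ≤ 2 * logConf P} ⊆ ⋃ ℓ ∈ Finset.Icc 1 P.L, ⋃ k ∈ epoch P.w K m,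
        ⋃ j ∈ Finset.range P.w, {ω | 2 * logConf P ≤ S ℓ k j ω} := by
    intro ω hω
    simp only [Set.mem_ofPred_eq, not_forall, not_le] at hω
    obtain ⟨ℓ, hℓ, k, hk, j, hj, h⟩ := hω
    simp only [Set.mem_iUnion]
    exact ⟨ℓ, hℓ, k, hk, j, hj, h.le⟩
  have hw' : (1 : ℝ) ≤ P.w := by exact_mod_cast hw
  have hL' : (1 : ℝ) ≤ P.L := by exact_mod_cast hL
  set e := Real.exp (-(2 * logConf P)) with he
  have he0 : 0 < e := Real.exp_pos _
  have hepoch : ((epoch P.w K m).card : ℝ) ≤ P.w := by exact_mod_cast card_epoch_le hw K m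
  calc _ ≤ μ.real (⋃ ℓ ∈ Finset.Icc 1 P.L, ⋃ k ∈ epoch P.w K m,
        ⋃ j ∈ Finset.range P.w, {ω | 2 * logConf P ≤ S ℓ k j ω}) := measureReal_mono hsub (measure_ne_top _ _)
    _ ≤ ∑ ℓ ∈ Finset.Icc 1 P.L, ∑ k ∈ epoch P.w K m, ∑ j ∈ Finset.range P.w, e := by
        refine (measureReal_biUnion_finset_le _ _).trans (Finset.sum_le_sum fun ℓ hℓ => ?_)
        refine (measureReal_biUnion_finset_le _ _).trans (Finset.sum_le_sum fun k hk => ?_)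
        refine (measureReal_biUnion_finset_le _ _).trans (Finset.sum_le_sum fun j _ => ?_)
        exact hone ℓ hℓ k hk j
    _ = P.L * ((epoch P.w K m).card * (P.w * e)) := by simp
    _ ≤ P.L * (P.w * (P.w * e)) := by gcongr
    _ ≤ P.δ / P.w := by
        have : e = (4 * (P.w : ℝ) ^ 2 * P.L / P.δ)⁻¹ ^ 2 := by
          rw [he, ← exp_logConf hw hL hδ, ← Real.exp_neg, ← Real.exp_nat_mul]
          congr 1; push_cast; ring
        rw [this, inv_div, div_pow]
        have h0 : (0 : ℝ) < P.w := by linarith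
        have h0' : (0 : ℝ) < P.L := by linarith
        rw [le_div_iff₀ h0]
        have h6 : P.L * (P.w * (P.w * (P.δ ^ 2 / (4 * (P.w : ℝ) ^ 2 * P.L) ^ 2))) * P.w =
            P.δ * (P.δ / (16 * P.w * P.L)) := by
          field_simp; ring
        rw [h6]
        refine mul_le_of_le_one_right hδ.le ?_
        rw [div_le_one (by positivity)]
        nlinarith

/-! ### Estimation error and residuals -/

theorem sqrt_sum_add_sq_le {ι : Type*} (s : Finset ι) (f g : ι → ℝ) :
    √(∑ i ∈ s, (f i + g i) ^ 2) ≤ √(∑ i ∈ s, f i ^ 2) + √(∑ i ∈ s, g i ^ 2) := by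
  refine Real.sqrt_le_iff.2 ⟨by positivity, ?_⟩
  have h := Real.sum_mul_le_sqrt_mul_sqrt s f g
  rw [add_sq, Real.sq_sqrt (Finset.sum_nonneg fun _ _ => sq_nonneg _),
    Real.sq_sqrt (Finset.sum_nonneg fun _ _ => sq_nonneg _)]
  have : ∑ i ∈ s, (f i + g i) ^ 2 =
      ∑ i ∈ s, f i ^ 2 + 2 * ∑ i ∈ s, f i * g i + ∑ i ∈ s, g i ^ 2 := by
    rw [Finset.mul_sum, ← Finset.sum_add_distrib, ← Finset.sum_add_distrib]
    exact Finset.sum_congr rfl fun i _ => by ring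
  rw [this]; linarith

/-- The logarithm `log (4 (w + 1)² L / δ)` in the variance estimate. -/
noncomputable def logVar (P : Params) : ℝ :=
  Real.log (4 * ((P.w : ℝ) + 1) ^ 2 * P.L / P.δ)

theorem logConf_le_logVar {P : Params} (hw : 1 ≤ P.w) (hL : 1 ≤ P.L) (hδ : 0 < P.δ) :
    logConf P ≤ logVar P := by
  have h0 : (0 : ℝ) < P.w := by exact_mod_cast hw
  have h1 : (0 : ℝ) < P.L := by exact_mod_cast hL
  refine Real.log_le_log (by positivity) ?_
  gcongr
  linarith

section
variable {d : ℕ} (P : Params) (a θ : ℕ → Vec d) (r ε : ℕ → ℝ)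

/-- The Euclidean norm of the perturbation of the rewards of layer `ℓ` that comes from the change
of the feature vectors. -/
noncomputable def driftNorm (k ℓ : ℕ) : ℝ :=
  √(∑ i ∈ roundSet P a r k ℓ, (roundWeight P a r i * inner ℝ (a i) (θ i - θ k)) ^ 2)

/-- The estimation error of layer `ℓ` in round `k`, in the norm of `Σ̂_ℓ`. -/
noncomputable def estError (k ℓ : ℕ) : ℝ :=
  invNorm (stateAt P a r k ℓ).Sig ((stateAt P a r k ℓ).b -
    act (stateAt P a r k ℓ).Sig (θ k))

/-- The weighted residual sum of squares of layer `ℓ` before round `k`. -/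
noncomputable def residual (k ℓ : ℕ) : ℝ :=
  ∑ i ∈ roundSet P a r k ℓ,
    roundWeight P a r i ^ 2 * (r i - inner ℝ (stateAt P a r k ℓ).est (a i)) ^ 2

theorem driftNorm_nonneg (k ℓ : ℕ) : 0 ≤ driftNorm P a θ r k ℓ := Real.sqrt_nonneg _

theorem residual_nonneg (k ℓ : ℕ) : 0 ≤ residual P a r k ℓ :=
  Finset.sum_nonneg fun _ _ => by positivity

variable {P a θ r ε} {k ℓ : ℕ}

theorem est_sub_eq (hw : 1 ≤ P.w) (hk : 1 ≤ k) (hℓ : ℓ ∈ Finset.Icc 1 P.L) :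
    (stateAt P a r k ℓ).est - θ k = act (stateAt P a r k ℓ).Sig⁻¹ ((stateAt P a r k ℓ).b -
      act (stateAt P a r k ℓ).Sig (θ k)) := by
  rw [map_sub, act_inv_act (posDef_Sig P a r hw hk hℓ), (isLayer_stateAt P a r hw hk hℓ).est]

theorem abs_inner_est_sub_le (hw : 1 ≤ P.w) (hk : 1 ≤ k) (hℓ : ℓ ∈ Finset.Icc 1 P.L) (x : Vec d) :
    |inner ℝ x (stateAt P a r k ℓ).est - inner ℝ x (θ k)| ≤
      invNorm (stateAt P a r k ℓ).Sig x * estError P a θ r k ℓ := by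
  rw [← inner_sub_right, est_sub_eq hw hk hℓ]
  exact abs_inner_act_inv_le (posDef_Sig P a r hw hk hℓ) _ _

/-- Substituting the rewards decomposes b̂ − Σ̂θ_k into drift, noise and regularisation. The
regularisation contributes ρB because the dual norm of θ_k is at most ‖θ_k‖/ρ. -/
theorem estError_le (hw : 1 ≤ P.w) (hr : ∀ i, r i = inner ℝ (θ i) (a i) + ε i) (hk : 1 ≤ k)
    (hℓ : ℓ ∈ Finset.Icc 1 P.L) (hθ : ‖θ k‖ ≤ P.B) :
    estError P a θ r k ℓ ≤ driftNorm P a θ r k ℓ + noiseNorm P a r ε k ℓ + lev ℓ * P.B := by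
  have hlay := isLayer_stateAt P a r hw hk hℓ
  have hM := posDef_Sig P a r hw hk hℓ
  have hl := lev_pos ℓ
  have hl2 : 0 < lev ℓ ^ 2 := by positivity
  have hG : (stateAt P a r k ℓ).b - act (stateAt P a r k ℓ).Sig (θ k) =
      ∑ i ∈ roundSet P a r k ℓ, (roundWeight P a r i * inner ℝ (a i) (θ i - θ k)) •
        (roundWeight P a r i • a i) + noiseSum P a r ε k ℓ + (-(lev ℓ ^ 2)) • θ k := by
    rw [hlay.b, hlay.Sig, act_design, noiseSum, ← Finset.sum_add_distrib, neg_smul,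
      ← sub_eq_add_neg, sub_add_eq_sub_sub_swap, ← Finset.sum_sub_distrib]
    congr 1
    refine Finset.sum_congr rfl fun i _ => ?_
    rw [hr i, smul_smul, smul_smul, ← sub_smul, ← add_smul, inner_sub_right,
      real_inner_smul_left, real_inner_comm (a i) (θ i)]
    congr 1; ring
  rw [estError, hG]
  refine (invNorm_add_le hM _ _).trans (add_le_add ((invNorm_add_le hM _ _).trans
    (add_le_add ?_ le_rfl)) ?_)
  · rw [hlay.Sig]
    exact invNorm_sum_smul_le hl2 _ _ _
  · rw [invNorm_smul, abs_neg, abs_of_pos hl2, hlay.Sig]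
    have h := sqrt_mul_invNorm_le hl2 (roundSet P a r k ℓ) (fun i => roundWeight P a r i • a i)
      (θ k)
    rw [Real.sqrt_sq hl.le] at h
    refine le_trans (le_of_eq ?_) (mul_le_mul_of_nonneg_left (h.trans hθ) hl.le)
    ring

/-- The weighted residual vector is weighted noise plus drift minus the fitted error, whose ℓ² norm
is at most `estError` by `sum_inner_sq_le`. Both claims are the triangle inequality. -/
theorem residual_bounds (hw : 1 ≤ P.w) (hr : ∀ i, r i = inner ℝ (θ i) (a i) + ε i) (hk : 1 ≤ k)
    (hℓ : ℓ ∈ Finset.Icc 1 P.L) :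
    √(noiseEnergy P a r ε k ℓ) ≤
        √(residual P a r k ℓ) + driftNorm P a θ r k ℓ + estError P a θ r k ℓ ∧
      √(residual P a r k ℓ) ≤
        √(noiseEnergy P a r ε k ℓ) + driftNorm P a θ r k ℓ + estError P a θ r k ℓ := by
  have hlay := isLayer_stateAt P a r hw hk hℓ
  have hl := lev_pos ℓ
  have hl2 : 0 < lev ℓ ^ 2 := by positivity
  set G := (stateAt P a r k ℓ).b - act (stateAt P a r k ℓ).Sig (θ k) with hG
  set I := roundSet P a r k ℓ with hI
  set q : ℕ → ℝ := fun i => inner ℝ (roundWeight P a r i • a i) (act (stateAt P a r k ℓ).Sig⁻¹ G)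
    with hq
  have hE : √(∑ i ∈ I, q i ^ 2) ≤ estError P a θ r k ℓ := by
    refine Real.sqrt_le_iff.2 ⟨invNorm_nonneg _ _, ?_⟩
    rw [estError, ← hG, hq]
    simp only [hlay.Sig]
    exact sum_inner_sq_le hl2 _ _ _
  set z : ℕ → ℝ := fun i => roundWeight P a r i * inner ℝ (a i) (θ i - θ k) with hz
  set e : ℕ → ℝ := fun i => roundWeight P a r i *
    (r i - inner ℝ (stateAt P a r k ℓ).est (a i)) with he
  have hres : residual P a r k ℓ = ∑ i ∈ I, e i ^ 2 :=
    Finset.sum_congr rfl fun i _ => by rw [he, mul_pow]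
  have hrel : ∀ i, e i = roundWeight P a r i * ε i + z i - q i := by
    intro i
    simp only [he, hz, hq]
    rw [hG, ← est_sub_eq hw hk hℓ, hr i, inner_sub_right, real_inner_smul_left, inner_sub_right,
      real_inner_comm (a i) (θ i), real_inner_comm (a i) (stateAt P a r k ℓ).est]
    ring
  have hneg : ∀ f : ℕ → ℝ, ∑ i ∈ I, (-f i) ^ 2 = ∑ i ∈ I, f i ^ 2 := fun f =>
    Finset.sum_congr rfl fun i _ => neg_sq _
  have hd : driftNorm P a θ r k ℓ = √(∑ i ∈ I, z i ^ 2) := rfl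
  rw [hres, hd]
  constructor
  · have h1 : noiseEnergy P a r ε k ℓ = ∑ i ∈ I, ((e i + -z i) + q i) ^ 2 :=
      Finset.sum_congr rfl fun i _ => by rw [hrel]; ring
    rw [h1]
    refine (sqrt_sum_add_sq_le _ _ _).trans (add_le_add ((sqrt_sum_add_sq_le _ _ _).trans ?_) hE)
    rw [hneg]
  · have h1 : ∑ i ∈ I, e i ^ 2 = ∑ i ∈ I, ((roundWeight P a r i * ε i + z i) + -q i) ^ 2 :=
      Finset.sum_congr rfl fun i _ => by rw [hrel]; ring
    rw [h1]
    refine (sqrt_sum_add_sq_le _ _ _).trans (add_le_add (sqrt_sum_add_sq_le _ _ _) ?_)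
    rw [hneg]; exact hE

end

/-! ### Validity and size of the confidence radius -/

/-- The layers whose confidence radius uses the residuals. -/
def IsHigh (P : Params) (ℓ : ℕ) : Prop := 64 * √(logVar P) ≤ (2 : ℝ) ^ ℓ

theorem lev_mul_sqrt_le {P : Params} {ℓ : ℕ} (h : IsHigh P ℓ) : 64 * (lev ℓ * √(logVar P)) ≤ 1 := by
  rw [IsHigh] at h
  rw [lev_eq]
  have : (0 : ℝ) < 2 ^ ℓ := by positivity
  rw [← mul_assoc, mul_comm (64 : ℝ), mul_assoc, inv_mul_le_iff₀ this, mul_one]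
  exact h

theorem one_le_of_not_isHigh {P : Params} {ℓ : ℕ} (hl : 0 ≤ logVar P) (h : ¬ IsHigh P ℓ) :
    1 ≤ 4096 * (lev ℓ ^ 2 * logVar P) := by
  rw [IsHigh, not_le] at h
  rw [lev_eq]
  have h2 : (0 : ℝ) < 2 ^ ℓ := by positivity
  have h3 : ((2 : ℝ) ^ ℓ) ^ 2 ≤ (64 * √(logVar P)) ^ 2 := pow_le_pow_left₀ h2.le h.le 2
  rw [mul_pow, Real.sq_sqrt hl] at h3
  rw [inv_pow, ← mul_assoc, mul_comm (4096 : ℝ), mul_assoc, ← div_eq_inv_mul,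
    one_le_div (by positivity)]
  linarith

section
variable {d : ℕ} {P : Params} {a θ : ℕ → Vec d} {r ε : ℕ → ℝ} {k ℓ K m : ℕ}

theorem varEst_of_isHigh (h : IsHigh P ℓ) :
    varEst P a r ℓ (stateAt P a r k ℓ).est (roundSet P a r k ℓ) (roundWeight P a r)
      = residual P a r k ℓ := by
  rw [IsHigh, logVar] at h
  rw [varEst, if_pos h]; rfl

theorem varEst_of_not_isHigh (h : ¬ IsHigh P ℓ) :
    varEst P a r ℓ (stateAt P a r k ℓ).est (roundSet P a r k ℓ) (roundWeight P a r)
      = P.R ^ 2 * (roundSet P a r k ℓ).card := by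
  rw [IsHigh, logVar] at h
  rw [varEst, if_neg h]

theorem sqrt_add_le_add {x y : ℝ} (hx : 0 ≤ x) (hy : 0 ≤ y) : √(x + y ^ 2) ≤ √x + y := by
  refine Real.sqrt_le_iff.2 ⟨by positivity, ?_⟩
  rw [add_sq, Real.sq_sqrt hx]
  nlinarith [mul_nonneg (Real.sqrt_nonneg x) hy]

/-- The algebra behind the validity of the confidence radius computed from the residuals. -/
theorem noise_le_of_residual {ρ l1 g sV n e Z B Bm R : ℝ} (hρ : 0 < ρ) (hg : 1 ≤ g) (hgl : g ≤ l1)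
    (hh : 64 * (ρ * √l1) ≤ 1) (hsV : 0 ≤ sV) (hZ : 0 ≤ Z) (hB : 0 ≤ B)
    (hBm : B ≤ Bm) (hR : 0 ≤ R) (hn : n ≤ ρ * (8 * (√g * (sV + R)) + 8 * R * g))
    (hV : sV ≤ e + 2 * Z + n + ρ * B) :
    n ≤ 16 * ρ * √(8 * e ^ 2 + 6 * R ^ 2 * l1 + 4 * ρ ^ 2 * Bm ^ 2) * √g + 6 * ρ * R * g + Z ∧
      n ≤ (sV + R) / 8 + R * √l1 / 8 := by
  set s := √g with hs
  set t := √l1 with ht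
  have hs1 : 1 ≤ s := Real.one_le_sqrt.2 hg
  have hst : s ≤ t := Real.sqrt_le_sqrt hgl
  have hg2 : g = s ^ 2 := (Real.sq_sqrt (by linarith)).symm
  have hl2 : l1 = t ^ 2 := (Real.sq_sqrt (by linarith)).symm
  have hρs : 64 * (ρ * s) ≤ 1 := by nlinarith
  have hρs0 : 0 < ρ * s := by positivity
  have hn2 : n ≤ (ρ * s) * (8 * (sV + R) + 8 * R * t) := by
    refine hn.trans ?_
    rw [hg2]
    have : 0 ≤ ρ * s * R * (t - s) := by
      have := sub_nonneg.2 hst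
      positivity
    nlinarith
  have hRt : R ≤ R * t := le_mul_of_one_le_right hR (hs1.trans hst)
  -- This makes the argument self-bounding: the noise is at most √V/8 plus multiples of R, so it can
  -- be absorbed when √V is bounded through the residuals.
  have hn3 : n ≤ (sV + R) / 8 + R * t / 8 := by
    have : (ρ * s) * (8 * (sV + R) + 8 * R * t) ≤ 1 / 64 * (8 * (sV + R) + 8 * R * t) :=
      mul_le_mul_of_nonneg_right (by linarith) (by nlinarith)
    linarith
  refine ⟨?_, hn3⟩
  have hρB : 0 ≤ ρ * B := by positivity
  have hsV2 : sV ≤ 8 / 7 * (e + 2 * Z + ρ * B + R * t / 4) := by linarith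
  -- 64/7 = 8 · 8/7 and 128/7 = 2 · 64/7 come from inserting `hsV2`; the R terms total 16/7 + 16 ≤
  -- 19.
  have hn4 : n ≤ (ρ * s) * (64 / 7 * (e + ρ * B) + 19 * (R * t)) + (ρ * s) * (128 / 7 * Z) := by
    rw [← mul_add]
    refine hn2.trans (mul_le_mul_of_nonneg_left ?_ hρs0.le)
    nlinarith
  have hZ2 : (ρ * s) * (128 / 7 * Z) ≤ Z := by nlinarith
  have hroot : 64 / 7 * (e + ρ * B) + 19 * (R * t) ≤
      16 * √(8 * e ^ 2 + 6 * R ^ 2 * l1 + 4 * ρ ^ 2 * Bm ^ 2) := by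
    rw [← div_le_iff₀' (by norm_num)]
    refine Real.le_sqrt_of_sq_le ?_
    rw [hl2]
    have h1 : (ρ * B) ^ 2 ≤ ρ ^ 2 * Bm ^ 2 := by
      rw [mul_pow]
      exact mul_le_mul_of_nonneg_left (pow_le_pow_left₀ hB hBm 2) (sq_nonneg _)
    nlinarith [sq_nonneg (e - ρ * B), sq_nonneg (e - R * t), sq_nonneg (ρ * B - R * t),
      sq_nonneg e, sq_nonneg (R * t), sq_nonneg (ρ * B)]
  have h2 := mul_le_mul_of_nonneg_left hroot hρs0.le
  have h3 : 0 ≤ 6 * ρ * R * g := by positivity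
  nlinarith

theorem B_le_Bmax (P : Params) : P.B ≤ P.Bmax := le_max_left _ _

theorem noiseNorm_le_of_goodEpoch (hw : 1 ≤ P.w) (hL : 1 ≤ P.L) (hδ : 0 < P.δ) (hδ1 : P.δ < 1)
    (hR : 0 ≤ P.R) (hgood : GoodEpoch P a r ε K m) (hk : k ∈ epoch P.w K m)
    (hℓ : ℓ ∈ Finset.Icc 1 P.L) :
    noiseNorm P a r ε k ℓ ≤ lev ℓ * (8 * (√(logConf P) *
      (√(noiseEnergy P a r ε k ℓ) + P.R)) + 8 * P.R * logConf P) := by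
  have hg := one_le_logConf hw hL hδ hδ1
  refine (hgood ℓ hℓ k hk).trans (mul_le_mul_of_nonneg_left ?_ (lev_pos ℓ).le)
  have h1 := sqrt_add_le_add (noiseEnergy_nonneg P a r ε k ℓ) hR
  rw [Real.sqrt_mul (by linarith)]
  have h2 := mul_le_mul_of_nonneg_left h1 (Real.sqrt_nonneg (logConf P))
  linarith

/-- One drift norm comes from the error decomposition. The second is the price of estimating the
noise energy by residuals that themselves contain the drift. -/
theorem estError_le_radius (hw : 1 ≤ P.w) (hL : 1 ≤ P.L) (hδ : 0 < P.δ) (hδ1 : P.δ < 1)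
    (hR : 0 ≤ P.R) (hr : ∀ i, r i = inner ℝ (θ i) (a i) + ε i)
    (hε : ∀ i ∈ Finset.Icc 1 K, |ε i| ≤ P.R) (hgood : GoodEpoch P a r ε K m)
    (hk : k ∈ epoch P.w K m) (hℓ : ℓ ∈ Finset.Icc 1 P.L) (hθ : ‖θ k‖ ≤ P.B) :
    estError P a θ r k ℓ ≤ (stateAt P a r k ℓ).radius + 2 * driftNorm P a θ r k ℓ := by
  have hkK := (mem_epoch.1 hk).1
  have hk1 := (Finset.mem_Icc.1 hkK).1
  have hlay := isLayer_stateAt P a r hw hk1 hℓ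
  have hE := estError_le hw hr hk1 hℓ hθ
  have hg := one_le_logConf hw hL hδ hδ1
  have hgl := logConf_le_logVar hw hL hδ
  have hB : 0 ≤ P.B := (norm_nonneg _).trans hθ
  have hl := lev_pos ℓ
  have hZ := driftNorm_nonneg P a θ r k ℓ
  have hn := noiseNorm_le_of_goodEpoch hw hL hδ hδ1 hR hgood hk hℓ
  rcases hlay.radius with ⟨h, hemp⟩ | h
  · have h1 : noiseNorm P a r ε k ℓ = 0 := by simp [noiseNorm, noiseSum, hemp, invNorm_eq]
    rw [h]
    have := mul_le_mul_of_nonneg_left (B_le_Bmax P) hl.le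
    linarith
  rw [h, confRadius]
  change _ ≤ 16 * lev ℓ * √(8 * _ + 6 * P.R ^ 2 * logVar P + _) * √(logConf P) +
    6 * lev ℓ * P.R * logConf P + lev ℓ * P.B + _
  by_cases hh : IsHigh P ℓ
  · rw [varEst_of_isHigh hh]
    have hres := (residual_bounds (ε := ε) hw hr hk1 hℓ).1
    have := (noise_le_of_residual (sV := √(noiseEnergy P a r ε k ℓ)) (e := √(residual P a r k ℓ))
      (Z := driftNorm P a θ r k ℓ) (Bm := P.Bmax) hl hg hgl (lev_mul_sqrt_le hh)
      (Real.sqrt_nonneg _) hZ hB (B_le_Bmax P) hR hn (by linarith)).1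
    rw [Real.sq_sqrt (residual_nonneg P a r k ℓ)] at this
    linarith
  · rw [varEst_of_not_isHigh hh]
    have hV := noiseEnergy_le P a r ε hℓ hkK hε
    set V := noiseEnergy P a r ε k ℓ with hVdef
    have hV0 : 0 ≤ V := noiseEnergy_nonneg P a r ε k ℓ
    have hroot : √V + P.R + P.R * √(logConf P) ≤
        2 * √(8 * (P.R ^ 2 * (roundSet P a r k ℓ).card) + 6 * P.R ^ 2 * logVar P +
          4 * lev ℓ ^ 2 * P.Bmax ^ 2) := by
      rw [← div_le_iff₀' (by norm_num)]
      refine Real.le_sqrt_of_sq_le ?_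
      have h1 := Real.sq_sqrt hV0
      have h2 := Real.sq_sqrt (show 0 ≤ logConf P by linarith)
      have h3 : P.R ^ 2 * logConf P ≤ P.R ^ 2 * logVar P :=
        mul_le_mul_of_nonneg_left hgl (sq_nonneg _)
      have h4 : P.R ^ 2 ≤ P.R ^ 2 * logConf P := le_mul_of_one_le_right (sq_nonneg _) hg
      have h5 : (P.R * √(logConf P)) ^ 2 = P.R ^ 2 * logConf P := by rw [mul_pow, h2]
      have h6 : 0 ≤ 4 * lev ℓ ^ 2 * P.Bmax ^ 2 := by positivity
      nlinarith [sq_nonneg (√V - P.R), sq_nonneg (√V - P.R * √(logConf P)),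
        sq_nonneg (P.R - P.R * √(logConf P))]
    have h2 : logConf P = √(logConf P) * √(logConf P) :=
      (Real.mul_self_sqrt (by linarith)).symm
    have h7 : noiseNorm P a r ε k ℓ ≤ 8 * lev ℓ * (√V + P.R + P.R * √(logConf P)) *
        √(logConf P) := by
      refine hn.trans (le_of_eq ?_)
      nth_rewrite 2 [h2]; ring
    have h8 := mul_le_mul_of_nonneg_right (mul_le_mul_of_nonneg_left hroot
      (show 0 ≤ 8 * lev ℓ by positivity)) (Real.sqrt_nonneg (logConf P))
    have h9 : 0 ≤ 6 * lev ℓ * P.R * logConf P := by positivity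
    linarith

/-- The algebra behind the upper bound on the confidence radius. -/
theorem radius_le_of_residual {ρ l1 g sV e Z B Bm R : ℝ} (hρ : 0 < ρ) (hg : 1 ≤ g) (hgl : g ≤ l1)
    (hsV : 0 ≤ sV) (he0 : 0 ≤ e) (hZ : 0 ≤ Z) (hBm : B ≤ Bm) (hBm0 : 0 ≤ Bm) (hR : 0 ≤ R)
    (hρ1 : ρ ≤ 1) (he : e ≤ 2 * sV + 2 * Z + R * √l1 + Bm) :
    16 * ρ * √(8 * e ^ 2 + 6 * R ^ 2 * l1 + 4 * ρ ^ 2 * Bm ^ 2) * √g + 6 * ρ * R * g + ρ * B ≤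
      102 * ρ * l1 * (sV + R + Bm + Z) := by
  have ht1 : 1 ≤ √l1 := Real.one_le_sqrt.2 (hg.trans hgl)
  have htt : √l1 * √l1 = l1 := Real.mul_self_sqrt (by linarith)
  have htl : √l1 ≤ l1 := by nlinarith
  have hst : √g ≤ √l1 := Real.sqrt_le_sqrt hgl
  have hl0 : 0 ≤ l1 := by linarith
  set t := √l1 with ht
  have h4 : 0 ≤ R * t := by positivity
  have hroot : √(8 * e ^ 2 + 6 * R ^ 2 * l1 + 4 * ρ ^ 2 * Bm ^ 2) ≤
      6 * sV + 6 * (R * t) + 5 * Bm + 6 * Z := by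
    refine (Real.sqrt_le_iff.2 ⟨by positivity, ?_⟩ : _ ≤ 3 * e + 3 * (R * t) +
      2 * Bm).trans (by linarith)
    have h2 : ρ ^ 2 * Bm ^ 2 ≤ Bm ^ 2 :=
      mul_le_of_le_one_left (sq_nonneg _) (pow_le_one₀ hρ.le hρ1)
    have h3 : R ^ 2 * l1 = (R * t) ^ 2 := by rw [mul_pow, sq t, htt]
    nlinarith [mul_nonneg he0 h4, mul_nonneg he0 hBm0, mul_nonneg h4 hBm0]
  have hs0 := Real.sqrt_nonneg g
  have hX0 : 0 ≤ 6 * sV + 6 * (R * t) + 5 * Bm + 6 * Z := by positivity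
  have h5 : √(8 * e ^ 2 + 6 * R ^ 2 * l1 + 4 * ρ ^ 2 * Bm ^ 2) * √g ≤
      l1 * (6 * sV + 6 * R + 5 * Bm + 6 * Z) := by
    refine (mul_le_mul hroot hst hs0 hX0).trans ?_
    have h6 : t * (6 * sV + 5 * Bm + 6 * Z) ≤ l1 * (6 * sV + 5 * Bm + 6 * Z) :=
      mul_le_mul_of_nonneg_right htl (by positivity)
    have h7 : R * t * t = R * l1 := by rw [mul_assoc, htt]
    linarith
  have h9 : R * g ≤ l1 * R := by rw [mul_comm]; gcongr
  have h10 : B ≤ l1 * Bm := hBm.trans (le_mul_of_one_le_left hBm0 (by linarith))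
  have h11 : 0 ≤ l1 * sV := by positivity
  have h12 : 0 ≤ l1 * Z := by positivity
  calc _ = ρ * (16 * (√(8 * e ^ 2 + 6 * R ^ 2 * l1 + 4 * ρ ^ 2 * Bm ^ 2) * √g) + 6 * (R * g)
        + B) := by ring
    _ ≤ ρ * (102 * (l1 * (sV + R + Bm + Z))) := by
        refine mul_le_mul_of_nonneg_left ?_ hρ.le
        have h13 : 0 ≤ l1 * Bm := by positivity
        linarith
    _ = _ := by ring

/-- In a fine layer the residuals exceed the noise only by drift and estimation error, so the radius
scales with the true noise energy. Coarse layers need no such bound, since their regret is handled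
trivially. -/
theorem radius_le (hw : 1 ≤ P.w) (hL : 1 ≤ P.L) (hδ : 0 < P.δ) (hδ1 : P.δ < 1)
    (hR : 0 ≤ P.R) (hr : ∀ i, r i = inner ℝ (θ i) (a i) + ε i)
    (hgood : GoodEpoch P a r ε K m) (hk : k ∈ epoch P.w K m) (hℓ : ℓ ∈ Finset.Icc 1 P.L)
    (hθ : ‖θ k‖ ≤ P.B) (hh : IsHigh P ℓ) :
    (stateAt P a r k ℓ).radius ≤ 102 * lev ℓ * logVar P *
      (√(noiseEnergy P a r ε k ℓ) + P.R + P.Bmax + driftNorm P a θ r k ℓ) := by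
  have hkK := (mem_epoch.1 hk).1
  have hk1 := (Finset.mem_Icc.1 hkK).1
  have hlay := isLayer_stateAt P a r hw hk1 hℓ
  have hE := estError_le hw hr hk1 hℓ hθ
  have hg := one_le_logConf hw hL hδ hδ1
  have hgl := logConf_le_logVar hw hL hδ
  have hB : 0 ≤ P.B := (norm_nonneg _).trans hθ
  have hBB := B_le_Bmax P
  have hl := lev_pos ℓ
  have hl1 := lev_le_one ℓ
  have hZ := driftNorm_nonneg P a θ r k ℓ
  have hn := noiseNorm_le_of_goodEpoch hw hL hδ hδ1 hR hgood hk hℓ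
  have hres := residual_bounds (ε := ε) hw hr hk1 hℓ
  have hn2 := (noise_le_of_residual (sV := √(noiseEnergy P a r ε k ℓ)) (e := √(residual P a r k ℓ))
      (Z := driftNorm P a θ r k ℓ) (Bm := P.Bmax) hl hg hgl (lev_mul_sqrt_le hh)
      (Real.sqrt_nonneg _) hZ hB hBB hR hn (by linarith [hres.1])).2
  have hres2 := hres.2
  have hV0 := Real.sqrt_nonneg (noiseEnergy P a r ε k ℓ)
  have he0 := Real.sqrt_nonneg (residual P a r k ℓ)
  have hBm0 : 0 ≤ P.Bmax := hB.trans hBB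
  rcases hlay.radius with ⟨h, _⟩ | h
  · have h2 : 1 ≤ 102 * logVar P := by linarith
    rw [h]
    calc lev ℓ * P.Bmax ≤ lev ℓ * (102 * logVar P * (√(noiseEnergy P a r ε k ℓ) + P.R + P.Bmax +
          driftNorm P a θ r k ℓ)) := by
          refine mul_le_mul_of_nonneg_left ?_ hl.le
          calc P.Bmax ≤ 1 * (√(noiseEnergy P a r ε k ℓ) + P.R + P.Bmax +
                driftNorm P a θ r k ℓ) := by linarith
            _ ≤ _ := mul_le_mul_of_nonneg_right h2 (by positivity)
      _ = _ := by ring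
  rw [h, confRadius, varEst_of_isHigh hh]
  have hρB : lev ℓ * P.B ≤ P.Bmax := (mul_le_of_le_one_left hB hl1).trans hBB
  have ht1 : 1 ≤ √(logVar P) := Real.one_le_sqrt.2 (hg.trans hgl)
  have hRt : P.R ≤ P.R * √(logVar P) := le_mul_of_one_le_right hR ht1
  have := radius_le_of_residual (e := √(residual P a r k ℓ)) hl hg hgl hV0 he0 hZ hBB hBm0 hR hl1
    (by linarith)
  rw [Real.sq_sqrt (residual_nonneg P a r k ℓ)] at this
  exact this

end

/-! ### Sample paths and the regret of one round -/

theorem one_div_le_two_pow_L {P : Params} (hα : 0 < P.α) : 1 / P.α ≤ 2 ^ P.L := by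
  have h := Nat.le_ceil (Real.logb 2 (1 / P.α))
  rw [Real.logb_le_iff_le_rpow (by norm_num) (by positivity), Real.rpow_natCast] at h
  exact h

theorem two_pow_L_le {P : Params} (hα : 0 < P.α) (hL : 1 ≤ P.L) : (2 : ℝ) ^ P.L ≤ 2 / P.α := by
  have hpos : 0 < Real.logb 2 (1 / P.α) := Nat.ceil_pos.1 hL
  have h := (Nat.ceil_lt_add_one hpos.le).le
  have h2 : (2 : ℝ) ^ (P.L : ℝ) ≤ 2 ^ (Real.logb 2 (1 / P.α) + 1) :=
    Real.rpow_le_rpow_of_exponent_le (by norm_num) h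
  rw [Real.rpow_natCast, Real.rpow_add (by norm_num), Real.rpow_logb (by norm_num) (by norm_num)
    (by positivity), Real.rpow_one] at h2
  calc _ ≤ _ := h2
    _ = _ := by ring

theorem lev_L_le {P : Params} (hα : 0 < P.α) : lev P.L ≤ P.α := by
  rw [lev_eq, inv_le_comm₀ (by positivity) hα, ← one_div]
  exact one_div_le_two_pow_L hα

/-- The properties of a sample path of the algorithm that the regret bound relies on. -/
structure IsPath {d : ℕ} (P : Params) (K : ℕ) (A : ℝ) (θ a aStar : ℕ → Vec d) (r ε : ℕ → ℝ) :
    Prop where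
  one_le_w : 1 ≤ P.w
  w_le : P.w ≤ K
  α_pos : 0 < P.α
  δ_pos : 0 < P.δ
  δ_lt : P.δ < 1
  R_nonneg : 0 ≤ P.R
  reward_eq : ∀ i, r i = inner ℝ (θ i) (a i) + ε i
  noise_le : ∀ i ∈ Finset.Icc 1 K, |ε i| ≤ P.R
  feature_le : ∀ i ∈ Finset.Icc 1 K, ‖θ i‖ ≤ P.B
  arm_le : ∀ i ∈ Finset.Icc 1 K, ‖a i‖ ≤ A
  star_le : ∀ i ∈ Finset.Icc 1 K, ‖aStar i‖ ≤ A
  gap_le : ∀ i ∈ Finset.Icc 1 K, inner ℝ (aStar i) (θ i) - inner ℝ (a i) (θ i) ≤ 2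
  index_le : ∀ i ∈ Finset.Icc 1 K,
    index P (stateAt P a r i) (aStar i) ≤ index P (stateAt P a r i) (a i)

/-- The total variation of the feature vectors in epoch `m`. -/
noncomputable def epochVariation {d : ℕ} (θ : ℕ → Vec d) (w K m : ℕ) : ℝ :=
  ∑ i ∈ Finset.Ico 1 K with i / w = m, ‖θ (i + 1) - θ i‖

theorem epochVariation_nonneg {d : ℕ} (θ : ℕ → Vec d) (w K m : ℕ) : 0 ≤ epochVariation θ w K m :=
  Finset.sum_nonneg fun _ _ => norm_nonneg _

theorem norm_sub_le_epochVariation {d : ℕ} (θ : ℕ → Vec d) {w K m i k : ℕ}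
    (hi : 1 ≤ i) (hik : i ≤ k) (hk : k ≤ K) (him : i / w = m) (hkm : k / w = m) :
    ‖θ i - θ k‖ ≤ epochVariation θ w K m := by
  rw [← dist_eq_norm]
  refine (dist_le_Ico_sum_dist θ hik).trans ?_
  simp only [dist_eq_norm, fun j => norm_sub_rev (θ j) (θ (j + 1))]
  refine Finset.sum_le_sum_of_subset_of_nonneg (fun j hj => ?_) fun _ _ _ => norm_nonneg _
  rw [Finset.mem_Ico] at hj
  rw [Finset.mem_filter, Finset.mem_Ico]
  have h1 := Nat.div_le_div_right (c := w) hj.1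
  have h2 := Nat.div_le_div_right (c := w) hj.2.le
  exact ⟨⟨by omega, by omega⟩, by omega⟩

section
variable {d : ℕ} {P : Params} {K : ℕ} {A : ℝ} {θ a aStar : ℕ → Vec d} {r ε : ℕ → ℝ} {k m : ℕ}

theorem IsPath.A_nonneg (h : IsPath P K A θ a aStar r ε) : 0 ≤ A :=
  (norm_nonneg _).trans (h.arm_le 1 (Finset.mem_Icc.2 ⟨le_rfl, h.one_le_w.trans h.w_le⟩))

theorem IsPath.B_nonneg (h : IsPath P K A θ a aStar r ε) : 0 ≤ P.B :=
  (norm_nonneg _).trans (h.feature_le 1 (Finset.mem_Icc.2 ⟨le_rfl, h.one_le_w.trans h.w_le⟩))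

theorem IsPath.driftNorm_le (h : IsPath P K A θ a aStar r ε) {ℓ : ℕ} (hℓ : ℓ ∈ Finset.Icc 1 P.L)
    (hk : k ∈ epoch P.w K m) :
    driftNorm P a θ r k ℓ ≤ √P.w * (A * epochVariation θ P.w K m) := by
  have hk' := mem_epoch.1 hk
  have hkK := Finset.mem_Icc.1 hk'.1
  have hA := h.A_nonneg
  have hΔ := epochVariation_nonneg θ P.w K m
  refine Real.sqrt_le_iff.2 ⟨by positivity, ?_⟩
  rw [mul_pow, Real.sq_sqrt (Nat.cast_nonneg _)]
  have hcard : ((roundSet P a r k ℓ).card : ℝ) ≤ P.w := by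
    exact_mod_cast (card_roundSet_lt P a r h.one_le_w k ℓ).le
  refine (Finset.sum_le_card_nsmul _ _ ((A * epochVariation θ P.w K m) ^ 2)
    fun i hi => ?_).trans ?_
  · have hi := (mem_roundSet P a r).1 hi
    rw [← sq_abs, abs_mul, abs_of_nonneg (roundWeight_nonneg P a r i)]
    refine pow_le_pow_left₀ (by have := roundWeight_nonneg P a r i; positivity) ?_ 2
    calc roundWeight P a r i * |inner ℝ (a i) (θ i - θ k)|
        ≤ 1 * (A * epochVariation θ P.w K m) := by
          refine mul_le_mul (roundWeight_le_one P a r hℓ hi.2.2) ?_ (abs_nonneg _) zero_le_one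
          refine (abs_real_inner_le_norm _ _).trans (mul_le_mul
            (h.arm_le i (Finset.mem_Icc.2 ⟨hi.1.1, by omega⟩)) ?_ (norm_nonneg _) hA)
          exact norm_sub_le_epochVariation θ hi.1.1 hi.1.2.le hkK.2 (by omega) hk'.2
      _ = _ := one_mul _
  · rw [nsmul_eq_mul]
    exact mul_le_mul_of_nonneg_right hcard (sq_nonneg _)

theorem IsPath.invNorm_le (h : IsPath P K A θ a aStar r ε) (hk : 1 ≤ k) {ℓ : ℕ}
    (hℓ : ℓ ∈ Finset.Icc 1 P.L) {x : Vec d} (hx : ‖x‖ ≤ A) :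
    lev ℓ * invNorm (stateAt P a r k ℓ).Sig x ≤ A := by
  have hl := lev_pos ℓ
  have h1 := sqrt_mul_invNorm_le (show 0 < lev ℓ ^ 2 by positivity) (roundSet P a r k ℓ)
    (fun i => roundWeight P a r i • a i) x
  rw [Real.sqrt_sq hl.le, ← (isLayer_stateAt P a r h.one_le_w hk hℓ).Sig] at h1
  exact h1.trans hx

theorem le_of_lev_mul_le {ℓ L : ℕ} (hℓ : ℓ ≤ L) {x y : ℝ} (hx : 0 ≤ x) (h : lev ℓ * x ≤ y) :
    x ≤ y * 2 ^ L := by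
  rw [lev_eq, inv_mul_le_iff₀ (by positivity)] at h
  have h1 : (1 : ℝ) ≤ 2 ^ ℓ := one_le_pow₀ (by norm_num)
  have hy : 0 ≤ y := by
    by_contra hc
    nlinarith
  calc x ≤ 2 ^ ℓ * y := h
    _ ≤ 2 ^ L * y := mul_le_mul_of_nonneg_right (pow_le_pow_right₀ (by norm_num) hℓ) hy
    _ = _ := mul_comm _ _

/-- The sum of the squares of the noise in epoch `m`. -/
noncomputable def epochEnergy (ε : ℕ → ℝ) (w K m : ℕ) : ℝ := ∑ i ∈ epoch w K m, ε i ^ 2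

theorem noiseEnergy_le_epochEnergy {ℓ : ℕ} (hℓ : ℓ ∈ Finset.Icc 1 P.L)
    (hk : k ∈ epoch P.w K m) : noiseEnergy P a r ε k ℓ ≤ epochEnergy ε P.w K m := by
  have hk' := mem_epoch.1 hk
  have hkK := Finset.mem_Icc.1 hk'.1
  refine (Finset.sum_le_sum fun i hi => ?_).trans (Finset.sum_le_sum_of_subset_of_nonneg
    (fun i hi => ?_) fun _ _ _ => sq_nonneg _)
  · have hi := (mem_roundSet P a r).1 hi
    rw [mul_pow]
    exact mul_le_of_le_one_left (sq_nonneg _)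
      (pow_le_one₀ (roundWeight_nonneg P a r i) (roundWeight_le_one P a r hℓ hi.2.2))
  · have hi := (mem_roundSet P a r).1 hi
    exact mem_epoch.2 ⟨Finset.mem_Icc.2 ⟨hi.1.1, by omega⟩, by omega⟩

theorem index_le_of_mem {s : State d} {x : Vec d} {ℓ : ℕ} (hℓ : ℓ ∈ Finset.Icc 1 P.L) :
    index P s x ≤ inner ℝ x (s ℓ).est + (s ℓ).radius * invNorm (s ℓ).Sig x :=
  ciInf_le (f := fun ℓ : {ℓ : ℕ // ℓ ∈ Finset.Icc 1 P.L} =>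
    inner ℝ x (s ℓ).est + (s ℓ).radius * invNorm (s ℓ).Sig x)
    (Set.finite_range _).bddBelow ⟨ℓ, hℓ⟩

/-- The regret of a round of a good epoch, bounded through a layer in which the selected arm
is certain. -/
theorem IsPath.gap_le_of_lt (h : IsPath P K A θ a aStar r ε) (hL : 1 ≤ P.L)
    (hgood : GoodEpoch P a r ε K m) (hk : k ∈ epoch P.w K m) {ℓ : ℕ}
    (hℓ : ℓ ∈ Finset.Icc 1 P.L) (hlt : invNorm (stateAt P a r k ℓ).Sig (a k) < lev ℓ)
    (hh : IsHigh P ℓ) :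
    inner ℝ (aStar k) (θ k) - inner ℝ (a k) (θ k) ≤
      204 * (lev ℓ ^ 2 * logVar P) * (√(epochEnergy ε P.w K m) + P.R + P.Bmax) +
      208 * logVar P * (A * 2 ^ P.L * (√P.w * (A * epochVariation θ P.w K m))) := by
  have hkK := (mem_epoch.1 hk).1
  have hk1 := (Finset.mem_Icc.1 hkK).1
  have hθ := h.feature_le k hkK
  have hA := h.A_nonneg
  have hlog : 1 ≤ logVar P := (one_le_logConf h.one_le_w hL h.δ_pos h.δ_lt).trans
    (logConf_le_logVar h.one_le_w hL h.δ_pos)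
  set Z := √P.w * (A * epochVariation θ P.w K m) with hZ
  have hΔ := epochVariation_nonneg θ P.w K m
  have hZ0 : 0 ≤ Z := by positivity
  -- A · 2^L bounds the norm of every admissible arm in every layer, so D is a uniform drift cost.
  -- As 2^L ≤ 2/α, this is where 1/α in the regret bound originates.
  set D := A * 2 ^ P.L * Z with hD
  have hD0 : 0 ≤ D := by positivity
  have herr : ∀ ℓ ∈ Finset.Icc 1 P.L, estError P a θ r k ℓ ≤
      (stateAt P a r k ℓ).radius + 2 * Z := by
    intro ℓ hℓ
    have h1 := estError_le_radius h.one_le_w hL h.δ_pos h.δ_lt h.R_nonneg h.reward_eq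
      h.noise_le hgood hk hℓ hθ
    have h2 := h.driftNorm_le hℓ hk
    linarith
  have hdev : ∀ ℓ ∈ Finset.Icc 1 P.L, ∀ x : Vec d, ‖x‖ ≤ A →
      |inner ℝ x (stateAt P a r k ℓ).est - inner ℝ x (θ k)| ≤
        (stateAt P a r k ℓ).radius * invNorm (stateAt P a r k ℓ).Sig x + 2 * D := by
    intro ℓ hℓ x hx
    have h0 := invNorm_nonneg (stateAt P a r k ℓ).Sig x
    have h1 := abs_inner_est_sub_le (a := a) (r := r) (θ := θ) h.one_le_w hk1 hℓ x
    have h2 := mul_le_mul_of_nonneg_left (herr ℓ hℓ) h0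
    have h3 := le_of_lev_mul_le (Finset.mem_Icc.1 hℓ).2 h0 (h.invNorm_le hk1 hℓ hx)
    have h4 := mul_le_mul_of_nonneg_right h3 hZ0
    linarith
  -- Optimism up to drift: every layer overestimates the optimal arm to within 2D, hence so does
  -- their minimum.
  have hopt : inner ℝ (aStar k) (θ k) - 2 * D ≤ index P (stateAt P a r k) (aStar k) := by
    have : Nonempty {ℓ : ℕ // ℓ ∈ Finset.Icc 1 P.L} := ⟨⟨ℓ, hℓ⟩⟩
    refine le_ciInf fun ℓ => ?_
    have h1 := (abs_le.1 (hdev ℓ.1 ℓ.2 (aStar k) (h.star_le k hkK))).1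
    linarith
  have hind := (h.index_le k hkK).trans (index_le_of_mem (s := stateAt P a r k) (x := a k) hℓ)
  have ha := (abs_le.1 (hdev ℓ hℓ (a k) (h.arm_le k hkK))).2
  have hrad := radius_le h.one_le_w hL h.δ_pos h.δ_lt h.R_nonneg h.reward_eq hgood hk hℓ hθ hh
  have hl := lev_pos ℓ
  have hn0 := invNorm_nonneg (stateAt P a r k ℓ).Sig (a k)
  have hnA := h.invNorm_le hk1 hℓ (h.arm_le k hkK)
  set n := invNorm (stateAt P a r k ℓ).Sig (a k) with hn
  have hV := Real.sqrt_le_sqrt (noiseEnergy_le_epochEnergy (a := a) (r := r) (ε := ε) hℓ hk)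
  have hd := h.driftNorm_le hℓ hk
  have hBm : 0 ≤ P.Bmax := h.B_nonneg.trans (B_le_Bmax P)
  have hH0 : 0 ≤ √(epochEnergy ε P.w K m) + P.R + P.Bmax := by
    have := h.R_nonneg; positivity
  set H := √(epochEnergy ε P.w K m) + P.R + P.Bmax with hH
  have hprod : (stateAt P a r k ℓ).radius * n ≤ 102 * (lev ℓ ^ 2 * logVar P) * H +
      102 * logVar P * D := by
    calc (stateAt P a r k ℓ).radius * n ≤ 102 * lev ℓ * logVar P * (H + Z) * n := by
          refine mul_le_mul_of_nonneg_right (hrad.trans ?_) hn0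
          refine mul_le_mul_of_nonneg_left (by linarith) (by positivity)
      _ = 102 * (lev ℓ * n * logVar P) * H + 102 * logVar P * (lev ℓ * n * Z) := by ring
      _ ≤ 102 * (lev ℓ * lev ℓ * logVar P) * H + 102 * logVar P * (A * 2 ^ P.L * Z) := by
          have h1 : lev ℓ * n ≤ A * 2 ^ P.L :=
            hnA.trans (le_mul_of_one_le_right hA (one_le_pow₀ (by norm_num)))
          gcongr
      _ = _ := by rw [hD]; ring
  have h5 : D ≤ logVar P * D := le_mul_of_one_le_left hD0 hlog
  linarith

/-- The regret of a round of a good epoch. -/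
theorem IsPath.gap_le_of_good (h : IsPath P K A θ a aStar r ε) (hL : 1 ≤ P.L)
    (hgood : GoodEpoch P a r ε K m) (hk : k ∈ epoch P.w K m) :
    inner ℝ (aStar k) (θ k) - inner ℝ (a k) (θ k) ≤
      4096 * logVar P * (√(epochEnergy ε P.w K m) + P.R + P.Bmax) *
        lev (roundLevel P a r k - 1) ^ 2 +
      208 * logVar P * (A * 2 ^ P.L * (√P.w * (A * epochVariation θ P.w K m))) := by
  have hkK := (mem_epoch.1 hk).1
  have hA := h.A_nonneg
  have hlog : 1 ≤ logVar P := (one_le_logConf h.one_le_w hL h.δ_pos h.δ_lt).trans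
    (logConf_le_logVar h.one_le_w hL h.δ_pos)
  have hΔ := epochVariation_nonneg θ P.w K m
  have hD : 0 ≤ 208 * logVar P * (A * 2 ^ P.L * (√P.w * (A * epochVariation θ P.w K m))) := by
    positivity
  have hBm : 2 ≤ P.Bmax := le_max_right _ _
  have hH : 2 ≤ √(epochEnergy ε P.w K m) + P.R + P.Bmax := by
    have := h.R_nonneg
    have := Real.sqrt_nonneg (epochEnergy ε P.w K m)
    linarith
  set H := √(epochEnergy ε P.w K m) + P.R + P.Bmax with hHdef
  -- Where 4^{-ℓ} · `logVar` is at least 1/4096, the trivial gap 2 suffices because H ≥ 2; this is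
  -- why `Bmax` is at least 2.
  have hsmall : ∀ x, 1 ≤ 4096 * (x * logVar P) →
      inner ℝ (aStar k) (θ k) - inner ℝ (a k) (θ k) ≤ 4096 * logVar P * H * x := by
    intro x hx
    have h1 := mul_le_mul hx hH (by norm_num) (by linarith)
    have h2 := h.gap_le k hkK
    nlinarith
  have hm := level_mem P (stateAt P a r k) (a k)
  change roundLevel P a r k ∈ _ at hm
  rw [Finset.mem_Icc] at hm
  set ℓ := roundLevel P a r k - 1 with hℓdef
  -- An arm uncertain already in layer 1 has no certain layer below it; the scale of the fictitious
  -- layer 0 is 1 and the trivial bound applies.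
  rcases Nat.eq_zero_or_pos ℓ with h0 | h0
  · rw [h0, lev_zero]
    have := hsmall (1 ^ 2) (by linarith)
    linarith
  have hℓ : ℓ ∈ Finset.Icc 1 P.L := Finset.mem_Icc.2 ⟨h0, by omega⟩
  have hlt : invNorm (stateAt P a r k ℓ).Sig (a k) < lev ℓ :=
    invNorm_lt_of_lt_level hℓ (show ℓ < roundLevel P a r k by omega)
  by_cases hh : IsHigh P ℓ
  · refine (h.gap_le_of_lt hL hgood hk hℓ hlt hh).trans (add_le_add ?_ le_rfl)
    have : 0 ≤ lev ℓ ^ 2 * logVar P * H := by positivity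
    linarith
  · have := hsmall _ (one_le_of_not_isHigh (by linarith) hh)
    linarith

/-! ### Elliptical potential: how many rounds a layer receives -/

/-- An equality, by the matrix determinant lemma, because the weighted arms have norm exactly ρ.
Together with `det_design_le` it bounds the number of rounds. -/
theorem det_Sig (hw : 1 ≤ P.w) (hk : 1 ≤ k) {ℓ : ℕ} (hℓ : ℓ ∈ Finset.Icc 1 P.L) :
    (stateAt P a r k ℓ).Sig.det =
      (lev ℓ ^ 2) ^ d * (1 + lev ℓ ^ 2) ^ (roundSet P a r k ℓ).card := by
  have hinit : ∀ k, roundSet P a r k ℓ = ∅ → (stateAt P a r k ℓ).Sig =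
      design (lev ℓ ^ 2) (roundSet P a r k ℓ) (fun i => roundWeight P a r i • a i) →
      (stateAt P a r k ℓ).Sig.det =
      (lev ℓ ^ 2) ^ d * (1 + lev ℓ ^ 2) ^ (roundSet P a r k ℓ).card := by
    intro k h1 h2
    rw [h2, h1]
    simp [design]
  induction k, hk using Nat.le_induction with
  | base => exact hinit 1 (roundSet_one P a r ℓ) (isLayer_stateAt P a r hw le_rfl hℓ).Sig
  | succ k hk ih =>
    by_cases hr : (k + 1) % P.w = 0
    · exact hinit _ (roundSet_restart P a r hw ℓ hr)
        (isLayer_stateAt P a r hw (by omega) hℓ).Sig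
    by_cases hl : roundLevel P a r k = ℓ
    · rw [Sig_succ_of_eq P a r hw hk hℓ hr hl, det_add_rankOne (posDef_Sig P a r hw hk hℓ), ih,
        invNorm_weighted_arm P a r hℓ hl, roundSet_succ_of_eq P a r hk hr hl,
        Finset.card_insert_of_notMem (notMem_roundSet P a r k ℓ), pow_succ]
      ring
    · rw [roundSet_succ_of_ne P a r hr hl, stateAt_succ P a r hk hr, update_of_ne P a r hℓ hl]
      exact ih

/-- The elliptical potential bound. -/
theorem IsPath.card_roundSet_mul_le (h : IsPath P K A θ a aStar r ε) (hk : k ∈ Finset.Icc 1 K)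
    {ℓ : ℕ} (hℓ : ℓ ∈ Finset.Icc 1 P.L) :
    (roundSet P a r k ℓ).card * lev ℓ ^ 2 ≤ 2 * d * Real.log (1 + P.w * A ^ 2 * (2 ^ P.L) ^ 2) := by
  have hk' := Finset.mem_Icc.1 hk
  have hl := lev_pos ℓ
  have hl1 := lev_le_one ℓ
  have hl2 : 0 < lev ℓ ^ 2 := by positivity
  set n := (roundSet P a r k ℓ).card with hn
  have hdet := det_Sig (a := a) (r := r) h.one_le_w hk'.1 hℓ
  have hle := det_design_le hl2 (roundSet P a r k ℓ) (fun i => roundWeight P a r i • a i) (A := A)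
    (fun i hi => by
      have hi := (mem_roundSet P a r).1 hi
      rw [norm_smul, Real.norm_eq_abs, abs_of_nonneg (roundWeight_nonneg P a r i)]
      exact (mul_le_of_le_one_left (norm_nonneg _) (roundWeight_le_one P a r hℓ hi.2.2)).trans
        (h.arm_le i (Finset.mem_Icc.2 ⟨hi.1.1, by omega⟩)))
  rw [← (isLayer_stateAt P a r h.one_le_w hk'.1 hℓ).Sig, hdet, ← hn] at hle
  have h1 : (lev ℓ ^ 2 + n * A ^ 2) ^ d = (lev ℓ ^ 2) ^ d * (1 + n * A ^ 2 / lev ℓ ^ 2) ^ d := by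
    rw [← mul_pow, mul_add, mul_one, mul_div_cancel₀ _ hl2.ne']
  rw [h1] at hle
  have h2 := le_of_mul_le_mul_left hle (by positivity)
  have h3 := Real.log_le_log (by positivity) h2
  rw [Real.log_pow, Real.log_pow] at h3
  have h4 := Real.le_log_one_add_of_nonneg hl2.le
  have h5 : lev ℓ ^ 2 / 2 ≤ Real.log (1 + lev ℓ ^ 2) := by
    refine le_trans ?_ h4
    rw [div_le_div_iff₀ (by norm_num) (by positivity)]
    have : lev ℓ ^ 2 ≤ 1 := pow_le_one₀ hl.le hl1
    nlinarith
  have h6 : 1 + n * A ^ 2 / lev ℓ ^ 2 ≤ 1 + P.w * A ^ 2 * (2 ^ P.L) ^ 2 := by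
    have hc : (n : ℝ) ≤ P.w := by
      exact_mod_cast (card_roundSet_lt P a r h.one_le_w k ℓ).le
    have h7 : (1 : ℝ) / lev ℓ ^ 2 ≤ (2 ^ P.L) ^ 2 := by
      rw [lev_eq, inv_pow, one_div, inv_inv]
      exact pow_le_pow_left₀ (by positivity)
        (pow_le_pow_right₀ (by norm_num) (Finset.mem_Icc.1 hℓ).2) 2
    rw [div_eq_mul_one_div]
    gcongr
  have h8 := Real.log_le_log (by positivity) h6
  have h9 := mul_le_mul_of_nonneg_left h8 (Nat.cast_nonneg (α := ℝ) d)
  have h10 := mul_le_mul_of_nonneg_left h5 (Nat.cast_nonneg (α := ℝ) n)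
  linarith

theorem IsPath.card_level_mul_le (h : IsPath P K A θ a aStar r ε) {ℓ : ℕ}
    (hℓ : ℓ ∈ Finset.Icc 1 P.L) :
    (((epoch P.w K m).filter fun k => roundLevel P a r k = ℓ).card : ℝ) * lev ℓ ^ 2 ≤
      2 * d * Real.log (1 + P.w * A ^ 2 * (2 ^ P.L) ^ 2) + 1 := by
  have hl := lev_pos ℓ
  have hl2 : lev ℓ ^ 2 ≤ 1 := pow_le_one₀ hl.le (lev_le_one ℓ)
  set S := (epoch P.w K m).filter fun k => roundLevel P a r k = ℓ with hS
  have hlog : 0 ≤ Real.log (1 + P.w * A ^ 2 * (2 ^ P.L) ^ 2) :=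
    Real.log_nonneg (by have : 0 ≤ P.w * A ^ 2 * (2 ^ P.L) ^ 2 := by positivity
                        linarith)
  rcases S.eq_empty_or_nonempty with he | hne
  · rw [he]; simp; positivity
  -- `roundSet` counts only the rounds strictly before its index, so the last round of the layer is
  -- added separately. This is the summand 1.
  · set k := S.max' hne with hk
    have hkS := S.max'_mem hne
    rw [← hk] at hkS
    have hk' := mem_epoch.1 (Finset.mem_filter.1 hkS).1
    have hsub : S ⊆ insert k (roundSet P a r k ℓ) := by
      intro i hi
      have hi' := Finset.mem_filter.1 hi
      have hi2 := mem_epoch.1 hi'.1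
      have hik := S.le_max' i hi
      rw [← hk] at hik
      rcases hik.eq_or_lt with h1 | h1
      · exact Finset.mem_insert.2 (Or.inl h1)
      · refine Finset.mem_insert.2 (Or.inr ((mem_roundSet P a r).2
          ⟨⟨(Finset.mem_Icc.1 hi2.1).1, h1⟩, ?_, hi'.2⟩))
        rw [hi2.2, hk'.2]
    have hc := (Finset.card_le_card hsub).trans (Finset.card_insert_le _ _)
    have hc' : (S.card : ℝ) ≤ (roundSet P a r k ℓ).card + 1 := by exact_mod_cast hc
    have h1 := h.card_roundSet_mul_le hk'.1 hℓ
    nlinarith [mul_le_mul_of_nonneg_right hc' (show 0 ≤ lev ℓ ^ 2 by positivity)]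

/-- Group the rounds by layer. Passing from ℓ to ℓ − 1 costs the factor 4, and the rounds without a
layer, at most w of them, have scale 2^{-L} ≤ α. -/
theorem IsPath.sum_lev_sq_le (h : IsPath P K A θ a aStar r ε) :
    ∑ k ∈ epoch P.w K m, lev (roundLevel P a r k - 1) ^ 2 ≤
      P.L * (4 * (2 * d * Real.log (1 + P.w * A ^ 2 * (2 ^ P.L) ^ 2) + 1)) + P.w * P.α ^ 2 := by
  have h1 : ∑ k ∈ epoch P.w K m, lev (roundLevel P a r k - 1) ^ 2 =
      ∑ ℓ ∈ Finset.Icc 1 (P.L + 1), ∑ k ∈ (epoch P.w K m).filter fun k => roundLevel P a r k = ℓ,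
        lev (roundLevel P a r k - 1) ^ 2 :=
    (Finset.sum_fiberwise_of_maps_to (fun k _ => level_mem P (stateAt P a r k) (a k)) _).symm
  have h2 : ∀ ℓ, ∑ k ∈ (epoch P.w K m).filter (fun k => roundLevel P a r k = ℓ),
      lev (roundLevel P a r k - 1) ^ 2 =
      (((epoch P.w K m).filter fun k => roundLevel P a r k = ℓ).card : ℝ) * lev (ℓ - 1) ^ 2 := by
    intro ℓ
    rw [Finset.sum_congr rfl fun k hk => by rw [(Finset.mem_filter.1 hk).2]]
    simp
  simp only [h2] at h1
  rw [h1, Finset.sum_Icc_succ_top (by omega)]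
  refine add_le_add ?_ ?_
  · have : (P.L : ℝ) * (4 * (2 * d * Real.log (1 + P.w * A ^ 2 * (2 ^ P.L) ^ 2) + 1)) =
        ∑ _ℓ ∈ Finset.Icc 1 P.L,
          4 * (2 * d * Real.log (1 + P.w * A ^ 2 * (2 ^ P.L) ^ 2) + 1) := by simp
    rw [this]
    refine Finset.sum_le_sum fun ℓ hℓ => ?_
    have h3 := h.card_level_mul_le (m := m) hℓ
    obtain ⟨j, rfl⟩ : ∃ j, ℓ = j + 1 := ⟨ℓ - 1, by have := (Finset.mem_Icc.1 hℓ).1; omega⟩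
    rw [lev_succ] at h3
    rw [Nat.add_sub_cancel]
    linarith
  · rw [Nat.add_sub_cancel]
    have hc : (((epoch P.w K m).filter fun k => roundLevel P a r k = P.L + 1).card : ℝ) ≤ P.w := by
      exact_mod_cast (Finset.card_filter_le _ _).trans (card_epoch_le h.one_le_w K m)
    exact mul_le_mul hc (pow_le_pow_left₀ (lev_pos _).le (lev_L_le h.α_pos) 2) (sq_nonneg _)
      (Nat.cast_nonneg _)

end

/-! ### Logarithmic factors and the regret of an epoch -/

/-- The logarithmic factor of the regret bound. -/
noncomputable def logFactor (K : ℕ) (A α δ : ℝ) : ℝ :=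
  1 + Real.log K + Real.log (1 + A) + Real.log (1 + 1 / α) + Real.log (1 / δ)

section
variable {d : ℕ} {P : Params} {K : ℕ} {A : ℝ} {θ a aStar : ℕ → Vec d} {r ε : ℕ → ℝ} {m : ℕ}

theorem logFactor_parts {K : ℕ} {A α δ : ℝ} (hK : 1 ≤ K) (hA : 0 ≤ A) (hα : 0 < α) (hδ : 0 < δ)
    (hδ1 : δ < 1) : 0 ≤ Real.log K ∧ 0 ≤ Real.log (1 + A) ∧ 0 ≤ Real.log (1 + 1 / α) ∧
      0 ≤ Real.log (1 / δ) := by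
  refine ⟨Real.log_nonneg (by exact_mod_cast hK), Real.log_nonneg (by linarith),
    Real.log_nonneg ?_, Real.log_nonneg ?_⟩
  · have : 0 < 1 / α := by positivity
    linarith
  · rw [le_div_iff₀ hδ]; linarith

theorem IsPath.one_le_K (h : IsPath P K A θ a aStar r ε) : 1 ≤ K := h.one_le_w.trans h.w_le

theorem IsPath.one_le_logFactor (h : IsPath P K A θ a aStar r ε) :
    1 ≤ logFactor K A P.α P.δ := by
  obtain ⟨h1, h2, h3, h4⟩ :=
    logFactor_parts h.one_le_K h.A_nonneg h.α_pos h.δ_pos h.δ_lt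
  rw [logFactor]; linarith

theorem IsPath.L_le (h : IsPath P K A θ a aStar r ε) (hL : 1 ≤ P.L) :
    (P.L : ℝ) ≤ 2 * logFactor K A P.α P.δ := by
  obtain ⟨h1, h2, h3, h4⟩ :=
    logFactor_parts h.one_le_K h.A_nonneg h.α_pos h.δ_pos h.δ_lt
  have hα := h.α_pos
  have hpos : 0 < Real.logb 2 (1 / P.α) := Nat.ceil_pos.1 hL
  have h5 : (P.L : ℝ) < Real.logb 2 (1 / P.α) + 1 := Nat.ceil_lt_add_one hpos.le
  have h6 : Real.logb 2 (1 / P.α) ≤ 2 * Real.log (1 + 1 / P.α) := by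
    have h7 : Real.log (1 / P.α) ≤ Real.log (1 + 1 / P.α) :=
      Real.log_le_log (by positivity) (by linarith)
    rw [Real.logb, div_le_iff₀ (Real.log_pos (by norm_num))]
    have := Real.log_two_gt_d9
    nlinarith
  rw [logFactor]; linarith

theorem IsPath.logVar_le (h : IsPath P K A θ a aStar r ε) (hL : 1 ≤ P.L) :
    logVar P ≤ 5 * logFactor K A P.α P.δ := by
  obtain ⟨h1, h2, h3, h4⟩ :=
    logFactor_parts h.one_le_K h.A_nonneg h.α_pos h.δ_pos h.δ_lt
  have hw : (1 : ℝ) ≤ P.w := by exact_mod_cast h.one_le_w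
  have hwK : (P.w : ℝ) ≤ K := by exact_mod_cast h.w_le
  have hL0 : (0 : ℝ) < P.L := by exact_mod_cast hL
  have hδ := h.δ_pos
  have h5 := h.L_le hL
  have h6 := Real.log_le_sub_one_of_pos hL0
  have h7 := Real.log_two_lt_d9
  have h8 : logVar P ≤ 4 * Real.log 2 + 2 * Real.log K + Real.log P.L + Real.log (1 / P.δ) := by
    have h9 : 4 * Real.log 2 + 2 * Real.log K + Real.log P.L + Real.log (1 / P.δ) =
        Real.log (2 ^ 4 * (K : ℝ) ^ 2 * P.L * (1 / P.δ)) := by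
      have : (K : ℝ) ≠ 0 := by linarith
      rw [Real.log_mul (by positivity) (by positivity), Real.log_mul (by positivity) hL0.ne',
        Real.log_mul (by positivity) (by positivity), Real.log_pow, Real.log_pow]
      norm_num
    rw [h9]
    refine Real.log_le_log (by positivity) ?_
    rw [div_eq_mul_one_div]
    have h10 : 4 * ((P.w : ℝ) + 1) ^ 2 ≤ 2 ^ 4 * (K : ℝ) ^ 2 := by nlinarith
    gcongr
  have : logFactor K A P.α P.δ = 1 + Real.log K + Real.log (1 + A) + Real.log (1 + 1 / P.α)
    + Real.log (1 / P.δ) := rfl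
  linarith

theorem IsPath.log_potential_le (h : IsPath P K A θ a aStar r ε) (hL : 1 ≤ P.L) :
    Real.log (1 + P.w * A ^ 2 * (2 ^ P.L) ^ 2) ≤ 2 * logFactor K A P.α P.δ := by
  obtain ⟨h1, h2, h3, h4⟩ :=
    logFactor_parts h.one_le_K h.A_nonneg h.α_pos h.δ_pos h.δ_lt
  have hwK : (P.w : ℝ) ≤ K := by exact_mod_cast h.w_le
  have hK : (1 : ℝ) ≤ K := by exact_mod_cast h.one_le_K
  have hA := h.A_nonneg
  have hα := h.α_pos
  have h5 := two_pow_L_le hα hL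
  have h7 := Real.log_two_lt_d9
  have hi : 0 < 1 / P.α := by positivity
  have h8 : Real.log (1 + P.w * A ^ 2 * (2 ^ P.L) ^ 2) ≤
      2 * Real.log 2 + Real.log K + 2 * Real.log (1 + A) + 2 * Real.log (1 + 1 / P.α) := by
    have h9 : 2 * Real.log 2 + Real.log K + 2 * Real.log (1 + A) + 2 * Real.log (1 + 1 / P.α) =
        Real.log (2 ^ 2 * (K : ℝ) * (1 + A) ^ 2 * (1 + 1 / P.α) ^ 2) := by
      rw [Real.log_mul (by positivity) (by positivity), Real.log_mul (by positivity) (by positivity),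
        Real.log_mul (by positivity) (by positivity), Real.log_pow, Real.log_pow, Real.log_pow]
      norm_num
    rw [h9]
    refine Real.log_le_log (by positivity) ?_
    have h10 : ((2 : ℝ) ^ P.L) ^ 2 ≤ (2 / P.α) ^ 2 := pow_le_pow_left₀ (by positivity) h5 2
    calc 1 + P.w * A ^ 2 * (2 ^ P.L) ^ 2 ≤ 1 + K * A ^ 2 * (2 / P.α) ^ 2 := by gcongr
      _ = 1 + 4 * K * (A ^ 2 * (1 / P.α) ^ 2) := by ring
      _ ≤ 2 ^ 2 * (K : ℝ) * ((1 + A) ^ 2 * (1 + 1 / P.α) ^ 2) := by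
          have h11 : 1 + A ^ 2 * (1 / P.α) ^ 2 ≤ (1 + A) ^ 2 * (1 + 1 / P.α) ^ 2 := by
            rw [← mul_pow, ← mul_pow]
            have : 1 + A * (1 / P.α) ≤ (1 + A) * (1 + 1 / P.α) := by linarith
            have h12 : 0 ≤ A * (1 / P.α) := by positivity
            nlinarith [pow_le_pow_left₀ (by linarith) this 2]
          have := mul_le_mul_of_nonneg_left h11 (show 0 ≤ 4 * (K : ℝ) by linarith)
          linarith
      _ = _ := by ring
  have : logFactor K A P.α P.δ = 1 + Real.log K + Real.log (1 + A) + Real.log (1 + 1 / P.α)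
    + Real.log (1 / P.δ) := rfl
  linarith

/-- The regret of a good epoch. -/
theorem IsPath.epoch_regret_le (h : IsPath P K A θ a aStar r ε) (hd : 1 ≤ d) (hL : 1 ≤ P.L)
    (hgood : GoodEpoch P a r ε K m) :
    ∑ k ∈ epoch P.w K m, (inner ℝ (aStar k) (θ k) - inner ℝ (a k) (θ k)) ≤
      819200 * logFactor K A P.α P.δ ^ 3 * (P.w * P.α ^ 2 + d) *
        (√(epochEnergy ε P.w K m) + (P.R + P.Bmax)) +
      2080 * logFactor K A P.α P.δ * (A ^ 2 * (P.w * √P.w) / P.α) *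
        epochVariation θ P.w K m := by
  have hΛ := h.one_le_logFactor
  have hLle := h.L_le hL
  have hlv := h.logVar_le hL
  have hlp := h.log_potential_le hL
  have hα := h.α_pos
  have hA := h.A_nonneg
  have hd1 : (1 : ℝ) ≤ d := by exact_mod_cast hd
  set Λ := logFactor K A P.α P.δ with hΛdef
  have hΔ := epochVariation_nonneg θ P.w K m
  set Δ := epochVariation θ P.w K m
  have hBm : 0 ≤ P.Bmax := h.B_nonneg.trans (B_le_Bmax P)
  have hH : 0 ≤ √(epochEnergy ε P.w K m) + P.R + P.Bmax := by
    have := h.R_nonneg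
    positivity
  set H := √(epochEnergy ε P.w K m) + P.R + P.Bmax with hHdef
  have hlog0 : 0 ≤ logVar P := by
    have := (one_le_logConf h.one_le_w hL h.δ_pos h.δ_lt).trans
      (logConf_le_logVar h.one_le_w hL h.δ_pos)
    linarith
  have hsum : ∑ k ∈ epoch P.w K m, lev (roundLevel P a r k - 1) ^ 2 ≤
      40 * Λ ^ 2 * (P.w * P.α ^ 2 + d) := by
    refine h.sum_lev_sq_le.trans ?_
    have h1 : 4 * (2 * d * Real.log (1 + P.w * A ^ 2 * (2 ^ P.L) ^ 2) + 1) ≤ 20 * (d * Λ) := by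
      have h2 := mul_le_mul_of_nonneg_left hlp (show (0 : ℝ) ≤ d by linarith)
      nlinarith
    have h3 : (P.L : ℝ) * (4 * (2 * d * Real.log (1 + P.w * A ^ 2 * (2 ^ P.L) ^ 2) + 1)) ≤
        (2 * Λ) * (20 * (d * Λ)) :=
      (mul_le_mul_of_nonneg_left h1 (Nat.cast_nonneg _)).trans
        (mul_le_mul_of_nonneg_right hLle (by positivity))
    have h4 : P.w * P.α ^ 2 ≤ 40 * Λ ^ 2 * (P.w * P.α ^ 2) := by
      refine le_mul_of_one_le_left (by positivity) ?_
      nlinarith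
    linarith
  have hD : 208 * logVar P * (A * 2 ^ P.L * (√P.w * (A * Δ))) ≤
      2080 * Λ * (A ^ 2 * √P.w / P.α) * Δ := by
    have h5 := two_pow_L_le hα hL
    calc _ ≤ 208 * (5 * Λ) * (A * (2 / P.α) * (√P.w * (A * Δ))) := by gcongr
      _ = _ := by ring
  have hcard : ((epoch P.w K m).card : ℝ) ≤ P.w := by
    exact_mod_cast card_epoch_le h.one_le_w K m
  refine (Finset.sum_le_sum fun k hk => h.gap_le_of_good hL hgood hk).trans ?_
  rw [Finset.sum_add_distrib, ← Finset.mul_sum, Finset.sum_const, nsmul_eq_mul]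
  refine add_le_add ?_ ?_
  · calc _ ≤ 4096 * (5 * Λ) * H * (40 * Λ ^ 2 * (P.w * P.α ^ 2 + d)) := by gcongr
      _ = _ := by rw [hHdef]; ring
  · calc _ ≤ P.w * (2080 * Λ * (A ^ 2 * √P.w / P.α) * Δ) :=
          mul_le_mul hcard hD (by positivity) (Nat.cast_nonneg _)
      _ = _ := by ring

/-! ### Summation over the epochs -/

theorem sum_epoch_eq (w : ℕ) (K : ℕ) (f : ℕ → ℝ) :
    ∑ m ∈ Finset.range (K / w + 1), ∑ k ∈ epoch w K m, f k = ∑ k ∈ Finset.Icc 1 K, f k :=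
  Finset.sum_fiberwise_of_maps_to (fun _ hk => Finset.mem_range.2
    (Nat.lt_succ_of_le (Nat.div_le_div_right (Finset.mem_Icc.1 hk).2))) f

theorem sum_epochVariation_eq (w : ℕ) (K : ℕ) (θ : ℕ → Vec d) :
    ∑ m ∈ Finset.range (K / w + 1), epochVariation θ w K m =
      ∑ k ∈ Finset.Ico 1 K, ‖θ (k + 1) - θ k‖ :=
  Finset.sum_fiberwise_of_maps_to (fun _ hk => Finset.mem_range.2
    (Nat.lt_succ_of_le (Nat.div_le_div_right (Finset.mem_Ico.1 hk).2.le))) _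

theorem sum_sqrt_le {ι : Type*} (s : Finset ι) {f : ι → ℝ} (hf : ∀ i ∈ s, 0 ≤ f i) :
    ∑ i ∈ s, √(f i) ≤ √s.card * √(∑ i ∈ s, f i) := by
  have h := Real.sum_mul_le_sqrt_mul_sqrt s (fun _ => 1) (fun i => √(f i))
  simp only [one_mul, one_pow, Finset.sum_const, nsmul_eq_mul, mul_one] at h
  rwa [Finset.sum_congr rfl fun i hi => Real.sq_sqrt (hf i hi)] at h

/-- The regret bound, without the constant and the logarithmic factor. -/
noncomputable def regretBound (d K w : ℕ) (α A R BK VK : ℝ) : ℝ :=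
  A ^ 2 * √d * (w : ℝ) ^ (3 / 2 : ℝ) * BK / α + (w * α ^ 2 + d) * √(K / w * VK) +
    (1 + R) * (K * α ^ 2 + K * d / w)

theorem regretBound_nonneg {d K w : ℕ} {α A R BK VK : ℝ} (hα : 0 < α) (hR : 0 ≤ R)
    (hBK : 0 ≤ BK) : 0 ≤ regretBound d K w α A R BK VK := by
  unfold regretBound; positivity

/-- Here κ = K/w and N is the number of epochs; √(N · V) is what Cauchy–Schwarz leaves of the sum of
the square roots of the epoch energies. -/
theorem sqrt_energy_le {N κ V VK R Λ : ℝ} (hκ : 1 ≤ κ) (hΛ : 1 ≤ Λ) (hR : 0 ≤ R) (hVK : 0 ≤ VK)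
    (hN : N ≤ 2 * κ) (hV0 : 0 ≤ V) (hV : V ≤ 2 * VK + (1 + R) ^ 2 * Λ) :
    √(N * V) ≤ 2 * √(κ * VK) + 2 * κ * ((1 + R) * Λ) := by
  refine Real.sqrt_le_iff.2 ⟨by positivity, ?_⟩
  have h2 : N * V ≤ 2 * κ * (2 * VK + (1 + R) ^ 2 * Λ) := mul_le_mul hN hV hV0 (by linarith)
  have h3 : √(κ * VK) ^ 2 = κ * VK := Real.sq_sqrt (by positivity)
  have h4 : 2 * κ * ((1 + R) ^ 2 * Λ) ≤ (2 * κ * ((1 + R) * Λ)) ^ 2 := by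
    have h5 : 0 ≤ (1 + R) ^ 2 := sq_nonneg _
    have h6 : κ * Λ ≤ 2 * (κ ^ 2 * Λ ^ 2) := by
      have : 1 ≤ κ * Λ := one_le_mul_of_one_le_of_one_le hκ hΛ
      nlinarith
    have h7 := mul_le_mul_of_nonneg_left h6 h5
    calc _ = 2 * ((1 + R) ^ 2 * (κ * Λ)) := by ring
      _ ≤ 2 * ((1 + R) ^ 2 * (2 * (κ ^ 2 * Λ ^ 2))) := by linarith
      _ = _ := by ring
  have h5 : 0 ≤ √(κ * VK) * (2 * κ * ((1 + R) * Λ)) := by positivity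
  rw [add_sq, mul_pow, h3]
  linarith

theorem main_term_le {Λ E κ S N y R Bm : ℝ} (hΛ : 1 ≤ Λ) (hE : 0 ≤ E) (hκ : 0 ≤ κ) (hR : 0 ≤ R)
    (hBm : 2 ≤ Bm) (hN : N ≤ 2 * κ) (hy : 0 ≤ y) (hS : S ≤ 2 * y + 2 * κ * ((1 + R) * Λ)) :
    819200 * Λ ^ 3 * E * (S + N * (R + Bm)) ≤
      1638400 * (1 + Bm) * Λ ^ 4 * (E * y + (1 + R) * (κ * E)) := by
  have h1 : N * (R + Bm) ≤ 2 * κ * ((1 + R) * Bm) := by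
    refine mul_le_mul hN ?_ (by linarith) (by linarith)
    nlinarith
  have h2 : Λ + Bm ≤ Λ * (1 + Bm) := by nlinarith
  have h3 : y ≤ Λ * (1 + Bm) * y := by
    refine le_mul_of_one_le_left hy ?_
    exact one_le_mul_of_one_le_of_one_le hΛ (by linarith)
  have h4 : 2 * κ * ((1 + R) * Λ) + 2 * κ * ((1 + R) * Bm) ≤
      2 * κ * (1 + R) * (Λ * (1 + Bm)) := by
    have := mul_le_mul_of_nonneg_left h2 (show 0 ≤ 2 * κ * (1 + R) by positivity)
    linarith
  calc _ ≤ 819200 * Λ ^ 3 * E * (2 * (Λ * (1 + Bm) * y) +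
        2 * κ * (1 + R) * (Λ * (1 + Bm))) := by
        refine mul_le_mul_of_nonneg_left ?_ (by positivity)
        linarith
    _ = _ := by ring

theorem IsPath.regret_le (h : IsPath P K A θ a aStar r ε) (hd : 1 ≤ d) {BK VK : ℝ}
    (hVK : 0 ≤ VK) (hvar : ∑ k ∈ Finset.Ico 1 K, ‖θ (k + 1) - θ k‖ ≤ BK)
    (henergy : ∑ k ∈ Finset.Icc 1 K, ε k ^ 2 ≤ 2 * VK + (1 + P.R) ^ 2 * logFactor K A P.α P.δ)
    (bad : Finset ℕ) (hbad : bad ⊆ Finset.range (K / P.w + 1))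
    (hcard : bad.card * P.w ≤ K / P.w + 1)
    (hgood : 1 ≤ P.L → ∀ m ∈ Finset.range (K / P.w + 1), m ∉ bad → GoodEpoch P a r ε K m) :
    ∑ k ∈ Finset.Icc 1 K, (inner ℝ (aStar k) (θ k) - inner ℝ (a k) (θ k)) ≤
      (1638400 * (1 + P.Bmax) + 2084) * logFactor K A P.α P.δ ^ 4 *
        regretBound d K P.w P.α A P.R BK VK := by
  have hΛ := h.one_le_logFactor
  have hα := h.α_pos
  have hA := h.A_nonneg
  have hR := h.R_nonneg
  have hd1 : (1 : ℝ) ≤ d := by exact_mod_cast hd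
  have hw1 : (1 : ℝ) ≤ P.w := by exact_mod_cast h.one_le_w
  have hw0 : (0 : ℝ) < P.w := by linarith
  have hwK : (P.w : ℝ) ≤ K := by exact_mod_cast h.w_le
  have hBm : 2 ≤ P.Bmax := le_max_right _ _
  have hBK : 0 ≤ BK := (Finset.sum_nonneg fun _ _ => norm_nonneg _).trans hvar
  set Λ := logFactor K A P.α P.δ with hΛdef
  have hΛ4 : Λ ≤ Λ ^ 4 := le_self_pow₀ hΛ (by norm_num)
  set κ : ℝ := K / P.w with hκ
  have hκ1 : 1 ≤ κ := by rw [hκ, le_div_iff₀ hw0]; linarith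
  have hwκ : P.w * κ = K := by rw [hκ]; field_simp
  set X := A ^ 2 * √d * (P.w : ℝ) ^ (3 / 2 : ℝ) * BK / P.α with hX
  set Y := (P.w * P.α ^ 2 + d) * √(κ * VK) with hY
  set Z := (1 + P.R) * (K * P.α ^ 2 + K * d / P.w) with hZ
  have hZ' : Z = (1 + P.R) * (κ * (P.w * P.α ^ 2 + d)) := by rw [hZ, hκ]; field_simp
  have hX0 : 0 ≤ X := by positivity
  have hY0 : 0 ≤ Y := by positivity
  have hZ0 : 0 ≤ Z := by positivity
  have hbound : regretBound d K P.w P.α A P.R BK VK = X + Y + Z := rfl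
  rw [hbound]
  by_cases hL : 1 ≤ P.L
  swap
  -- Without layers α ≥ 1, so the trivial regret 2K is already below twice the term (1 + R)Kα².
  · have hL0 : P.L = 0 := by omega
    have h1 := one_div_le_two_pow_L hα
    rw [hL0, pow_zero, div_le_one hα] at h1
    have h2 : ∑ k ∈ Finset.Icc 1 K, (inner ℝ (aStar k) (θ k) - inner ℝ (a k) (θ k)) ≤ K * 2 := by
      refine (Finset.sum_le_card_nsmul _ _ _ h.gap_le).trans ?_
      simp
    have h3 : (K : ℝ) ≤ Z := by
      have h4 : (K : ℝ) ≤ K * P.α ^ 2 := le_mul_of_one_le_right (by linarith) (one_le_pow₀ h1)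
      have h5 : (K : ℝ) * P.α ^ 2 ≤ K * P.α ^ 2 + K * d / P.w := le_add_of_nonneg_right
        (by positivity)
      have h6 : K * P.α ^ 2 + K * d / P.w ≤ Z := le_mul_of_one_le_left (by positivity)
        (by linarith)
      linarith
    have h7 : 2 ≤ (1638400 * (1 + P.Bmax) + 2084) * Λ ^ 4 := by nlinarith
    calc _ ≤ 2 * Z := by linarith
      _ ≤ (1638400 * (1 + P.Bmax) + 2084) * Λ ^ 4 * (X + Y + Z) :=
        mul_le_mul h7 (by linarith) hZ0 (by linarith)
  set N := K / P.w + 1 with hN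
  have hNκ : (N : ℝ) ≤ 2 * κ := by
    have : ((K / P.w : ℕ) : ℝ) ≤ κ := Nat.cast_div_le
    rw [hN]; push_cast; linarith
  set E := P.w * P.α ^ 2 + (d : ℝ) with hE
  have hE0 : 0 ≤ E := by positivity
  have hterm : ∀ m ∈ Finset.range N,
      ∑ k ∈ epoch P.w K m, (inner ℝ (aStar k) (θ k) - inner ℝ (a k) (θ k)) ≤
      (819200 * Λ ^ 3 * E * (√(epochEnergy ε P.w K m) + (P.R + P.Bmax)) +
      2080 * Λ * (A ^ 2 * (P.w * √P.w) / P.α) * epochVariation θ P.w K m) +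
      if m ∈ bad then 2 * (P.w : ℝ) else 0 := by
    intro m hm
    have hΔ := epochVariation_nonneg θ P.w K m
    split_ifs with hmb
    · have h1 : ∑ k ∈ epoch P.w K m, (inner ℝ (aStar k) (θ k) - inner ℝ (a k) (θ k)) ≤
          P.w * 2 := by
        refine (Finset.sum_le_card_nsmul _ _ _ fun k hk => h.gap_le k (mem_epoch.1 hk).1).trans ?_
        rw [nsmul_eq_mul]
        have : ((epoch P.w K m).card : ℝ) ≤ P.w := by
          exact_mod_cast card_epoch_le h.one_le_w K m
        linarith
      have h2 : 0 ≤ 819200 * Λ ^ 3 * E * (√(epochEnergy ε P.w K m) + (P.R + P.Bmax)) +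
          2080 * Λ * (A ^ 2 * (P.w * √P.w) / P.α) * epochVariation θ P.w K m := by positivity
      linarith
    · rw [add_zero]
      exact h.epoch_regret_le hd hL (hgood hL m hm hmb)
  rw [← sum_epoch_eq P.w K]
  refine (Finset.sum_le_sum hterm).trans ?_
  rw [Finset.sum_add_distrib, Finset.sum_add_distrib, ← Finset.mul_sum, ← Finset.mul_sum,
    sum_epochVariation_eq, Finset.sum_add_distrib, Finset.sum_const, Finset.card_range,
    nsmul_eq_mul, Finset.sum_ite_mem, Finset.inter_eq_right.2 hbad, Finset.sum_const, nsmul_eq_mul]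
  -- A bad epoch costs at most 2w and there are at most N/w of them, hence 2N ≤ 4κ in total; κ ≤ Z
  -- uses d ≥ 1.
  have hbadle : (bad.card : ℝ) * (2 * P.w) ≤ 4 * Z := by
    have h1 : (bad.card : ℝ) * P.w ≤ N := by exact_mod_cast hcard
    have h2 : κ ≤ Z := by
      rw [hZ', ← mul_assoc, mul_comm (1 + P.R), mul_assoc]
      refine le_mul_of_one_le_right (by linarith) ?_
      have h3 : 1 ≤ E := by
        have : 0 ≤ P.w * P.α ^ 2 := by positivity
        linarith
      exact one_le_mul_of_one_le_of_one_le (by linarith) h3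
    linarith
  have hdrift : 2080 * Λ * (A ^ 2 * (P.w * √P.w) / P.α) *
      ∑ k ∈ Finset.Ico 1 K, ‖θ (k + 1) - θ k‖ ≤ 2080 * Λ ^ 4 * X := by
    have h1 : (P.w : ℝ) ^ (3 / 2 : ℝ) = P.w * √P.w := by
      rw [Real.sqrt_eq_rpow, ← Real.rpow_one_add' hw0.le (by norm_num)]
      norm_num
    -- The drift bound obtained has no √d; the factor is inserted only to match the stated bound.
    have h2 : 1 ≤ √(d : ℝ) := Real.one_le_sqrt.2 hd1
    calc _ ≤ 2080 * Λ ^ 4 * (A ^ 2 * (P.w * √P.w) / P.α) * BK := by gcongr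
      _ = 2080 * Λ ^ 4 * ((A ^ 2 * (P.w * √P.w) / P.α) * BK * 1) := by ring
      _ ≤ 2080 * Λ ^ 4 * ((A ^ 2 * (P.w * √P.w) / P.α) * BK * √d) := by gcongr
      _ = 2080 * Λ ^ 4 * X := by rw [hX, h1]; ring
  have hsqrt : ∑ m ∈ Finset.range N, √(epochEnergy ε P.w K m) ≤
      2 * √(κ * VK) + 2 * κ * ((1 + P.R) * Λ) := by
    refine (sum_sqrt_le _ fun m _ => Finset.sum_nonneg fun _ _ => sq_nonneg _).trans ?_
    rw [Finset.card_range, ← Real.sqrt_mul (Nat.cast_nonneg _), sum_epoch_eq P.w K fun k => ε k ^ 2]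
    exact sqrt_energy_le hκ1 hΛ hR hVK hNκ (Finset.sum_nonneg fun _ _ => sq_nonneg _) henergy
  have hmain : 819200 * Λ ^ 3 * E * (∑ m ∈ Finset.range N, √(epochEnergy ε P.w K m) +
      N * (P.R + P.Bmax)) ≤ 1638400 * (1 + P.Bmax) * Λ ^ 4 * (Y + Z) := by
    rw [hZ', hY]
    exact main_term_le hΛ hE0 (by linarith) hR hBm hNκ (Real.sqrt_nonneg _) hsqrt
  have h1 : 0 ≤ Λ ^ 4 * X := by positivity
  have h2 : 0 ≤ Λ ^ 4 * Y := by positivity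
  have h3 : Z ≤ Λ ^ 4 * Z := le_mul_of_one_le_left hZ0 (one_le_pow₀ hΛ)
  have h4 : 0 ≤ (1 + P.Bmax) * (Λ ^ 4 * X) := by positivity
  have h5 : (1638400 * (1 + P.Bmax) + 2084) * Λ ^ 4 * (X + Y + Z) =
      1638400 * (1 + P.Bmax) * Λ ^ 4 * (Y + Z) + 1638400 * ((1 + P.Bmax) * (Λ ^ 4 * X)) +
      2084 * (Λ ^ 4 * X) + 2084 * (Λ ^ 4 * Y) + 2084 * (Λ ^ 4 * Z) := by ring
  rw [h5]
  linarith

end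

/-! ### Probability of the exceptional events -/

section
variable {Ω : Type*} {m0 : MeasurableSpace Ω} {μ : Measure Ω} [IsProbabilityMeasure μ]

open Classical in
/-- If each of `N` events has probability at most `δ / w`, then, with probability at least `1 - δ`,
at most `N / w` of them occur. -/
theorem measureReal_card_gt_le {N w : ℕ} (hN : 1 ≤ N) (hw : 1 ≤ w) {δ : ℝ} (S : ℕ → Set Ω)
    (hS : ∀ m ∈ Finset.range N, μ.real (S m) ≤ δ / w) :
    μ.real {ω | N < ((Finset.range N).filter fun m => ω ∈ S m).card * w} ≤ δ := by
  -- Measurable hulls have the same measure and only enlarge the count, so Markov's inequality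
  -- applies without measurability of the bad events.
  set T : ℕ → Set Ω := fun m => toMeasurable μ (S m) with hT
  have hTm : ∀ m, MeasurableSet (T m) := fun m => measurableSet_toMeasurable μ (S m)
  have hTS : ∀ m, μ.real (T m) = μ.real (S m) := fun m => by
    rw [measureReal_def, measureReal_def, hT, measure_toMeasurable]
  have hN0 : (0 : ℝ) < N := by exact_mod_cast hN
  have hw0 : (0 : ℝ) < w := by exact_mod_cast hw
  set f : Ω → ℝ := fun ω => ∑ m ∈ Finset.range N, (T m).indicator (fun _ => (1 : ℝ)) ω with hf
  have hint : ∀ m ∈ Finset.range N, Integrable ((T m).indicator fun _ => (1 : ℝ)) μ :=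
    fun m _ => (integrable_const (1 : ℝ)).indicator (hTm m)
  have hfi : Integrable f μ := integrable_finsetSum _ hint
  have hf0 : ∀ ω, 0 ≤ f ω := fun ω => Finset.sum_nonneg fun m _ =>
    Set.indicator_nonneg (fun _ _ => zero_le_one) ω
  have hfint : ∫ ω, f ω ∂μ ≤ N * (δ / w) := by
    rw [hf, integral_finsetSum _ hint]
    refine (Finset.sum_le_card_nsmul _ _ (δ / w) fun m hm => ?_).trans (by simp)
    rw [integral_indicator_const _ (hTm m), smul_eq_mul, mul_one, hTS]
    exact hS m hm
  have hmk := mul_meas_ge_le_integral_of_nonneg (Filter.Eventually.of_forall hf0) hfi (N / w : ℝ)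
  have hsub : {ω | N < ((Finset.range N).filter fun m => ω ∈ S m).card * w} ⊆
      {ω | (N / w : ℝ) ≤ f ω} := by
    intro ω hω
    have h1 : (N : ℝ) < ((Finset.range N).filter fun m => ω ∈ S m).card * w := by
      exact_mod_cast hω
    change (N / w : ℝ) ≤ f ω
    rw [div_le_iff₀ hw0]
    refine h1.le.trans (mul_le_mul_of_nonneg_right ?_ hw0.le)
    rw [Finset.card_filter, Nat.cast_sum]
    refine Finset.sum_le_sum fun m _ => ?_
    split_ifs with h
    · rw [Set.indicator_of_mem (subset_toMeasurable μ _ h)]; simp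
    · rw [Nat.cast_zero]; exact Set.indicator_nonneg (fun _ _ => zero_le_one) ω
  have h2 := measureReal_mono hsub (measure_ne_top μ _)
  have h3 : N / w * μ.real {ω | N < ((Finset.range N).filter fun m => ω ∈ S m).card * w} ≤
      N * (δ / w) := (mul_le_mul_of_nonneg_left h2 (by positivity)).trans (hmk.trans hfint)
  have h4 : (N : ℝ) * (δ / w) = N / w * δ := by ring
  rw [h4] at h3
  exact le_of_mul_le_mul_left h3 (by positivity)

theorem holdsWithProb_of_compl {X : Ω → ℝ} {c p : ℝ} (S : Set Ω) (hS : μ.real S ≤ 1 - p)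
    (h : ∀ ω ∉ S, X ω ≤ c) : HoldsWithProb μ p X c := by
  refine ⟨(toMeasurable μ S)ᶜ, (measurableSet_toMeasurable μ S).compl, ?_, fun ω hω =>
    h ω fun h' => hω (subset_toMeasurable μ S h')⟩
  rw [← ofReal_measureReal]
  refine ENNReal.ofReal_le_ofReal ?_
  rw [probReal_compl_eq_one_sub (measurableSet_toMeasurable μ S), measureReal_def,
    measure_toMeasurable, ← measureReal_def]
  linarith

end

theorem HoldsWithProb.mono {Ω : Type*} [MeasurableSpace Ω] {μ : Measure Ω} {X : Ω → ℝ}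
    {c c' p : ℝ} (h : HoldsWithProb μ p X c) (hc : c ≤ c') :
    HoldsWithProb μ p X c' := by
  obtain ⟨G, h1, h2, h3⟩ := h
  exact ⟨G, h1, h2, fun ω hω => (h3 ω hω).trans hc⟩

theorem IsBandit.BK_nonneg {Ω : Type*} [MeasurableSpace Ω] {μ : Measure Ω} {d K : ℕ}
    {A B R BK VK : ℝ} {θ : ℕ → Vec d} {D : ℕ → Ω → Set (Vec d)} {a aStar : ℕ → Ω → Vec d}
    {ε σ : ℕ → Ω → ℝ} (h : IsBandit μ K A B R BK VK θ D a aStar ε σ) : 0 ≤ BK :=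
  (Finset.sum_nonneg fun _ _ => norm_nonneg _).trans h.variation

section
variable {Ω : Type*} [MeasurableSpace Ω] {μ : Measure Ω} [IsProbabilityMeasure μ]
  {d K : ℕ} {A B R BK VK : ℝ} {θ : ℕ → Vec d} {D : ℕ → Ω → Set (Vec d)}
  {a aStar : ℕ → Ω → Vec d} {ε σ : ℕ → Ω → ℝ}

theorem IsBandit.R_nonneg (h : IsBandit μ K A B R BK VK θ D a aStar ε σ) (hK : 1 ≤ K) : 0 ≤ R := by
  obtain ⟨ω, hω⟩ := (h.noise_bdd 1 (Finset.mem_Icc.2 ⟨le_rfl, hK⟩)).exists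
  exact (abs_nonneg _).trans hω

theorem IsBandit.A_nonneg (h : IsBandit μ K A B R BK VK θ D a aStar ε σ) (hK : 1 ≤ K) : 0 ≤ A := by
  obtain ⟨ω⟩ : Nonempty Ω := nonempty_of_isProbabilityMeasure μ
  have h1 : 1 ∈ Finset.Icc 1 K := Finset.mem_Icc.2 ⟨le_rfl, hK⟩
  exact (norm_nonneg _).trans (h.norm_arm 1 h1 ω _ (h.arm_mem 1 h1 ω))

theorem IsBandit.VK_nonneg (h : IsBandit μ K A B R BK VK θ D a aStar ε σ) : 0 ≤ VK := by
  obtain ⟨ω, hω⟩ := h.variance.exists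
  exact (Finset.sum_nonneg fun _ _ => sq_nonneg _).trans hω

/-- The sum of the squares of the noise is controlled by the total variance. -/
theorem IsBandit.exists_energy_event (h : IsBandit μ K A B R BK VK θ D a aStar ε σ) (hK : 1 ≤ K)
    {δ : ℝ} (hδ : 0 < δ) : ∃ S : Set Ω, μ.real S ≤ δ ∧ ∀ᵐ ω ∂μ, ω ∉ S →
      ∑ k ∈ Finset.Icc 1 K, ε k ω ^ 2 ≤ 2 * VK + (1 + R) ^ 2 * Real.log (1 / δ) := by
  have hR := h.R_nonneg hK
  -- Rather than R⁻², so that s R² ≤ 1 and s > 0 also when R = 0.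
  set s : ℝ := ((1 + R) ^ 2)⁻¹ with hs
  have hs0 : 0 < s := by positivity
  obtain ⟨h1, h2⟩ := integral_exp_sum_sq_sub_le (μ := μ) (F := history a ε) (K := K) (ε := ε)
    (R := R) (s := s) (n := K + 1) (history_le h.measurable_arm h.measurable_noise) history_mono
    measurable_noise_history h.measurable_noise h.noise_bdd hs0.le
    (by rw [hs, inv_mul_le_iff₀ (by positivity), mul_one]
        exact pow_le_pow_left₀ hR (by linarith) 2) (by omega) le_rfl
  refine ⟨_, (measureReal_le_of_integral_exp_le_one (Γ := Real.log (1 / δ)) h1 h2).trans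
    (le_of_eq ?_), ?_⟩
  · rw [one_div, Real.log_inv, neg_neg, Real.exp_log hδ]
  · have hall : ∀ᵐ ω ∂μ, ∀ k ∈ Finset.Icc 1 K,
        (μ[fun ω => ε k ω ^ 2 | history a ε k]) ω = σ k ω ^ 2 :=
      (Finset.eventually_all _).2 fun k hk => h.noise_var k hk
    filter_upwards [hall, h.variance] with ω hω hV hS
    change ¬ (_ ≤ _) at hS
    rw [not_le, Finset.sum_sub_distrib, ← Finset.mul_sum, ← Finset.mul_sum] at hS
    have hIcc : Finset.Ico 1 (K + 1) = Finset.Icc 1 K := rfl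
    rw [hIcc, Finset.sum_congr rfl hω] at hS
    have h3 : s * ∑ k ∈ Finset.Icc 1 K, ε k ω ^ 2 ≤
        s * (2 * VK + (1 + R) ^ 2 * Real.log (1 / δ)) := by
      have h4 : s * (2 * VK + (1 + R) ^ 2 * Real.log (1 / δ)) =
          2 * s * VK + Real.log (1 / δ) := by
        rw [hs]; field_simp
      rw [h4]
      have := mul_le_mul_of_nonneg_left hV (show 0 ≤ 2 * s by positivity)
      linarith
    exact le_of_mul_le_mul_left h3 hs0

/-- Each epoch is good outside of an event of small probability. -/
theorem IsBandit.exists_bad_event {w : ℕ} {α δ : ℝ}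
    (h : IsBandit μ K A B R BK VK θ D a aStar ε σ) (hK : 1 ≤ K) (hw : 1 ≤ w) (hδ : 0 < δ)
    (hδ1 : δ < 1) (hL : 1 ≤ Params.L ⟨w, α, B, R, δ⟩) (m : ℕ) :
    ∃ S : Set Ω, μ.real S ≤ δ / w ∧ ∀ ω, (∀ k ∈ Finset.Icc 1 K, |ε k ω| ≤ R) → ω ∉ S →
      GoodEpoch ⟨w, α, B, R, δ⟩ (fun i => a i ω) (reward θ a ε ω) (fun i => ε i ω) K m := by
  rcases (h.R_nonneg hK).eq_or_lt with hR | hR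
  · refine ⟨∅, by rw [measureReal_empty]; positivity, fun ω hω _ => ?_⟩
    exact goodEpoch_of_R_eq_zero _ _ _ _ hR.symm hω
  · refine ⟨_, measureReal_badEpoch_le (P := ⟨w, α, B, R, δ⟩) θ hw hL hδ hδ1 h.measurable_arm
      h.measurable_noise h.noise_bdd h.noise_mean hR m, fun ω hω hS => ?_⟩
    exact goodEpoch_of_forall _ _ _ _ hw hL hδ hδ1 hR hω (not_not.1 hS)

theorem IsBandit.isPath {w : ℕ} {α δ : ℝ} (h : IsBandit μ K A B R BK VK θ D a aStar ε σ)
    (hf : FollowsAlgorithm ⟨w, α, B, R, δ⟩ K θ D a ε) (hw : 1 ≤ w) (hwK : w ≤ K) (hα : 0 < α)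
    (hδ : 0 < δ) (hδ1 : δ < 1) {ω : Ω} (hω : ∀ k ∈ Finset.Icc 1 K, |ε k ω| ≤ R) :
    IsPath ⟨w, α, B, R, δ⟩ K A θ (fun i => a i ω) (fun i => aStar i ω) (reward θ a ε ω)
      (fun i => ε i ω) where
  one_le_w := hw
  w_le := hwK
  α_pos := hα
  δ_pos := hδ
  δ_lt := hδ1
  R_nonneg := h.R_nonneg (hw.trans hwK)
  reward_eq _ := rfl
  noise_le := hω
  feature_le := h.norm_feature
  arm_le k hk := h.norm_arm k hk ω _ (h.arm_mem k hk ω)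
  star_le k hk := h.norm_arm k hk ω _ (h.star_mem k hk ω)
  gap_le k hk := by
    have h1 := (h.mean_reward k hk ω _ (h.star_mem k hk ω)).2
    have h2 := (h.mean_reward k hk ω _ (h.arm_mem k hk ω)).1
    linarith
  index_le k hk := hf k hk ω (h.star_mem k hk ω)

open Classical in
/-- The dynamic regret bound with explicit constants. -/
theorem IsBandit.regret_bound {w : ℕ} {α δ : ℝ} (h : IsBandit μ K A B R BK VK θ D a aStar ε σ)
    (hf : FollowsAlgorithm ⟨w, α, B, R, δ⟩ K θ D a ε) (hw : 1 ≤ w) (hwK : w ≤ K) (hα : 0 < α)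
    (hδ : 0 < δ) (hδ1 : δ < 1) :
    HoldsWithProb μ (1 - 3 * δ) (regret K θ a aStar)
      ((1638400 * (1 + max B 2) + 2084) * logFactor K A α δ ^ 4 *
        regretBound d K w α A R BK VK) := by
  have hK : 1 ≤ K := hw.trans hwK
  have hR := h.R_nonneg hK
  have hA := h.A_nonneg hK
  obtain ⟨l1, l2, l3, l4⟩ := logFactor_parts hK hA hα hδ hδ1
  -- In dimension 0 all arms coincide and the regret vanishes; the remaining argument needs d ≥ 1.
  rcases Nat.eq_zero_or_pos d with hd | hd
  · subst hd
    refine holdsWithProb_of_compl ∅ (by rw [measureReal_empty]; linarith) fun ω _ => ?_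
    have h0 : regret K θ a aStar ω = 0 := Finset.sum_eq_zero fun k _ => by
      rw [Subsingleton.elim (aStar k ω) (a k ω), sub_self]
    rw [h0]
    have h1 := regretBound_nonneg (d := 0) (K := K) (w := w) (A := A) (VK := VK) hα hR h.BK_nonneg
    have h2 : 0 ≤ logFactor K A α δ := by rw [logFactor]; linarith
    have h3 : (2 : ℝ) ≤ max B 2 := le_max_right _ _
    positivity
  obtain ⟨S1, hS1, hE⟩ := h.exists_energy_event hK hδ
  have hbad : ∀ m : ℕ, ∃ S : Set Ω, μ.real S ≤ δ / w ∧ (1 ≤ Params.L ⟨w, α, B, R, δ⟩ →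
      ∀ ω, (∀ k ∈ Finset.Icc 1 K, |ε k ω| ≤ R) → ω ∉ S →
      GoodEpoch ⟨w, α, B, R, δ⟩ (fun i => a i ω) (reward θ a ε ω) (fun i => ε i ω) K m) := by
    intro m
    by_cases hL : 1 ≤ Params.L ⟨w, α, B, R, δ⟩
    · obtain ⟨S, h1, h2⟩ := h.exists_bad_event hK hw hδ hδ1 hL m
      exact ⟨S, h1, fun _ => h2⟩
    · exact ⟨∅, by rw [measureReal_empty]; positivity, fun hL' => absurd hL' hL⟩
  choose S hS hSgood using hbad
  set N := K / w + 1 with hN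
  have hmarkov := measureReal_card_gt_le (μ := μ) (N := N) (Nat.le_add_left 1 _) hw S fun m _ => hS m
  have hnoise : ∀ᵐ ω ∂μ, ∀ k ∈ Finset.Icc 1 K, |ε k ω| ≤ R :=
    (Finset.eventually_all _).2 h.noise_bdd
  set S2 := {ω | N < ((Finset.range N).filter fun m => ω ∈ S m).card * w} with hS2
  set S0 := {ω | ¬ ((∀ k ∈ Finset.Icc 1 K, |ε k ω| ≤ R) ∧ (ω ∉ S1 →
      ∑ k ∈ Finset.Icc 1 K, ε k ω ^ 2 ≤ 2 * VK + (1 + R) ^ 2 * Real.log (1 / δ)))} with hS0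
  have hS0m : μ.real S0 = 0 := by
    rw [measureReal_def]
    have : μ S0 = 0 := ae_iff.1 (hnoise.and hE)
    rw [this]; rfl
  -- The three events have probability 0, at most δ and at most δ, which is within the allowed 3δ.
  refine holdsWithProb_of_compl (S0 ∪ (S1 ∪ S2)) ?_ fun ω hω => ?_
  · have h1 := measureReal_union_le (μ := μ) S0 (S1 ∪ S2)
    have h2 := measureReal_union_le (μ := μ) S1 S2
    linarith
  · simp only [Set.mem_union, not_or] at hω
    obtain ⟨hω0, hω1, hω2⟩ := hω
    obtain ⟨hb, hen⟩ := not_not.1 hω0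
    have hpath := h.isPath hf hw hwK hα hδ hδ1 hb
    refine hpath.regret_le hd h.VK_nonneg h.variation ((hen hω1).trans ?_)
      ((Finset.range N).filter fun m => ω ∈ S m) (Finset.filter_subset _ _) (not_lt.1 hω2)
      fun hL m hm hmb => hSgood m hL ω hb fun hmS => hmb (Finset.mem_filter.2 ⟨hm, hmS⟩)
    have : Real.log (1 / δ) ≤ logFactor K A α δ := by rw [logFactor]; linarith
    have := mul_le_mul_of_nonneg_left this (sq_nonneg (1 + R))
    linarith

end

/-! ### Absorbing A and R into the constant -/

theorem logFactor_le {K : ℕ} {A α δ : ℝ} (h1 : 0 ≤ Real.log K) (h2 : 0 ≤ Real.log (1 + A))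
    (h3 : 0 ≤ Real.log (1 + 1 / α)) (h4 : 0 ≤ Real.log (1 / δ)) :
    logFactor K A α δ ≤ (1 + Real.log (1 + A)) *
      (1 + Real.log K + Real.log (1 + 1 / α) + Real.log (1 / δ)) := by
  rw [logFactor]
  nlinarith [mul_nonneg h2 h1, mul_nonneg h2 h3, mul_nonneg h2 h4]

/-- Since w√(KV_K/w) = √(wKV_K), the first bound regroups into the terms of the second, each with a
coefficient at most (1 + A²)(1 + R). -/
theorem regretBound_le {d K w : ℕ} {α A R BK VK : ℝ} (hw : 1 ≤ w) (hα : 0 < α) (hR : 0 ≤ R)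
    (hBK : 0 ≤ BK) : regretBound d K w α A R BK VK ≤ ((1 + A ^ 2) * (1 + R)) *
      (√d * (w : ℝ) ^ (3 / 2 : ℝ) * BK / α + α ^ 2 * (K + √(w * K * VK))
        + d * √(K * VK / w) + d * K / w) := by
  have hw0 : (0 : ℝ) < w := by exact_mod_cast hw
  set X := √d * (w : ℝ) ^ (3 / 2 : ℝ) * BK / α with hX
  have hX0 : 0 ≤ X := by positivity
  have h1 : w * √(K / w * VK) = √(w * K * VK) := by
    nth_rewrite 1 [← Real.sqrt_sq hw0.le]
    rw [← Real.sqrt_mul (sq_nonneg _)]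
    congr 1
    field_simp
  have h2 : (K : ℝ) / w * VK = K * VK / w := by ring
  have h3 : regretBound d K w α A R BK VK = A ^ 2 * X + (α ^ 2 * √(w * K * VK) +
      d * √(K * VK / w)) + (1 + R) * (α ^ 2 * K + d * K / w) := by
    rw [regretBound, ← h1, hX, h2]; ring
  rw [h3]
  set Y := α ^ 2 * √(w * K * VK) + d * √(K * VK / w) with hY
  set Z := α ^ 2 * K + d * K / w with hZ
  have hY0 : 0 ≤ Y := by positivity
  have hZ0 : 0 ≤ Z := by positivity
  have h4 : X + α ^ 2 * (K + √(w * K * VK)) + d * √(K * VK / w) + d * K / w = X + Y + Z := by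
    rw [hY, hZ]; ring
  rw [h4]
  have hA : 0 ≤ A ^ 2 := sq_nonneg A
  have e1 := mul_nonneg hA hX0
  have e2 := mul_nonneg hA hY0
  have e3 := mul_nonneg hA hZ0
  have e4 : 0 ≤ R * (X + Y) := by positivity
  have e5 : 0 ≤ R * (A ^ 2 * (X + Y + Z)) := by positivity
  linarith

end RestartedSAVE

theorem mainTheorem3 :
    ∃ p : ℕ,
      -- constants hidden in the first bound depend only on `B`
      (∀ B : ℝ, ∃ C : ℝ,
        ∀ (Ω : Type*) [MeasurableSpace Ω] (μ : MeasureTheory.Measure Ω)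
          [MeasureTheory.IsProbabilityMeasure μ]
          (d K w : ℕ) (α δ A R BK VK : ℝ)
          (θ : ℕ → RestartedSAVE.Vec d) (D : ℕ → Ω → Set (RestartedSAVE.Vec d))
          (a aStar : ℕ → Ω → RestartedSAVE.Vec d) (ε σ : ℕ → Ω → ℝ),
          1 ≤ w → w ≤ K → 0 < α → 0 < δ → δ < 1 →
          RestartedSAVE.IsBandit μ K A B R BK VK θ D a aStar ε σ →
          RestartedSAVE.FollowsAlgorithm ⟨w, α, B, R, δ⟩ K θ D a ε →
          RestartedSAVE.HoldsWithProb μ (1 - 3 * δ) (RestartedSAVE.regret K θ a aStar)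
            (C * (1 + Real.log K + Real.log (1 + A) + Real.log (1 + 1 / α)
                + Real.log (1 / δ)) ^ p *
              (A ^ 2 * Real.sqrt d * (w : ℝ) ^ (3 / 2 : ℝ) * BK / α
                + (w * α ^ 2 + d) * Real.sqrt (K / w * VK)
                + (1 + R) * (K * α ^ 2 + K * d / w)))) ∧
      -- the special case where `A` and `R` are also regarded as constants
      (∀ A B R : ℝ, ∃ C : ℝ,
        ∀ (Ω : Type*) [MeasurableSpace Ω] (μ : MeasureTheory.Measure Ω)
          [MeasureTheory.IsProbabilityMeasure μ]
          (d K w : ℕ) (α δ BK VK : ℝ)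
          (θ : ℕ → RestartedSAVE.Vec d) (D : ℕ → Ω → Set (RestartedSAVE.Vec d))
          (a aStar : ℕ → Ω → RestartedSAVE.Vec d) (ε σ : ℕ → Ω → ℝ),
          1 ≤ w → w ≤ K → 0 < α → 0 < δ → δ < 1 →
          RestartedSAVE.IsBandit μ K A B R BK VK θ D a aStar ε σ →
          RestartedSAVE.FollowsAlgorithm ⟨w, α, B, R, δ⟩ K θ D a ε →
          RestartedSAVE.HoldsWithProb μ (1 - 3 * δ) (RestartedSAVE.regret K θ a aStar)
            (C * (1 + Real.log K + Real.log (1 + 1 / α) + Real.log (1 / δ)) ^ p *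
              (Real.sqrt d * (w : ℝ) ^ (3 / 2 : ℝ) * BK / α
                + α ^ 2 * (K + Real.sqrt (w * K * VK))
                + d * Real.sqrt (K * VK / w) + d * K / w))) := by
  -- The exponent 4 is three logarithms from the epoch bound (`logVar`, L and the potential) and one
  -- from the log(1/δ) in the noise energy.
  refine ⟨4, fun B => ⟨1638400 * (1 + max B 2) + 2084, ?_⟩, fun A B R =>
    ⟨(1638400 * (1 + max B 2) + 2084) * (1 + Real.log (1 + A)) ^ 4 * ((1 + A ^ 2) * (1 + R)), ?_⟩⟩
  · intro Ω _ μ _ d K w α δ A R BK VK θ D a aStar ε σ hw hwK hα hδ hδ1 hb hf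
    exact hb.regret_bound hf hw hwK hα hδ hδ1
  · intro Ω _ μ _ d K w α δ BK VK θ D a aStar ε σ hw hwK hα hδ hδ1 hb hf
    have hK : 1 ≤ K := hw.trans hwK
    have hR := hb.R_nonneg hK
    have hA := hb.A_nonneg hK
    obtain ⟨l1, l2, l3, l4⟩ := RestartedSAVE.logFactor_parts hK hA hα hδ hδ1
    refine (hb.regret_bound hf hw hwK hα hδ hδ1).mono ?_
    have hC : (0 : ℝ) ≤ 1638400 * (1 + max B 2) + 2084 := by
      have : (2 : ℝ) ≤ max B 2 := le_max_right _ _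
      positivity
    have h1 := RestartedSAVE.logFactor_le (K := K) (α := α) (δ := δ) l1 l2 l3 l4
    have h2 := RestartedSAVE.regretBound_le (d := d) (K := K) (A := A) (VK := VK) hw hα hR hb.BK_nonneg
    have h0 : 0 ≤ RestartedSAVE.logFactor K A α δ := by rw [RestartedSAVE.logFactor]; linarith
    refine (mul_le_mul (mul_le_mul_of_nonneg_left (pow_le_pow_left₀ h0 h1 4) hC) h2
      (RestartedSAVE.regretBound_nonneg hα hR hb.BK_nonneg) (by positivity)).trans (le_of_eq ?_)
    rw [mul_pow]
    ring
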